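/- Let $\nabla^\perp=(-\partial_2,\partial_1)$ on $\mathbb R^2$ and $(-\Delta)^{-1/2}f(x)=\frac1{2\pi}\int_{\mathbb R^2}\frac{f(y)}{|x-y|}\,dy$. Let $\theta$ be a classical solution on $\mathbb R^2\times[0,T)$ of the SQG equation $$\theta_t+u\cdot\nabla\theta=0,\qquad u=\nabla^\perp(-\Delta)^{-1/2}\theta,$$ that is, $\theta$ is $C^2$ on $[0,T)\times\mathbb R^2$ and, on each $[0,T']$ with $T'<T$, $|\theta(\cdot,t)|$ is dominated by one integrable function of $x$ and the first and second space derivatives of $\theta$ are bounded. Write $\Omega(t)=\|\nabla^\perp\theta(\cdot,t)\|_{L^\infty}$ and let $0\le T_0<T$. (i) For all $K$ and $m>1$ there is a constant $C_u>0$, depending only on $K$ and $m$, such that $$\|u(\cdot,t)\|_{L^\infty}\le C_u\log\Omega(t)\quad\text{for } t\in[T_0,T)\tag{1}$$ for all such $\theta$, $T$, $T_0$ with $\|\theta(\cdot,0)\|_{L^1}\le K$, $\|\theta(\cdot,0)\|_{L^\infty}\le K$, and $\Omega(t)\ge m$ on $[T_0,T)$. (ii) Let $C_u>0$ be any constant for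 which (1) holds. Let $L^t=\{x(s,t):0\le s\le L(t)\}$, $t\in[T_0,T)$, be a family of segments of one and the same level set of $\theta$, on which $\nabla^\perp\theta\ne0$. Here $s$ is arclength, with $\partial_s x=\sigma\xi$, $\xi=\nabla^\perp\theta/|\nabla^\perp\theta|$, for a fixed sign $\sigma\in\{1,-1\}$; the length $L(t)>0$ and the point $x(0,t)$ are differentiable in $t$, and $L$ is non-increasing. Put $\kappa=|\xi\cdot\nabla\xi|$, $\tau=\nabla\cdot\xi$, $$\Omega_L(t)=\max_{L^t}|\nabla^\perp\theta|,\qquad V(t)=\max_{L^t}|u\cdot\xi|,\qquad Q(t)=\frac1{L(t)}\int_0^{L(t)}|\nabla^\perp\theta(x(s,t),t)|\,ds .$$ Assume that there are constants $0<c_0\le1$, $C_0>0$, $C_l>0$ such that for all $t\in[T_0,T)$ $$\Omega_L(t)\ge c_0\Omega(t),\qquad |\nabla^\perp\theta(x(L(t),t),t)|=\Omega_L(t),$$ $$\int_{L^t}|\kappa|\,ds\le C_0,\qquad\int_{L^t}|\tau|\,ds\le C_0,\qquad \Big|\frac{dx(0,t)}{dt}\cdot\xi(x(0,t),t)\Big|\le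 C_lV(t).$$ Then for all $t\in[T_0,T)$ $$\Omega(t)\le\exp\left(\log\left(\frac{C_1}{c_0}Q(T_0)\right)\exp\left(\int_{T_0}^t\frac{C}{L(t')}\,dt'\right)\right),$$ where $C_1=e^{C_0}$, $C_U=C_0(2C_1-1)$, $C_V=2C_0C_1+(C_1-1)(C_l+1)+2C_1$ and $C=C_u\max(C_U,C_V)$. -/

import Mathlib

open Set MeasureTheory

noncomputable section

/-- The plane `ℝ²` with its Euclidean norm. -/
abbrev Plane : Type := EuclideanSpace ℝ (Fin 2)

/-- The rotated gradient `∇^⊥ f = (-∂₂ f, ∂₁ f)`. -/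
def gradPerp (f : Plane → ℝ) (x : Plane) : Plane :=
  !₂[-(gradient f x 1), gradient f x 0]

/-- `(-Δ)^{-1/2} f` on `ℝ²`, as the Riesz potential of order one,
`(1 / 2π) ∫ f(y) / |x - y| dy`. -/
def invSqrtLaplacian (f : Plane → ℝ) (x : Plane) : ℝ :=
  (1 / (2 * Real.pi)) * ∫ y : Plane, f y / ‖x - y‖

/-- The velocity `u = ∇^⊥ (-Δ)^{-1/2} f` generated by the scalar `f`. -/
def sqgVelocity (f : Plane → ℝ) : Plane → Plane :=
  gradPerp (invSqrtLaplacian f)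

/-- `θ t x` is a classical solution on `[0, T)` of `θ_t + u · ∇θ = 0`,
`u = ∇^⊥ (-Δ)^{-1/2} θ`: it is twice continuously differentiable in time and space and, uniformly
on compact time intervals, it has an integrable majorant and bounded first and second space
derivatives. -/
structure IsSQGSolution (θ : ℝ → Plane → ℝ) (T : ℝ) : Prop where
  contDiff : ContDiffOn ℝ 2 (fun p : ℝ × Plane => θ p.1 p.2) (Ico 0 T ×ˢ univ)
  bounds : ∀ T' < T, ∃ (g : Plane → ℝ) (B : ℝ), Integrable g ∧
    ∀ t ∈ Icc 0 T', ∀ x,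
      |θ t x| ≤ g x ∧ ‖fderiv ℝ (θ t) x‖ ≤ B ∧ ‖iteratedFDeriv ℝ 2 (θ t) x‖ ≤ B
  transport : ∀ t ∈ Ico 0 T, ∀ x,
    derivWithin (fun r => θ r x) (Ico 0 T) t
      + inner ℝ (sqgVelocity (θ t) x) (gradient (θ t) x) = 0

/-- `‖∇^⊥ f‖_{L^∞}`. -/
def supGradPerp (f : Plane → ℝ) : ℝ := ⨆ x : Plane, ‖gradPerp f x‖

/-- The unit tangent field `ξ = ∇^⊥ f / |∇^⊥ f|` of the level sets of `f`. -/
def unitTangent (f : Plane → ℝ) (x : Plane) : Plane :=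
  ‖gradPerp f x‖⁻¹ • gradPerp f x

/-- The unsigned curvature `κ = |ξ · ∇ξ|`. -/
def levelCurvature (f : Plane → ℝ) (x : Plane) : ℝ :=
  ‖fderiv ℝ (unitTangent f) x (unitTangent f x)‖

/-- The divergence `τ = ∇ · ξ`. -/
def tangentDivergence (f : Plane → ℝ) (x : Plane) : ℝ :=
  ∑ i : Fin 2, fderiv ℝ (unitTangent f) x (EuclideanSpace.single i 1) i

/-- `L^t = {x t s : 0 ≤ s ≤ L t}`, `T₀ ≤ t < T`, is a family of segments of one and the same level
set of `θ`, on which `∇^⊥θ` does not vanish; `s` is the arclength, measured along `ξ` or against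
`ξ`, and the length `L t > 0` and the initial point `x t 0` are differentiable in `t`. -/
structure IsLevelSegmentFamily (θ : ℝ → Plane → ℝ) (T₀ T : ℝ)
    (x : ℝ → ℝ → Plane) (L : ℝ → ℝ) : Prop where
  length_pos : ∀ t ∈ Ico T₀ T, 0 < L t
  length_diff : DifferentiableOn ℝ L (Ico T₀ T)
  start_diff : DifferentiableOn ℝ (fun t => x t 0) (Ico T₀ T)
  same_level : ∃ c : ℝ, ∀ t ∈ Ico T₀ T, ∀ s ∈ Icc 0 (L t), θ t (x t s) = c
  gradPerp_ne : ∀ t ∈ Ico T₀ T, ∀ s ∈ Icc 0 (L t), gradPerp (θ t) (x t s) ≠ 0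
  arclength : ∃ σ : ℝ, (σ = 1 ∨ σ = -1) ∧ ∀ t ∈ Ico T₀ T, ∀ s ∈ Icc 0 (L t),
    HasDerivWithinAt (x t) (σ • unitTangent (θ t) (x t s)) (Icc 0 (L t)) s

/-- The maximum of `|∇^⊥ f|` on the curve `γ` over `[0, l]`. -/
def segmentMax (f : Plane → ℝ) (γ : ℝ → Plane) (l : ℝ) : ℝ :=
  sSup ((fun s => ‖gradPerp f (γ s)‖) '' Icc 0 l)

/-- The maximum of `|u · ξ|` on the curve `γ` over `[0, l]`. -/
def segmentTangentialSpeed (f : Plane → ℝ) (γ : ℝ → Plane) (l : ℝ) : ℝ :=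
  sSup ((fun s => |inner ℝ (sqgVelocity f (γ s)) (unitTangent f (γ s))|) '' Icc 0 l)

/-- The mean of `|∇^⊥ f|` on the curve `γ` over `[0, l]`. -/
def segmentMean (f : Plane → ℝ) (γ : ℝ → Plane) (l : ℝ) : ℝ :=
  (1 / l) * ∫ s in (0 : ℝ)..l, ‖gradPerp f (γ s)‖

/-- `‖u(t)‖_{L^∞} ≤ C_u log ‖∇^⊥θ(t)‖_{L^∞}` for `T₀ ≤ t < T`, with `C_u > 0`. -/
def IsVelocityConstant (θ : ℝ → Plane → ℝ) (T₀ T Cu : ℝ) : Prop :=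
  0 < Cu ∧ ∀ t ∈ Ico T₀ T, ∀ x, ‖sqgVelocity (θ t) x‖ ≤ Cu * Real.log (supGradPerp (θ t))

/-- `C_1 = exp C_0`. -/
def constOne (C₀ : ℝ) : ℝ := Real.exp C₀

/-- `C_U = C_0 (2 C_1 - 1)`. -/
def constU (C₀ : ℝ) : ℝ := C₀ * (2 * constOne C₀ - 1)

/-- `C_V = 2 C_0 C_1 + (C_1 - 1) (C_l + 1) + 2 C_1`. -/
def constV (C₀ Cl : ℝ) : ℝ :=
  2 * C₀ * constOne C₀ + (constOne C₀ - 1) * (Cl + 1) + 2 * constOne C₀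

end

/-! Velocity bound. Split the kernel `1/|z|` into a core `1/|z| - (|z|²+δ²)^{-1/2}` and a smooth
remainder. The core is integrable, and by scaling its `L¹` norm is `δ` times a constant, so putting
the derivative on `θ` there costs `O(δΩ)`. In the remainder the derivative falls on the kernel and
leaves one of size at most `(|z|²+δ²)^{-1}`. Its part with `|z| < 1` contributes `‖θ‖_∞ log(1+δ⁻²)`;
its part with `|z| ≥ 1` is square integrable and is paired with `‖θ‖_{L²}`. With `δ = 1/Ω` the total
is `O(1 + log Ω)`, and `Ω ≥ m > 1` lets `log Ω` absorb the constant. The sup norm is controlled by a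
maximum principle, the `L²` norm by the divergence-free transport tested against cutoffs; at time
zero `‖θ‖²_{L²} ≤ ‖θ‖_∞ ‖θ‖_{L¹} ≤ K²`.

Growth estimate. Write `ω = |∇^⊥θ|`. Since `∇^⊥θ = ωξ` is divergence free, `ξ·∇ω = -τω`; hence `∫|τ|
≤ C₀` makes all values of `ω` on a segment comparable up to `C₁ = e^{C₀}`, and `Ω ≤ (C₁/c₀) Q`. It
remains to bound `Q'`.

Rescale each segment to `r ∈ [0,1]`. Only `L` and the start point are assumed differentiable in
time, but this determines the motion of every point: the normal velocity is that of the flow,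
because each point stays on one level set of a transported scalar, and the tangential speed `b`
follows by integrating `∂_r b = L'σ + (∂_r ξ)·u` from the start point. A Gronwall comparison of
nearby segments supplies the Lipschitz bounds behind these limits (`exists_lipschitz`,
`tendsto_inner_gradient`, `tendsto_inner_unitTangent`).

Along the motion `ω` changes by stretching `ω ξ·∇u ξ` and by slip `(b - u·ξ) ξ·∇ω`. Integration over
the segment moves the derivative off `u` (`mul_integral_growth_eq`): boundary values, curvature and
divergence terms remain, all bounded by a constant times `‖u‖_∞ Q`, together with `L'(ω(1) - Q)`,
which is nonpositive because `L' ≤ 0` and `ω` is largest at the end. Thus `Q' ≤ C_V ‖u‖_∞ Q / L`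
(`integral_growth_le`). As `‖u‖_∞ ≤ C_u log Ω ≤ C_u log((C₁/c₀)Q)`, the quantity `y = log((C₁/c₀)Q)`
satisfies a linear inequality `y' ≤ (C/L) y`, whose integration gives the double exponential. -/

open Filter Topology

/-! ### Averages of translates -/

section ShiftAverage

variable {F : Type*} [NormedAddCommGroup F] [NormedSpace ℝ F]

/-- The convolution `∫ k(z) f(x - z) dz` of a scalar and a vector-valued function. -/
noncomputable def shiftAverage (k : Plane → ℝ) (f : Plane → F) (x : Plane) : F :=
  ∫ z, k z • f (x - z)

lemma integrable_smul_shift {k : Plane → ℝ} {f : Plane → F} {C : ℝ} (hk : Integrable k)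
    (hf : Continuous f) (hC : ∀ x, ‖f x‖ ≤ C) (x : Plane) :
    Integrable fun z => k z • f (x - z) := by
  have hc : Continuous fun z => f (x - z) := by fun_prop
  refine (hk.norm.mul_const C).mono' (hk.aestronglyMeasurable.smul hc.aestronglyMeasurable)
    (Eventually.of_forall fun z => ?_)
  rw [norm_smul]
  gcongr
  exact hC _

lemma norm_shiftAverage_le {k : Plane → ℝ} {f : Plane → F} {C : ℝ} (hk : Integrable k)
    (hC : ∀ x, ‖f x‖ ≤ C) (x : Plane) : ‖shiftAverage k f x‖ ≤ (∫ z, |k z|) * C := by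
  rw [← integral_mul_const]
  refine norm_integral_le_of_norm_le (hk.norm.mul_const C) (Eventually.of_forall fun z => ?_)
  rw [norm_smul]
  exact mul_le_mul_of_nonneg_left (hC _) (norm_nonneg _)

lemma continuous_shiftAverage {k : Plane → ℝ} {f : Plane → F} {C : ℝ} (hk : Integrable k)
    (hf : Continuous f) (hC : ∀ x, ‖f x‖ ≤ C) : Continuous (shiftAverage k f) := by
  refine continuous_of_dominated (bound := fun z => ‖k z‖ * C)
    (fun x => (integrable_smul_shift hk hf hC x).aestronglyMeasurable) (fun x => ?_)
    (hk.norm.mul_const C) (Eventually.of_forall fun z => by fun_prop)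
  refine Eventually.of_forall fun z => ?_
  rw [norm_smul]
  gcongr
  exact hC _

/-- The weight `k` is only integrable, so the derivative goes to the bounded factor `f`. Both roles
occur: `k` the core kernel with `f` the scalar, and `k` the scalar with `f` the smooth kernel. -/
lemma hasFDerivAt_shiftAverage {k : Plane → ℝ} {f : Plane → F} {f' : Plane → Plane →L[ℝ] F}
    {C C' : ℝ} (hk : Integrable k) (hf : ∀ x, HasFDerivAt f (f' x) x) (hf' : Continuous f')
    (hC : ∀ x, ‖f x‖ ≤ C) (hC' : ∀ x, ‖f' x‖ ≤ C') (x : Plane) :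
    HasFDerivAt (shiftAverage k f) (shiftAverage k f' x) x := by
  have hfc : Continuous f := continuous_iff_continuousAt.2 fun x => (hf x).continuousAt
  refine hasFDerivAt_integral_of_dominated_of_fderiv_le (s := univ)
    (F := fun x z => k z • f (x - z)) (F' := fun x z => k z • f' (x - z))
    (bound := fun z => ‖k z‖ * C') univ_mem
    (Eventually.of_forall fun y => (integrable_smul_shift hk hfc hC y).aestronglyMeasurable)
    (integrable_smul_shift hk hfc hC x)
    (integrable_smul_shift hk hf' hC' x).aestronglyMeasurable ?_ (hk.norm.mul_const C') ?_
  · refine Eventually.of_forall fun z y _ => ?_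
    rw [norm_smul]
    gcongr
    exact hC' _
  · refine Eventually.of_forall fun z y _ => ?_
    have h := (hf (y - z)).comp y ((hasFDerivAt_id y).sub_const z)
    exact h.const_smul (k z)

lemma hasGradientAt_shiftAverage {k : Plane → ℝ} {f : Plane → ℝ} {f' : Plane → Plane}
    {C C' : ℝ} (hk : Integrable k) (hf : ∀ x, HasGradientAt f (f' x) x) (hf' : Continuous f')
    (hC : ∀ x, |f x| ≤ C) (hC' : ∀ x, ‖f' x‖ ≤ C') (x : Plane) :
    HasGradientAt (shiftAverage k f) (shiftAverage k f' x) x := by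
  have hd : Continuous fun x => InnerProductSpace.toDual ℝ Plane (f' x) := by fun_prop
  have hb : ∀ x, ‖InnerProductSpace.toDual ℝ Plane (f' x)‖ ≤ C' := fun x => by
    simpa using hC' x
  have h := hasFDerivAt_shiftAverage hk (fun x => (hf x).hasFDerivAt) hd hC hb x
  rw [hasGradientAt_iff_hasFDerivAt]
  refine h.congr_fderiv ?_
  ext v
  change (∫ z, k z • InnerProductSpace.toDual ℝ Plane (f' (x - z))) v = _
  rw [shiftAverage,
    ContinuousLinearMap.integral_apply (integrable_smul_shift hk hd hb x),
    InnerProductSpace.toDual_apply_apply, real_inner_comm,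
    ← integral_inner (integrable_smul_shift hk hf' hC' x)]
  refine integral_congr_ae (Eventually.of_forall fun z => ?_)
  simp [inner_smul_right, real_inner_comm]

end ShiftAverage

/-! ### The regularized kernel -/

/-- The smooth kernel `(|z|² + δ²)^{-1/2}`. -/
noncomputable def smoothKernel (δ : ℝ) (z : Plane) : ℝ := (√(‖z‖ ^ 2 + δ ^ 2))⁻¹

/-- The gradient of `smoothKernel`. -/
noncomputable def smoothKernelGrad (δ : ℝ) (z : Plane) : Plane := -((√(‖z‖ ^ 2 + δ ^ 2))⁻¹ ^ 3) • z

/-- The derivative of `smoothKernelGrad`. -/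
noncomputable def smoothKernelHess (δ : ℝ) (z : Plane) : Plane →L[ℝ] Plane :=
  -((√(‖z‖ ^ 2 + δ ^ 2))⁻¹ ^ 3) • ContinuousLinearMap.id ℝ Plane +
    ((3 * (√(‖z‖ ^ 2 + δ ^ 2))⁻¹ ^ 5) • innerSL ℝ z).smulRight z

/-- The integrable remainder `1 / |z| - (|z|² + δ²)^{-1/2}`. -/
noncomputable def coreKernel (δ : ℝ) (z : Plane) : ℝ := ‖z‖⁻¹ - smoothKernel δ z

section Kernel
variable {δ : ℝ}

lemma sqrt_norm_sq_add_pos (hδ : 0 < δ) (z : Plane) : 0 < √(‖z‖ ^ 2 + δ ^ 2) := by positivity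

lemma hasFDerivAt_smoothKernel (hδ : 0 < δ) (z : Plane) :
    HasFDerivAt (smoothKernel δ) (-((√(‖z‖ ^ 2 + δ ^ 2))⁻¹ ^ 3) • innerSL ℝ z) z := by
  have h0 := sqrt_norm_sq_add_pos hδ z
  have h1 : HasFDerivAt (fun z : Plane => ‖z‖ ^ 2 + δ ^ 2) (2 • innerSL ℝ z) z :=
    (hasStrictFDerivAt_norm_sq z).hasFDerivAt.add_const _
  have h2 := (hasDerivAt_inv h0.ne').comp_hasFDerivAt z (h1.sqrt (by positivity))
  refine h2.congr_fderiv ?_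
  ext v
  simp
  field_simp

lemma hasGradientAt_smoothKernel (hδ : 0 < δ) (z : Plane) :
    HasGradientAt (smoothKernel δ) (smoothKernelGrad δ z) z := by
  rw [hasGradientAt_iff_hasFDerivAt]
  refine (hasFDerivAt_smoothKernel hδ z).congr_fderiv ?_
  ext v
  simp [smoothKernelGrad]

lemma hasFDerivAt_smoothKernelGrad (hδ : 0 < δ) (z : Plane) :
    HasFDerivAt (smoothKernelGrad δ) (smoothKernelHess δ z) z := by
  have h1 := (((hasFDerivAt_smoothKernel hδ z).pow 3).neg).smul (hasFDerivAt_id z)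
  refine h1.congr_fderiv ?_
  ext1 v
  simp only [smoothKernelHess, smoothKernel]
  simp
  congr 1
  ring

lemma continuous_smoothKernelHess (hδ : 0 < δ) : Continuous (smoothKernelHess δ) := by
  have h0 := sqrt_norm_sq_add_pos hδ
  have h1 : Continuous fun z : Plane => (√(‖z‖ ^ 2 + δ ^ 2))⁻¹ :=
    Continuous.inv₀ (by fun_prop) fun z => (h0 z).ne'
  have h2 : Continuous fun z : Plane =>
      ((3 * (√(‖z‖ ^ 2 + δ ^ 2))⁻¹ ^ 5) • innerSL ℝ z : Plane →L[ℝ] ℝ) :=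
    ((h1.pow 5).const_mul 3).smul (innerSL ℝ).continuous
  exact (((h1.pow 3).neg).smul continuous_const).add
    (((ContinuousLinearMap.smulRightL ℝ Plane Plane).continuous.comp h2).clm_apply continuous_id)

lemma inv_sqrt_mul_norm_le_one (hδ : 0 < δ) (z : Plane) :
    (√(‖z‖ ^ 2 + δ ^ 2))⁻¹ * ‖z‖ ≤ 1 := by
  have h0 := sqrt_norm_sq_add_pos hδ z
  rw [inv_mul_le_iff₀ h0, mul_one]
  exact Real.le_sqrt_of_sq_le (by nlinarith)

lemma smoothKernel_nonneg (z : Plane) : 0 ≤ smoothKernel δ z := by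
  unfold smoothKernel; positivity

lemma smoothKernel_le (hδ : 0 < δ) (z : Plane) : smoothKernel δ z ≤ δ⁻¹ := by
  unfold smoothKernel
  gcongr
  exact Real.le_sqrt_of_sq_le (by nlinarith [sq_nonneg ‖z‖])

lemma norm_smoothKernelGrad_le_inv_sq (hδ : 0 < δ) (z : Plane) :
    ‖smoothKernelGrad δ z‖ ≤ (‖z‖ ^ 2 + δ ^ 2)⁻¹ := by
  have h1 := inv_sqrt_mul_norm_le_one hδ z
  have h2 : (‖z‖ ^ 2 + δ ^ 2)⁻¹ = ((√(‖z‖ ^ 2 + δ ^ 2))⁻¹) ^ 2 := by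
    rw [inv_pow, Real.sq_sqrt (by positivity)]
  rw [smoothKernelGrad, norm_smul, norm_neg, Real.norm_of_nonneg (by positivity), h2, pow_succ,
    mul_assoc]
  exact mul_le_of_le_one_right (by positivity) h1

lemma inv_sq_add_le (hδ : 0 < δ) (z : Plane) : (‖z‖ ^ 2 + δ ^ 2)⁻¹ ≤ (δ⁻¹) ^ 2 := by
  rw [inv_pow]
  gcongr
  nlinarith [sq_nonneg ‖z‖]

lemma norm_smoothKernelGrad_le (hδ : 0 < δ) (z : Plane) : ‖smoothKernelGrad δ z‖ ≤ (δ⁻¹) ^ 2 :=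
  (norm_smoothKernelGrad_le_inv_sq hδ z).trans (inv_sq_add_le hδ z)

lemma norm_smoothKernelHess_le (hδ : 0 < δ) (z : Plane) :
    ‖smoothKernelHess δ z‖ ≤ 4 * (δ⁻¹) ^ 3 := by
  have h1 := inv_sqrt_mul_norm_le_one hδ z
  have h3 := smoothKernel_le hδ z
  unfold smoothKernel at h3
  set q := (√(‖z‖ ^ 2 + δ ^ 2))⁻¹ with hq
  refine (norm_add_le _ _).trans ?_
  have e1 : ‖-(q ^ 3) • ContinuousLinearMap.id ℝ Plane‖ ≤ q ^ 3 := by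
    rw [norm_smul, norm_neg, Real.norm_of_nonneg (by positivity)]
    exact mul_le_of_le_one_right (by positivity) ContinuousLinearMap.norm_id_le
  have e2 : ‖((3 * q ^ 5) • innerSL ℝ z).smulRight z‖ ≤ 3 * q ^ 3 := by
    rw [ContinuousLinearMap.norm_smulRight_apply, norm_smul, innerSL_apply_norm,
      Real.norm_of_nonneg (by positivity)]
    -- Two of the five powers of `q` absorb the two factors `‖z‖` of the rank-one term.
    have : (q * ‖z‖) ^ 2 ≤ 1 := pow_le_one₀ (by positivity) h1
    calc 3 * q ^ 5 * ‖z‖ * ‖z‖ = 3 * q ^ 3 * (q * ‖z‖) ^ 2 := by ring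
      _ ≤ 3 * q ^ 3 := mul_le_of_le_one_right (by positivity) this
  have e3 : q ^ 3 ≤ (δ⁻¹) ^ 3 := by gcongr
  linarith

lemma finrank_plane : Module.finrank ℝ Plane = 2 := by simp

/-- In polar coordinates the integrand is `(s - r)/s` with `s = √(r²+1)`. Since `(s - r)(s + r) =
1`, it is at most `1/s² = 1/(1+r²)`. -/
lemma integrable_coreKernel_one : Integrable (coreKernel 1) := by
  have h := (integrable_fun_norm_addHaar (volume : Measure Plane)
    (f := fun r : ℝ => r⁻¹ - (√(r ^ 2 + 1 ^ 2))⁻¹)).2 ?_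
  · exact h
  rw [finrank_plane]
  refine (integrable_inv_one_add_sq.integrableOn (s := Ioi 0)).mono' ?_ ?_
  · refine (ContinuousOn.aestronglyMeasurable ?_ measurableSet_Ioi)
    refine ContinuousOn.smul (continuous_pow _).continuousOn (ContinuousOn.sub ?_ ?_)
    · exact continuousOn_inv₀.mono fun r (hr : 0 < r) => hr.ne'
    · exact ContinuousOn.inv₀ (by fun_prop) fun r _ => by positivity
  · refine (ae_restrict_iff' measurableSet_Ioi).2 (Eventually.of_forall fun r (hr : 0 < r) => ?_)
    have hs : 0 < √(r ^ 2 + 1 ^ 2) := by positivity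
    have hq : √(r ^ 2 + 1 ^ 2) ^ 2 = r ^ 2 + 1 := by rw [Real.sq_sqrt (by positivity)]; ring
    set s := √(r ^ 2 + 1 ^ 2) with hs'
    have hrs : r ≤ s := Real.le_sqrt_of_sq_le (by nlinarith)
    have e : r ^ (2 - 1) • (r⁻¹ - s⁻¹) = (s - r) / s := by
      rw [smul_eq_mul, show 2 - 1 = 1 from rfl, pow_one]; field_simp
    rw [e, Real.norm_of_nonneg (div_nonneg (by linarith) hs.le), show 1 + r ^ 2 = s ^ 2 by linarith,
      ← one_div, div_le_div_iff₀ hs (by positivity)]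
    nlinarith

lemma coreKernel_eq (hδ : 0 < δ) (z : Plane) :
    coreKernel δ z = δ⁻¹ * coreKernel 1 (δ⁻¹ • z) := by
  have e : √(‖z‖ ^ 2 + δ ^ 2) = δ * √((δ⁻¹ * ‖z‖) ^ 2 + 1 ^ 2) := by
    rw [← Real.sqrt_sq hδ.le, ← Real.sqrt_mul (by positivity), Real.sqrt_sq hδ.le]
    congr 1
    field_simp
  rw [coreKernel, coreKernel, smoothKernel, smoothKernel, norm_smul, norm_inv,
    Real.norm_of_nonneg hδ.le, e, mul_sub, mul_inv, mul_inv, inv_inv,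
    inv_mul_cancel_left₀ hδ.ne']

lemma integrable_coreKernel (hδ : 0 < δ) : Integrable (coreKernel δ) := by
  have h := (integrable_coreKernel_one.comp_smul (inv_ne_zero hδ.ne')).const_mul δ⁻¹
  exact h.congr (Eventually.of_forall fun z => (coreKernel_eq hδ z).symm)

/-- The kernel is homogeneous of degree `-1` jointly in `z` and `δ`, and the area element
contributes `δ²`. This smallness in `δ` compensates the factor `Ω` from the gradient of the scalar.
-/
lemma integral_abs_coreKernel (hδ : 0 < δ) :
    ∫ z, |coreKernel δ z| = δ * ∫ z, |coreKernel 1 z| := by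
  simp_rw [coreKernel_eq hδ, abs_mul]
  rw [integral_const_mul, Measure.integral_comp_smul volume (fun z => |coreKernel 1 z|),
    finrank_plane, abs_of_pos (inv_pos.2 hδ), smul_eq_mul, ← mul_assoc]
  congr 1
  rw [abs_of_pos (by positivity)]
  field_simp

lemma integrableOn_inv_sq_add (hδ : 0 < δ) :
    IntegrableOn (fun z : Plane => (‖z‖ ^ 2 + δ ^ 2)⁻¹) (Metric.ball 0 1) := by
  refine Measure.integrableOn_of_bounded (M := (δ⁻¹) ^ 2) measure_ball_lt_top.ne ?_ ?_
  · exact (Continuous.inv₀ (by fun_prop) fun z => by positivity).aestronglyMeasurable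
  · refine Eventually.of_forall fun z => ?_
    rw [Real.norm_of_nonneg (by positivity)]
    exact inv_sq_add_le hδ z

/-- Source of the logarithm: in polar coordinates this is `2|B₁| ∫₀¹ r/(r²+δ²) dr`. -/
lemma setIntegral_inv_sq_add (hδ : 0 < δ) :
    ∫ z in Metric.ball (0 : Plane) 1, (‖z‖ ^ 2 + δ ^ 2)⁻¹ =
      volume.real (Metric.ball (0 : Plane) 1) * Real.log (1 + (δ⁻¹) ^ 2) := by
  have e1 : ∫ z in Metric.ball (0 : Plane) 1, (‖z‖ ^ 2 + δ ^ 2)⁻¹ =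
      ∫ z : Plane, (Iio (1 : ℝ)).indicator (fun r => (r ^ 2 + δ ^ 2)⁻¹) ‖z‖ := by
    rw [← integral_indicator measurableSet_ball]
    refine integral_congr_ae (Eventually.of_forall fun z => ?_)
    simp [indicator]
  have e2 : ∫ y in Ioi (0 : ℝ), y ^ (2 - 1) • (Iio (1 : ℝ)).indicator
      (fun r => (r ^ 2 + δ ^ 2)⁻¹) y = ∫ y in (0 : ℝ)..1, y / (y ^ 2 + δ ^ 2) := by
    rw [intervalIntegral.integral_of_le zero_le_one, ← integral_Ioc_eq_integral_Ioo.symm,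
      ← integral_indicator measurableSet_Ioi, ← integral_indicator measurableSet_Ioo]
    refine integral_congr_ae (Eventually.of_forall fun y => ?_)
    by_cases h0 : 0 < y <;> by_cases h1 : y < 1 <;> simp [indicator, h0, h1, div_eq_mul_inv]
  have e3 : ∫ y in (0 : ℝ)..1, y / (y ^ 2 + δ ^ 2) =
      Real.log (1 ^ 2 + δ ^ 2) / 2 - Real.log (0 ^ 2 + δ ^ 2) / 2 := by
    refine intervalIntegral.integral_eq_sub_of_hasDerivAt
      (f := fun y => Real.log (y ^ 2 + δ ^ 2) / 2) (fun y _ => ?_) ?_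
    · have h : HasDerivAt (fun y : ℝ => y ^ 2 + δ ^ 2) (2 * y) y := by
        simpa using (hasDerivAt_pow 2 y).add_const (δ ^ 2)
      convert! (h.log (by positivity)).div_const 2 using 1
      field_simp
    · refine Continuous.intervalIntegrable ?_ _ _
      exact Continuous.div (by fun_prop) (by fun_prop) fun y => by positivity
  rw [e1, integral_fun_norm_addHaar, finrank_plane, e2, e3]
  have e4 : Real.log (1 + (δ⁻¹) ^ 2) = Real.log (1 ^ 2 + δ ^ 2) - Real.log (0 ^ 2 + δ ^ 2) := by
    rw [← Real.log_div (by positivity) (by positivity)]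
    congr 1
    field_simp
    ring
  rw [e4]
  simp only [nsmul_eq_mul, smul_eq_mul]
  push_cast
  ring

/-- A square-integrable majorant of `|z|⁻²` away from the origin. -/
lemma inv_sq_add_sq_le (δ : ℝ) {z : Plane} (hz : 1 ≤ ‖z‖) :
    ((‖z‖ ^ 2 + δ ^ 2)⁻¹) ^ 2 ≤ 16 * (1 + ‖z‖) ^ (-(4 : ℝ)) := by
  have e : (1 + ‖z‖) ^ (-(4 : ℝ)) = ((1 + ‖z‖) ^ 4)⁻¹ := by
    rw [Real.rpow_neg (by positivity)]
    norm_cast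
  have h1 : (‖z‖ ^ 2 + δ ^ 2)⁻¹ ≤ (‖z‖ ^ 2)⁻¹ := by
    gcongr
    nlinarith [sq_nonneg δ]
  rw [e]
  calc ((‖z‖ ^ 2 + δ ^ 2)⁻¹) ^ 2 ≤ ((‖z‖ ^ 2)⁻¹) ^ 2 := by gcongr
    _ = 16 * ((2 * ‖z‖) ^ 4)⁻¹ := by field_simp; norm_num
    _ ≤ 16 * ((1 + ‖z‖) ^ 4)⁻¹ := by gcongr; linarith

lemma integrable_one_add_norm_four : Integrable fun z : Plane => (1 + ‖z‖) ^ (-(4 : ℝ)) :=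
  integrable_one_add_norm (by rw [finrank_plane]; norm_num)

lemma continuous_smoothKernel (hδ : 0 < δ) : Continuous (smoothKernel δ) :=
  continuous_iff_continuousAt.2 fun z => (hasFDerivAt_smoothKernel hδ z).continuousAt

lemma continuous_smoothKernelGrad (hδ : 0 < δ) : Continuous (smoothKernelGrad δ) :=
  continuous_iff_continuousAt.2 fun z => (hasFDerivAt_smoothKernelGrad hδ z).continuousAt

lemma abs_smoothKernel_le (hδ : 0 < δ) (z : Plane) : |smoothKernel δ z| ≤ δ⁻¹ := by
  rw [abs_of_nonneg (smoothKernel_nonneg z)]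
  exact smoothKernel_le hδ z

lemma invSqrtLaplacian_eq {f : Plane → ℝ} {C : ℝ} (hδ : 0 < δ) (hf : Continuous f)
    (hC : ∀ x, |f x| ≤ C) (hi : Integrable f) (x : Plane) :
    invSqrtLaplacian f x = (1 / (2 * Real.pi)) *
      (shiftAverage (coreKernel δ) f x + shiftAverage f (smoothKernel δ) x) := by
  have e1 : ∫ y : Plane, f y / ‖x - y‖ = ∫ z : Plane, f (x - z) / ‖z‖ := by
    rw [← integral_sub_left_eq_self _ volume x]
    simp
  have e2 : shiftAverage f (smoothKernel δ) x = ∫ z, smoothKernel δ z • f (x - z) := by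
    rw [shiftAverage, ← integral_sub_left_eq_self _ volume x]
    simp [mul_comm]
  have i2 : Integrable fun z => smoothKernel δ z • f (x - z) := by
    have := (integrable_smul_shift hi (continuous_smoothKernel hδ)
      (abs_smoothKernel_le hδ) x).comp_sub_left x
    refine this.congr (Eventually.of_forall fun z => ?_)
    simp [mul_comm]
  rw [invSqrtLaplacian, e1, e2, shiftAverage,
    ← integral_add (integrable_smul_shift (integrable_coreKernel hδ) hf hC x) i2]
  congr 1
  refine integral_congr_ae (Eventually.of_forall fun z => ?_)
  simp only [coreKernel, smul_eq_mul]
  ring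

end Kernel

/-! ### Gradients and their rotation -/

/-- The inner product of the plane as a continuous linear map into the dual. -/
noncomputable def innerMap : Plane →L[ℝ] Plane →L[ℝ] ℝ := innerSL ℝ

/-- The Riesz isomorphism from the dual of the plane. -/
noncomputable def rieszMap : (Plane →L[ℝ] ℝ) →L[ℝ] Plane :=
  (InnerProductSpace.toDual ℝ Plane).symm.toContinuousLinearEquiv.toContinuousLinearMap

lemma gradient_eq_rieszMap (f : Plane → ℝ) (x : Plane) :
    gradient f x = rieszMap (fderiv ℝ f x) := rfl

lemma norm_rieszMap (φ : Plane →L[ℝ] ℝ) : ‖rieszMap φ‖ = ‖φ‖ :=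
  (InnerProductSpace.toDual ℝ Plane).symm.norm_map φ

lemma inner_rieszMap (φ : Plane →L[ℝ] ℝ) (v : Plane) : inner ℝ (rieszMap φ) v = φ v :=
  InnerProductSpace.toDual_symm_apply

lemma norm_rieszMap_le : ‖rieszMap‖ ≤ 1 :=
  ContinuousLinearMap.opNorm_le_bound _ zero_le_one fun φ => by rw [norm_rieszMap, one_mul]

lemma norm_gradient (f : Plane → ℝ) (x : Plane) : ‖gradient f x‖ = ‖fderiv ℝ f x‖ :=
  norm_rieszMap _

lemma inner_gradient (f : Plane → ℝ) (x v : Plane) : inner ℝ (gradient f x) v = fderiv ℝ f x v :=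
  inner_rieszMap _ _

/-- Rotation of the plane by a right angle. -/
noncomputable def rot : Plane →L[ℝ] Plane :=
  LinearMap.toContinuousLinearMap
    { toFun := fun v => !₂[-(v 1), v 0]
      map_add' := fun v w => by ext i; fin_cases i <;> simp [add_comm]
      map_smul' := fun c v => by ext i; fin_cases i <;> simp }

@[simp] lemma rot_apply_zero (v : Plane) : rot v 0 = -(v 1) := rfl
@[simp] lemma rot_apply_one (v : Plane) : rot v 1 = v 0 := rfl

lemma gradPerp_eq_rot (f : Plane → ℝ) (x : Plane) : gradPerp f x = rot (gradient f x) := rfl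

lemma inner_plane (v w : Plane) : inner ℝ v w = v 0 * w 0 + v 1 * w 1 := by
  simp [PiLp.inner_apply, Fin.sum_univ_two, mul_comm]

lemma inner_rot_rot (v w : Plane) : inner ℝ (rot v) (rot w) = inner ℝ v w := by
  simp only [inner_plane, rot_apply_zero, rot_apply_one]; ring

lemma norm_rot (v : Plane) : ‖rot v‖ = ‖v‖ := by
  rw [← sq_eq_sq₀ (norm_nonneg _) (norm_nonneg _), ← real_inner_self_eq_norm_sq,
    ← real_inner_self_eq_norm_sq, inner_rot_rot]

lemma norm_gradPerp (f : Plane → ℝ) (x : Plane) : ‖gradPerp f x‖ = ‖fderiv ℝ f x‖ := by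
  rw [gradPerp_eq_rot, norm_rot, norm_gradient]

/-- The trace of a linear map of the plane. -/
noncomputable def planeTrace (A : Plane →L[ℝ] Plane) : ℝ :=
  ∑ i : Fin 2, A (EuclideanSpace.single i 1) i

lemma planeTrace_eq (A : Plane →L[ℝ] Plane) :
    planeTrace A = A (EuclideanSpace.single 0 1) 0 + A (EuclideanSpace.single 1 1) 1 := by
  simp [planeTrace, Fin.sum_univ_two]

/-- For `A` a Hessian this is the identity `∇·∇^⊥ = 0`. It gives incompressibility of both the
velocity and `∇^⊥θ`. -/
lemma planeTrace_rot_comp {A : Plane →L[ℝ] Plane} (hA : ∀ v w, inner ℝ (A v) w = inner ℝ (A w) v) :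
    planeTrace (rot.comp A) = 0 := by
  have h := hA (EuclideanSpace.single 0 1) (EuclideanSpace.single 1 1)
  simp only [inner_plane] at h
  simp at h
  simp [planeTrace_eq, h]

lemma apply_eq_sum (A : Plane →L[ℝ] Plane) (v : Plane) :
    A v = v 0 • A (EuclideanSpace.single 0 1) + v 1 • A (EuclideanSpace.single 1 1) := by
  rw [← map_smul, ← map_smul, ← map_add]
  congr 1
  ext i; fin_cases i <;> simp

/-- For a trace-free `A`, the quadratic form changes sign under rotation. -/
lemma inner_rot_apply_rot {A : Plane →L[ℝ] Plane} (hA : planeTrace A = 0) (v : Plane) :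
    inner ℝ (rot v) (A (rot v)) = -inner ℝ v (A v) := by
  rw [planeTrace_eq] at hA
  rw [apply_eq_sum A (rot v), apply_eq_sum A v]
  simp only [inner_plane, rot_apply_zero, rot_apply_one, PiLp.add_apply, PiLp.smul_apply,
    smul_eq_mul]
  -- The forms at `v` and at its rotation add up to `|v|²` times the trace.
  linear_combination (v 0 ^ 2 + v 1 ^ 2) * hA

lemma inner_symm_of_hasGradientAt {f : Plane → ℝ} {V : Plane → Plane} {W : Plane →L[ℝ] Plane}
    {x : Plane} (hf : ∀ y, HasGradientAt f (V y) y) (hV : HasFDerivAt V W x) (v w : Plane) :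
    inner ℝ (W v) w = inner ℝ (W w) v :=
  second_derivative_symmetric (f' := fun y => innerMap (V y)) (f'' := innerMap.comp W)
    (fun y => (hf y).hasFDerivAt) (innerMap.hasFDerivAt.comp x hV) v w

/-! ### Functions with an integrable majorant and bounded derivatives -/

/-- The bounds that a classical solution satisfies at a fixed time. -/
structure IsTameScalar (f : Plane → ℝ) (g : Plane → ℝ) (B : ℝ) : Prop where
  contDiff : ContDiff ℝ 2 f
  integrable_bound : Integrable g
  abs_le : ∀ x, |f x| ≤ g x
  norm_fderiv_le : ∀ x, ‖fderiv ℝ f x‖ ≤ B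
  norm_hess_le : ∀ x, ‖iteratedFDeriv ℝ 2 f x‖ ≤ B

/-- Lipschitz functions with a common integrable majorant decay uniformly at infinity. -/
lemma exists_radius_abs_lt {g : Plane → ℝ} (hg : Integrable g) {B ε : ℝ} (hε : 0 < ε) :
    ∃ R : ℝ, ∀ f : Plane → ℝ, (∀ x, |f x| ≤ g x) → (∀ x y, |f x - f y| ≤ B * ‖x - y‖) →
      ∀ x, R < ‖x‖ → |f x| < ε := by
  -- If `|f x| ≥ ε`, the Lipschitz bound keeps `|f| ≥ ε/2` on the ball of this radius about `x`, so
  -- `g` has a fixed positive mass there. Far from the origin the vanishing tail of `∫ g` excludes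
  -- this, uniformly in `f`.
  set r : ℝ := ε / (2 * (|B| + 1)) with hr
  have hr0 : 0 < r := by positivity
  have hv : 0 < volume.real (Metric.ball (0 : Plane) r) := by
    rw [Measure.real, ENNReal.toReal_pos_iff]
    exact ⟨Metric.measure_ball_pos _ _ hr0, measure_ball_lt_top⟩
  have ht := tendsto_setIntegral_of_antitone (μ := volume) (f := g)
    (s := fun n : ℕ => (Metric.ball (0 : Plane) n)ᶜ)
    (fun n => measurableSet_ball.compl)
    (fun m n h => compl_subset_compl.2 (Metric.ball_subset_ball (by exact_mod_cast h)))
    ⟨0, hg.integrableOn⟩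
  have he : ⋂ n : ℕ, (Metric.ball (0 : Plane) n)ᶜ = ∅ := by
    rw [← compl_iUnion, Metric.iUnion_ball_nat, compl_univ]
  rw [he, Measure.restrict_empty, integral_zero_measure] at ht
  obtain ⟨n, hn⟩ := (ht.eventually_lt_const
    (show (0 : ℝ) < ε / 2 * volume.real (Metric.ball (0 : Plane) r) by positivity)).exists
  refine ⟨n + r, fun f hfg hfl x hx => ?_⟩
  have hg0 : ∀ y, 0 ≤ g y := fun y => (abs_nonneg _).trans (hfg y)
  by_contra! hc
  have hsub : Metric.ball x r ⊆ (Metric.ball (0 : Plane) n)ᶜ := fun y hy => by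
    rw [mem_compl_iff, Metric.mem_ball, not_lt, dist_zero_right]
    rw [Metric.mem_ball, dist_eq_norm] at hy
    have := norm_sub_norm_le x y
    rw [norm_sub_rev] at this
    linarith
  have hlow : ∀ y ∈ Metric.ball x r, ε / 2 ≤ g y := fun y hy => by
    rw [Metric.mem_ball, dist_eq_norm] at hy
    have h1 := hfl x y
    rw [norm_sub_rev] at h1
    have h2 : B * ‖y - x‖ ≤ ε / 2 := by
      calc B * ‖y - x‖ ≤ (|B| + 1) * r := by
            gcongr
            linarith [le_abs_self B]
        _ = ε / 2 := by rw [hr]; field_simp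
    have h3 := abs_sub_abs_le_abs_sub (f x) (f y)
    linarith [hfg y]
  have h1 : ε / 2 * volume.real (Metric.ball (0 : Plane) r) ≤ ∫ y in Metric.ball x r, g y := by
    have : volume.real (Metric.ball x r) = volume.real (Metric.ball (0 : Plane) r) := by
      rw [Measure.real, Measure.addHaar_ball_center, Measure.real]
    rw [← this]
    exact setIntegral_ge_of_const_le_real measurableSet_ball measure_ball_lt_top.ne hlow
      hg.integrableOn
  have h2 : ∫ y in Metric.ball x r, g y ≤ ∫ y in (Metric.ball (0 : Plane) n)ᶜ, g y :=
    setIntegral_mono_set hg.integrableOn (Eventually.of_forall hg0) hsub.eventuallyLE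
  linarith

namespace IsTameScalar

variable {f g : Plane → ℝ} {B : ℝ}

lemma differentiable (h : IsTameScalar f g B) : Differentiable ℝ f :=
  h.contDiff.differentiable (by norm_num)

lemma continuous (h : IsTameScalar f g B) : Continuous f := h.contDiff.continuous

lemma integrable (h : IsTameScalar f g B) : Integrable f :=
  h.integrable_bound.mono' h.continuous.aestronglyMeasurable (Eventually.of_forall h.abs_le)

lemma bound_nonneg (h : IsTameScalar f g B) : 0 ≤ B :=
  (norm_nonneg _).trans (h.norm_fderiv_le 0)

lemma lipschitz (h : IsTameScalar f g B) (x y : Plane) : |f x - f y| ≤ B * ‖x - y‖ :=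
  convex_univ.norm_image_sub_le_of_norm_fderiv_le (fun x _ => h.differentiable x)
    (fun x _ => h.norm_fderiv_le x) (mem_univ y) (mem_univ x)

lemma exists_bound (h : IsTameScalar f g B) : ∃ C, ∀ x, |f x| ≤ C := by
  obtain ⟨R, hR⟩ := exists_radius_abs_lt h.integrable_bound (B := B) one_pos
  obtain ⟨C, hC⟩ := (isCompact_closedBall (0 : Plane) R).exists_bound_of_continuousOn
    h.continuous.continuousOn
  refine ⟨max C 1, fun x => ?_⟩
  rcases le_or_gt ‖x‖ R with hx | hx
  · exact (hC x (by simpa using hx)).trans (le_max_left _ _)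
  · exact (hR f h.abs_le h.lipschitz x hx).le.trans (le_max_right _ _)

lemma hasGradientAt (h : IsTameScalar f g B) (x : Plane) : HasGradientAt f (gradient f x) x :=
  (h.differentiable x).hasGradientAt

lemma contDiff_gradient (h : IsTameScalar f g B) : ContDiff ℝ 1 (gradient f) :=
  rieszMap.contDiff.comp (h.contDiff.fderiv_right (m := 1) (by norm_num))

lemma norm_fderiv_gradient_le (h : IsTameScalar f g B) (x : Plane) :
    ‖fderiv ℝ (gradient f) x‖ ≤ B := by
  have hd : DifferentiableAt ℝ (fderiv ℝ f) x :=
    (h.contDiff.fderiv_right (m := 1) (by norm_num)).differentiable (by norm_num) x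
  have e : fderiv ℝ (gradient f) x = rieszMap.comp (fderiv ℝ (fderiv ℝ f) x) :=
    (rieszMap.hasFDerivAt.comp x hd.hasFDerivAt).fderiv
  rw [e]
  refine (ContinuousLinearMap.opNorm_comp_le _ _).trans ?_
  have h1 : ‖fderiv ℝ (fderiv ℝ f) x‖ ≤ B := by
    rw [← norm_iteratedFDeriv_one, norm_iteratedFDeriv_fderiv]
    exact h.norm_hess_le x
  calc ‖rieszMap‖ * ‖fderiv ℝ (fderiv ℝ f) x‖ ≤ 1 * B := by gcongr; exact norm_rieszMap_le
    _ = B := one_mul B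

lemma hasFDerivAt_gradient (h : IsTameScalar f g B) (x : Plane) :
    HasFDerivAt (gradient f) (fderiv ℝ (gradient f) x) x :=
  (h.contDiff_gradient.differentiable (by norm_num) x).hasFDerivAt

lemma norm_gradient_le (h : IsTameScalar f g B) (x : Plane) : ‖gradient f x‖ ≤ B := by
  rw [norm_gradient]; exact h.norm_fderiv_le x

lemma bddAbove_gradPerp (h : IsTameScalar f g B) : BddAbove (range fun x => ‖gradPerp f x‖) :=
  ⟨B, by rintro _ ⟨x, rfl⟩; simpa only [norm_gradPerp] using h.norm_fderiv_le x⟩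

lemma norm_gradPerp_le_sup (h : IsTameScalar f g B) (x : Plane) :
    ‖gradPerp f x‖ ≤ supGradPerp f := le_ciSup h.bddAbove_gradPerp x

end IsTameScalar

/-! ### The potential and the velocity -/

/-- The gradient of `(-Δ)^{-1/2} f`. -/
noncomputable def potentialGrad (δ : ℝ) (f : Plane → ℝ) (x : Plane) : Plane :=
  (1 / (2 * Real.pi)) •
    (shiftAverage (coreKernel δ) (gradient f) x + shiftAverage f (smoothKernelGrad δ) x)

/-- The Hessian of `(-Δ)^{-1/2} f`. -/
noncomputable def potentialHess (δ : ℝ) (f : Plane → ℝ) (x : Plane) : Plane →L[ℝ] Plane :=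
  (1 / (2 * Real.pi)) •
    (shiftAverage (coreKernel δ) (fderiv ℝ (gradient f)) x + shiftAverage f (smoothKernelHess δ) x)

namespace IsTameScalar

variable {f g : Plane → ℝ} {B δ : ℝ}

lemma hasGradientAt_potential (h : IsTameScalar f g B) (hδ : 0 < δ) (x : Plane) :
    HasGradientAt (invSqrtLaplacian f) (potentialGrad δ f x) x := by
  obtain ⟨C, hC⟩ := h.exists_bound
  have h1 := hasGradientAt_shiftAverage (integrable_coreKernel hδ) h.hasGradientAt
    h.contDiff_gradient.continuous hC h.norm_gradient_le x
  have h2 := hasGradientAt_shiftAverage h.integrable (hasGradientAt_smoothKernel hδ)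
    (continuous_smoothKernelGrad hδ) (abs_smoothKernel_le hδ) (norm_smoothKernelGrad_le hδ) x
  have h3 := (h1.hasFDerivAt.add h2.hasFDerivAt).const_mul (1 / (2 * Real.pi))
  rw [hasGradientAt_iff_hasFDerivAt]
  refine (h3.congr_fderiv ?_).congr_of_eventuallyEq
    (Eventually.of_forall fun y => invSqrtLaplacian_eq hδ h.continuous hC h.integrable y)
  simp [potentialGrad]

lemma hasFDerivAt_potentialGrad (h : IsTameScalar f g B) (hδ : 0 < δ) (x : Plane) :
    HasFDerivAt (potentialGrad δ f) (potentialHess δ f x) x :=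
  ((hasFDerivAt_shiftAverage (integrable_coreKernel hδ) h.hasFDerivAt_gradient
    (h.contDiff_gradient.continuous_fderiv (by norm_num)) h.norm_gradient_le
    h.norm_fderiv_gradient_le x).add
  (hasFDerivAt_shiftAverage h.integrable (hasFDerivAt_smoothKernelGrad hδ)
    (continuous_smoothKernelHess hδ) (norm_smoothKernelGrad_le hδ)
    (norm_smoothKernelHess_le hδ) x)).const_smul (1 / (2 * Real.pi))

lemma continuous_potentialHess (h : IsTameScalar f g B) (hδ : 0 < δ) :
    Continuous (potentialHess δ f) :=
  ((continuous_shiftAverage (integrable_coreKernel hδ)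
    (h.contDiff_gradient.continuous_fderiv (by norm_num)) h.norm_fderiv_gradient_le).add
  (continuous_shiftAverage h.integrable (continuous_smoothKernelHess hδ)
    (norm_smoothKernelHess_le hδ))).const_smul (1 / (2 * Real.pi))

lemma sqgVelocity_eq (h : IsTameScalar f g B) (hδ : 0 < δ) (x : Plane) :
    sqgVelocity f x = rot (potentialGrad δ f x) := by
  rw [sqgVelocity, gradPerp_eq_rot, (h.hasGradientAt_potential hδ x).gradient]

lemma contDiff_sqgVelocity (h : IsTameScalar f g B) : ContDiff ℝ 1 (sqgVelocity f) := by
  have e : sqgVelocity f = fun x => rot (potentialGrad 1 f x) :=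
    funext fun x => h.sqgVelocity_eq one_pos x
  rw [e]
  refine rot.contDiff.comp (contDiff_one_iff_hasFDerivAt.2
    ⟨_, h.continuous_potentialHess one_pos, h.hasFDerivAt_potentialGrad one_pos⟩)

lemma planeTrace_fderiv_sqgVelocity (h : IsTameScalar f g B) (x : Plane) :
    planeTrace (fderiv ℝ (sqgVelocity f) x) = 0 := by
  have e : sqgVelocity f = fun x => rot (potentialGrad 1 f x) :=
    funext fun x => h.sqgVelocity_eq one_pos x
  have hd := h.hasFDerivAt_potentialGrad one_pos x
  have e' : fderiv ℝ (fun x => rot (potentialGrad 1 f x)) x = rot.comp (potentialHess 1 f x) :=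
    (rot.hasFDerivAt.comp x hd).fderiv
  rw [e, e']
  exact planeTrace_rot_comp (inner_symm_of_hasGradientAt (h.hasGradientAt_potential one_pos) hd)

lemma planeTrace_fderiv_gradPerp (h : IsTameScalar f g B) (x : Plane) :
    planeTrace (fderiv ℝ (gradPerp f) x) = 0 := by
  have hd := h.hasFDerivAt_gradient x
  have e : fderiv ℝ (gradPerp f) x = rot.comp (fderiv ℝ (gradient f) x) :=
    (rot.hasFDerivAt.comp x hd).fderiv
  rw [e]
  exact planeTrace_rot_comp (inner_symm_of_hasGradientAt h.hasGradientAt hd)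

/-- `δ` stays free: `δ = 1` yields a crude bound uniform on compact time intervals, `δ = 1/Ω` the
logarithmic one. -/
lemma norm_sqgVelocity_le (h : IsTameScalar f g B) (hδ : 0 < δ) {Ω : ℝ}
    (hΩ : ∀ x, ‖gradient f x‖ ≤ Ω) (x : Plane) :
    ‖sqgVelocity f x‖ ≤ (1 / (2 * Real.pi)) *
      (δ * (∫ z, |coreKernel 1 z|) * Ω + ‖shiftAverage f (smoothKernelGrad δ) x‖) := by
  rw [h.sqgVelocity_eq hδ, norm_rot, potentialGrad, norm_smul, Real.norm_of_nonneg (by positivity)]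
  gcongr
  refine (norm_add_le _ _).trans ?_
  gcongr
  rw [← integral_abs_coreKernel hδ]
  exact norm_shiftAverage_le (integrable_coreKernel hδ) hΩ x

lemma norm_sqgVelocity_le_of_bounds (h : IsTameScalar f g B) (x : Plane) :
    ‖sqgVelocity f x‖ ≤ (1 / (2 * Real.pi)) *
      ((∫ z, |coreKernel 1 z|) * B + ∫ z, g z) := by
  refine (h.norm_sqgVelocity_le one_pos h.norm_gradient_le x).trans ?_
  rw [one_mul]
  gcongr
  refine (norm_shiftAverage_le h.integrable (norm_smoothKernelGrad_le one_pos) x).trans ?_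
  rw [inv_one, one_pow, mul_one]
  exact integral_mono h.integrable.abs h.integrable_bound h.abs_le

end IsTameScalar

/-! ### Time regularity of solutions -/

namespace IsSQGSolution

variable {θ : ℝ → Plane → ℝ} {T : ℝ}

lemma exists_tame (h : IsSQGSolution θ T) {T' : ℝ} (hT' : T' < T) :
    ∃ g B, ∀ t ∈ Icc 0 T', IsTameScalar (θ t) g B := by
  obtain ⟨g, B, hg, hb⟩ := h.bounds T' hT'
  refine ⟨g, B, fun t ht => ⟨?_, hg, fun x => (hb t ht x).1, fun x => (hb t ht x).2.1,
    fun x => (hb t ht x).2.2⟩⟩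
  have hm : ContDiff ℝ 2 fun x : Plane => ((t, x) : ℝ × Plane) := by fun_prop
  rw [← contDiffOn_univ] at hm ⊢
  exact h.contDiff.comp hm fun x _ => ⟨⟨ht.1, ht.2.trans_lt hT'⟩, mem_univ _⟩

lemma tame (h : IsSQGSolution θ T) {t : ℝ} (ht : t ∈ Ico 0 T) :
    ∃ g B, IsTameScalar (θ t) g B := by
  obtain ⟨g, B, hb⟩ := h.exists_tame ht.2
  exact ⟨g, B, hb t ⟨ht.1, le_rfl⟩⟩

lemma contDiffAt (h : IsSQGSolution θ T) {t : ℝ} (ht : t ∈ Ioo 0 T) (x : Plane) :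
    ContDiffAt ℝ 2 (fun p : ℝ × Plane => θ p.1 p.2) (t, x) :=
  h.contDiff.contDiffAt (prod_mem_nhds (Ico_mem_nhds ht.1 ht.2) univ_mem)

lemma continuousOn_time (h : IsSQGSolution θ T) (x : Plane) :
    ContinuousOn (fun t => θ t x) (Ico 0 T) :=
  h.contDiff.continuousOn.comp (f := fun t : ℝ => ((t, x) : ℝ × Plane)) (by fun_prop)
    fun t ht => ⟨ht, mem_univ _⟩

lemma hasDerivAt_time (h : IsSQGSolution θ T) {t : ℝ} (ht : t ∈ Ioo 0 T) (x : Plane) :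
    HasDerivAt (fun r => θ r x) (-inner ℝ (sqgVelocity (θ t) x) (gradient (θ t) x)) t := by
  have hd : DifferentiableAt ℝ (fun r => θ r x) t :=
    ((h.contDiffAt ht x).differentiableAt (by norm_num)).comp t
      (f := fun r : ℝ => ((r, x) : ℝ × Plane)) (by fun_prop)
  have h1 := h.transport t ⟨ht.1.le, ht.2⟩ x
  rw [derivWithin_of_mem_nhds (Ico_mem_nhds ht.1 ht.2)] at h1
  rw [← eq_neg_of_add_eq_zero_left h1]
  exact hd.hasDerivAt

end IsSQGSolution

/-! ### The maximum principle -/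

/-- Subtracting `εt` turns a violation into a maximum of `f - εt` over a compact set at some
positive time. There `f` is spatially maximal, hence stationary in time, whereas maximality forces
its left slope to be at least `ε`. -/
lemma le_of_stationary_at_max {f : ℝ → Plane → ℝ} {K t₁ : ℝ} (ht₁ : 0 ≤ t₁)
    (hf : ContinuousOn (fun p : ℝ × Plane => f p.1 p.2) (Icc 0 t₁ ×ˢ univ))
    (hdecay : ∀ ε > 0, ∃ R : ℝ, ∀ t ∈ Icc 0 t₁, ∀ x, R < ‖x‖ → f t x < ε)
    (hcrit : ∀ t ∈ Ioc 0 t₁, ∀ x, (∀ y, f t y ≤ f t x) → HasDerivAt (fun r => f r x) 0 t)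
    (hK : 0 ≤ K) (h0 : ∀ x, f 0 x ≤ K) (x : Plane) : f t₁ x ≤ K := by
  by_contra! hc
  -- `ε` is small enough that the penalized value at `(t₁, x)` still exceeds `K`. As `K ≥ 0`, that
  -- value is a positive level, below which `f` falls outside some ball at all times.
  obtain ⟨ε, hε, hε2⟩ : ∃ ε > 0, K < f t₁ x - ε * t₁ := by
    refine ⟨(f t₁ x - K) / (2 * (t₁ + 1)), by apply div_pos <;> linarith, ?_⟩
    rw [div_mul_eq_mul_div, lt_sub_comm, div_lt_iff₀ (by positivity)]
    nlinarith
  obtain ⟨R, hR⟩ := hdecay (f t₁ x - ε * t₁) (by linarith)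
  have hxR : ‖x‖ ≤ R := by
    by_contra! hx
    have := hR t₁ ⟨ht₁, le_rfl⟩ x hx
    nlinarith
  have hcomp : IsCompact (Icc 0 t₁ ×ˢ Metric.closedBall (0 : Plane) R) :=
    isCompact_Icc.prod (isCompact_closedBall _ _)
  obtain ⟨⟨t₀, x₀⟩, ⟨ht₀, hx₀⟩, hmax⟩ := hcomp.exists_isMaxOn
    (f := fun p : ℝ × Plane => f p.1 p.2 - ε * p.1)
    ⟨(t₁, x), ⟨ht₁, le_rfl⟩, by simpa using hxR⟩
    ((hf.mono (prod_mono_right (subset_univ _))).sub (by fun_prop))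
  have hge : f t₁ x - ε * t₁ ≤ f t₀ x₀ - ε * t₀ :=
    hmax (a := (t₁, x)) ⟨⟨ht₁, le_rfl⟩, by simpa using hxR⟩
  have ht₀pos : 0 < t₀ := by
    rcases ht₀.1.eq_or_lt with h | h
    · obtain rfl : (0 : ℝ) = t₀ := h
      have := h0 x₀
      nlinarith
    · exact h
  -- The maximum over the ball is one over the plane: outside the ball `f` lies below the penalized
  -- value already attained.
  have hglob : ∀ y, f t₀ y ≤ f t₀ x₀ := fun y => by
    rcases le_or_gt ‖y‖ R with hy | hy
    · have : f t₀ y - ε * t₀ ≤ f t₀ x₀ - ε * t₀ :=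
        hmax (a := (t₀, y)) ⟨ht₀, by simpa using hy⟩
      linarith
    · have := hR t₀ ht₀ y hy
      nlinarith
  have hd := hasDerivAt_iff_tendsto_slope_left_right.1 (hcrit t₀ ⟨ht₀pos, ht₀.2⟩ x₀ hglob)
  have : ε ≤ 0 := by
    refine ge_of_tendsto hd.1 ?_
    filter_upwards [Ioo_mem_nhdsLT ht₀pos] with r hr
    have h1 : f r x₀ - ε * r ≤ f t₀ x₀ - ε * t₀ :=
      hmax (a := (r, x₀)) ⟨⟨hr.1.le, hr.2.le.trans ht₀.2⟩, hx₀⟩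
    rw [slope_comm, slope_def_field, le_div_iff₀ (by linarith [hr.2])]
    nlinarith
  linarith

namespace IsSQGSolution

variable {θ : ℝ → Plane → ℝ} {T : ℝ}

/-- At a spatial extremum `∇θ = 0`, so the transport equation makes `θ` stationary in time. The
integrable majorant and the gradient bound, common to all times up to `t`, give the uniform decay at
infinity. -/
lemma abs_le_of_initial (h : IsSQGSolution θ T) {K : ℝ} (hK : ∀ x, |θ 0 x| ≤ K) {t : ℝ}
    (ht : t ∈ Ico 0 T) (x : Plane) : |θ t x| ≤ K := by
  have hK0 : 0 ≤ K := (abs_nonneg _).trans (hK 0)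
  obtain ⟨g, B, hb⟩ := h.exists_tame ht.2
  have hg : Integrable g := (hb t ⟨ht.1, le_rfl⟩).integrable_bound
  have hc : ContinuousOn (fun p : ℝ × Plane => θ p.1 p.2) (Icc 0 t ×ˢ univ) :=
    h.contDiff.continuousOn.mono (prod_mono_left (Icc_subset_Ico_right ht.2))
  have hcrit : ∀ s ∈ Ioc 0 t, ∀ x, fderiv ℝ (θ s) x = 0 → HasDerivAt (fun r => θ r x) 0 s := by
    intro s hs x hx
    have := h.hasDerivAt_time ⟨hs.1, hs.2.trans_lt ht.2⟩ x
    rwa [gradient_eq_rieszMap, hx, map_zero, inner_zero_right, neg_zero] at this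
  refine abs_le'.2 ⟨?_, ?_⟩
  · refine le_of_stationary_at_max ht.1 hc (fun ε hε => ?_) (fun s hs x hx => ?_) hK0
      (fun x => (le_abs_self _).trans (hK x)) x
    · obtain ⟨R, hR⟩ := exists_radius_abs_lt hg (B := B) hε
      exact ⟨R, fun s hs x hx => (le_abs_self _).trans_lt
        (hR _ (hb s hs).abs_le (hb s hs).lipschitz x hx)⟩
    · exact hcrit s hs x (IsLocalMax.fderiv_eq_zero (Eventually.of_forall hx))
  · refine le_of_stationary_at_max (f := fun t x => -θ t x) ht.1 hc.neg (fun ε hε => ?_)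
      (fun s hs x hx => ?_) hK0 (fun x => (neg_le_abs _).trans (hK x)) x
    · obtain ⟨R, hR⟩ := exists_radius_abs_lt hg (B := B) hε
      exact ⟨R, fun s hs x hx => (neg_le_abs _).trans_lt
        (hR _ (hb s hs).abs_le (hb s hs).lipschitz x hx)⟩
    · have := (hcrit s hs x (IsLocalMin.fderiv_eq_zero (Eventually.of_forall
        fun y => neg_le_neg_iff.1 (hx y)))).neg
      rwa [neg_zero] at this

end IsSQGSolution

/-! ### Decay of the square integral -/

/-- The flux of a divergence-free field against a compactly supported function vanishes. -/
lemma integral_fderiv_apply_eq_zero {w : Plane → ℝ} {u : Plane → Plane} (hw : ContDiff ℝ 1 w)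
    (hs : HasCompactSupport w) (hu : ContDiff ℝ 1 u) (hdiv : ∀ x, planeTrace (fderiv ℝ u x) = 0) :
    ∫ x, fderiv ℝ w x (u x) = 0 := by
  have hud : Differentiable ℝ u := hu.differentiable (by norm_num)
  have hwd : Differentiable ℝ w := hw.differentiable (by norm_num)
  have hui : ∀ i : Fin 2, ContDiff ℝ 1 fun x => u x i := fun i =>
    (EuclideanSpace.proj (𝕜 := ℝ) i).contDiff.comp hu
  have hfui : ∀ (i : Fin 2) x v, fderiv ℝ (fun x => u x i) x v = fderiv ℝ u x v i := by
    intro i x v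
    have e : fderiv ℝ (fun x => u x i) x = (EuclideanSpace.proj i).comp (fderiv ℝ u x) :=
      ((EuclideanSpace.proj (𝕜 := ℝ) i).hasFDerivAt.comp x (hud x).hasFDerivAt).fderiv
    rw [e]; rfl
  have hs' : ∀ v, HasCompactSupport fun x => fderiv ℝ w x v := fun v =>
    (hs.fderiv ℝ).comp_left (g := fun A : Plane →L[ℝ] ℝ => A v) rfl
  have hcw : ∀ v, Continuous fun x => fderiv ℝ w x v := fun v =>
    (hw.continuous_fderiv (by norm_num)).clm_apply continuous_const
  have hcu : ∀ (i : Fin 2) v, Continuous fun x => fderiv ℝ (fun x => u x i) x v := fun i v =>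
    ((hui i).continuous_fderiv (by norm_num)).clm_apply continuous_const
  have i1 : ∀ (i : Fin 2) v, Integrable fun x => u x i * fderiv ℝ w x v := fun i v =>
    ((hui i).continuous.mul (hcw v)).integrable_of_hasCompactSupport (hs' v).mul_left
  have i2 : ∀ (i : Fin 2) v, Integrable fun x => fderiv ℝ (fun x => u x i) x v * w x := fun i v =>
    ((hcu i v).mul hw.continuous).integrable_of_hasCompactSupport hs.mul_left
  -- Integration by parts in each coordinate; summed over `i`, the right-hand sides contain the
  -- divergence of `u`.
  have key : ∀ i : Fin 2, ∫ x, u x i * fderiv ℝ w x (EuclideanSpace.single i 1) =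
      -∫ x, fderiv ℝ (fun x => u x i) x (EuclideanSpace.single i 1) * w x := fun i =>
    integral_mul_fderiv_eq_neg_fderiv_mul_of_integrable (i2 i _) (i1 i _)
      (((hui i).continuous.mul hw.continuous).integrable_of_hasCompactSupport hs.mul_left)
      (fun x _ => (hui i).differentiable (by norm_num) x) (fun x _ => hwd x)
  have e1 : ∀ x, fderiv ℝ w x (u x) = ∑ i : Fin 2, u x i *
      fderiv ℝ w x (EuclideanSpace.single i 1) := by
    intro x
    rw [Fin.sum_univ_two]
    conv_lhs => rw [show u x = u x 0 • EuclideanSpace.single (0 : Fin 2) (1 : ℝ) +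
      u x 1 • EuclideanSpace.single (1 : Fin 2) (1 : ℝ) by ext i; fin_cases i <;> simp]
    simp only [map_add, map_smul, smul_eq_mul]
  simp_rw [e1]
  rw [integral_finsetSum _ fun i _ => i1 i _]
  simp_rw [key]
  rw [Finset.sum_neg_distrib, ← integral_finsetSum _ fun i _ => i2 i _, neg_eq_zero]
  refine integral_eq_zero_of_ae (Eventually.of_forall fun x => ?_)
  have := hdiv x
  simp only [planeTrace] at this
  simp only [hfui, ← Finset.sum_mul, this, zero_mul, Pi.zero_apply]

/-- A smooth cutoff equal to one on the ball of radius `R`. -/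
lemma exists_cutoff : ∃ (χ : ℝ → Plane → ℝ) (A : ℝ), 0 ≤ A ∧ ∀ R > 0, ContDiff ℝ 1 (χ R) ∧
    HasCompactSupport (χ R) ∧ (∀ x, 0 ≤ χ R x ∧ χ R x ≤ 1) ∧ (∀ x, ‖x‖ ≤ R → χ R x = 1) ∧
    ∀ x, ‖fderiv ℝ (χ R) x‖ ≤ A / R := by
  let b : ContDiffBump (0 : Plane) := ⟨1, 2, one_pos, one_lt_two⟩
  have hb : ContDiff ℝ 1 b := b.contDiff
  obtain ⟨A, hA⟩ := (b.hasCompactSupport.fderiv ℝ).exists_bound_of_continuous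
    (hb.continuous_fderiv (by norm_num))
  refine ⟨fun R x => b (R⁻¹ • x), A, (norm_nonneg _).trans (hA 0), fun R hR => ⟨?_, ?_, ?_, ?_, ?_⟩⟩
  · exact hb.comp (contDiff_const_smul _)
  · exact b.hasCompactSupport.comp_homeomorph (Homeomorph.smulOfNeZero R⁻¹ (inv_ne_zero hR.ne'))
  · exact fun x => ⟨b.nonneg, b.le_one⟩
  · intro x hx
    refine b.one_of_mem_closedBall ?_
    rw [mem_closedBall_zero_iff, norm_smul, norm_inv, Real.norm_of_nonneg hR.le,
      inv_mul_le_iff₀ hR]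
    simpa [b] using hx
  · intro x
    have e : fderiv ℝ (fun x => b (R⁻¹ • x)) x = R⁻¹ • fderiv ℝ b (R⁻¹ • x) := by
      exact fderiv_comp_smul _
    rw [e, norm_smul, norm_inv, Real.norm_of_nonneg hR.le, div_eq_inv_mul]
    gcongr
    exact hA _

namespace IsSQGSolution

variable {θ : ℝ → Plane → ℝ} {T : ℝ}

/-- The rate of change of `∫ θ² χ`, after moving the derivatives to the cutoff. -/
lemma integral_flux_eq {f g χ : Plane → ℝ} {B : ℝ} (h : IsTameScalar f g B) (hχ : ContDiff ℝ 1 χ)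
    (hs : HasCompactSupport χ) :
    ∫ x, 2 * f x * (-inner ℝ (sqgVelocity f x) (gradient f x)) * χ x =
      ∫ x, f x ^ 2 * fderiv ℝ χ x (sqgVelocity f x) := by
  have hw : ContDiff ℝ 1 fun x => f x ^ 2 * χ x :=
    ((h.contDiff.of_le (by norm_num)).pow 2).mul hχ
  have hsw : HasCompactSupport fun x => f x ^ 2 * χ x := hs.mul_left
  have hz := integral_fderiv_apply_eq_zero hw hsw h.contDiff_sqgVelocity
    h.planeTrace_fderiv_sqgVelocity
  have hu := h.contDiff_sqgVelocity.continuous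
  -- The product rule for `u·∇(f²χ)`, whose integral vanishes because `u` is divergence free.
  have e : ∀ x, fderiv ℝ (fun x => f x ^ 2 * χ x) x (sqgVelocity f x) =
      f x ^ 2 * fderiv ℝ χ x (sqgVelocity f x) -
        2 * f x * (-inner ℝ (sqgVelocity f x) (gradient f x)) * χ x := by
    intro x
    have hd := ((h.differentiable x).hasFDerivAt.pow 2).mul
      (hχ.differentiable (by norm_num) x).hasFDerivAt
    have hd' : HasFDerivAt (fun x => f x ^ 2 * χ x) _ x := hd
    rw [hd'.fderiv, real_inner_comm, inner_gradient]
    simp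
    ring
  simp_rw [e] at hz
  have i1 : Integrable fun x => f x ^ 2 * fderiv ℝ χ x (sqgVelocity f x) := by
    refine Continuous.integrable_of_hasCompactSupport ?_ ?_
    · exact (h.continuous.pow 2).mul ((hχ.continuous_fderiv (by norm_num)).clm_apply hu)
    · refine HasCompactSupport.mul_left ?_
      exact (hs.fderiv ℝ).mono fun x hx hx' => hx (by simp [hx'])
  have i2 : Integrable fun x =>
      2 * f x * (-inner ℝ (sqgVelocity f x) (gradient f x)) * χ x := by
    refine Continuous.integrable_of_hasCompactSupport ?_ hs.mul_left
    exact (((h.continuous.const_mul 2).mul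
      (hu.inner h.contDiff_gradient.continuous).neg)).mul hχ.continuous
  rw [integral_sub i1 i2] at hz
  linarith

/-- Against a cutoff at scale `R` the square integral changes only by flux through the cutoff. The
flux is `O(1/R)` uniformly in time, since `|∇χ| ≤ A/R`, `u` is bounded and `θ² ≤ K g`. Then `R → ∞`.
-/
lemma integral_sq_le (h : IsSQGSolution θ T) {t : ℝ} (ht : t ∈ Ico 0 T) :
    ∫ x, θ t x ^ 2 ≤ ∫ x, θ 0 x ^ 2 := by
  obtain ⟨g, B, hb⟩ := h.exists_tame ht.2
  have h0t : (0 : ℝ) ∈ Icc 0 t := ⟨le_rfl, ht.1⟩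
  have hg := (hb 0 h0t).integrable_bound
  have hB := (hb 0 h0t).bound_nonneg
  obtain ⟨K, hK⟩ := (hb 0 h0t).exists_bound
  have hK0 : 0 ≤ K := (abs_nonneg _).trans (hK 0)
  have hθK : ∀ s ∈ Icc 0 t, ∀ x, |θ s x| ≤ K := fun s hs x =>
    h.abs_le_of_initial hK ⟨hs.1, hs.2.trans_lt ht.2⟩ x
  have hsq : ∀ s ∈ Icc 0 t, ∀ x, θ s x ^ 2 ≤ K * g x := fun s hs x => by
    rw [← sq_abs, sq]
    exact mul_le_mul (hθK s hs x) ((hb s hs).abs_le x) (abs_nonneg _) hK0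
  have hsqi : ∀ s ∈ Icc 0 t, Integrable fun x => θ s x ^ 2 := fun s hs =>
    (hg.const_mul K).mono' ((hb s hs).continuous.pow 2).aestronglyMeasurable
      (Eventually.of_forall fun x => by
        rw [Real.norm_of_nonneg (sq_nonneg _)]; exact hsq s hs x)
  set U : ℝ := (1 / (2 * Real.pi)) * ((∫ z, |coreKernel 1 z|) * B + ∫ z, g z) with hU
  have hu : ∀ s ∈ Icc 0 t, ∀ x, ‖sqgVelocity (θ s) x‖ ≤ U := fun s hs x =>
    (hb s hs).norm_sqgVelocity_le_of_bounds x
  have hU0 : 0 ≤ U := (norm_nonneg _).trans (hu 0 h0t 0)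
  obtain ⟨χ, A, hA, hχ⟩ := exists_cutoff
  set M : ℝ := U * A * (K * ∫ x, g x) with hM
  have step : ∀ R > 0, ∫ x, θ t x ^ 2 * χ R x ≤ (∫ x, θ 0 x ^ 2) + M / R * t := by
    intro R hR
    obtain ⟨hχ1, hχ2, hχ3, hχ4, hχ5⟩ := hχ R hR
    have hderiv : ∀ s ∈ Ioo 0 t, HasDerivAt (fun s => ∫ x, θ s x ^ 2 * χ R x)
        (∫ x, 2 * θ s x * (-inner ℝ (sqgVelocity (θ s) x) (gradient (θ s) x)) * χ R x) s := by
      intro s hs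
      have hmeas : ∀ r ∈ Ioo 0 t, Continuous fun x => θ r x ^ 2 * χ R x := fun r hr =>
        ((hb r (Ioo_subset_Icc_self hr)).continuous.pow 2).mul hχ1.continuous
      have hs' := hb s (Ioo_subset_Icc_self hs)
      refine (hasDerivAt_integral_of_dominated_loc_of_deriv_le (s := Ioo 0 t)
        (F := fun r x => θ r x ^ 2 * χ R x)
        (F' := fun r x =>
          2 * θ r x * (-inner ℝ (sqgVelocity (θ r) x) (gradient (θ r) x)) * χ R x)
        (bound := fun x => 2 * K * (U * B) * χ R x) (Ioo_mem_nhds hs.1 hs.2) ?_ ?_ ?_ ?_ ?_ ?_).2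
      · filter_upwards [Ioo_mem_nhds hs.1 hs.2] with r hr
        exact (hmeas r hr).aestronglyMeasurable
      · exact (hmeas s hs).integrable_of_hasCompactSupport hχ2.mul_left
      · exact (((hs'.continuous.const_mul 2).mul (hs'.contDiff_sqgVelocity.continuous.inner
          hs'.contDiff_gradient.continuous).neg).mul hχ1.continuous).aestronglyMeasurable
      · refine Eventually.of_forall fun x r hr => ?_
        have hr' := Ioo_subset_Icc_self hr
        rw [norm_mul, norm_mul, norm_mul, norm_neg, Real.norm_of_nonneg (hχ3 x).1,
          Real.norm_of_nonneg zero_le_two]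
        have h1 : ‖inner ℝ (sqgVelocity (θ r) x) (gradient (θ r) x)‖ ≤ U * B :=
          (norm_inner_le_norm _ _).trans (mul_le_mul (hu r hr' x) ((hb r hr').norm_gradient_le x)
            (norm_nonneg _) hU0)
        have h2 : ‖θ r x‖ ≤ K := hθK r hr' x
        have h3 := (hχ3 x).1
        gcongr
      · exact (hχ1.continuous.integrable_of_hasCompactSupport hχ2).const_mul _
      · refine Eventually.of_forall fun x r hr => ?_
        have hd := ((h.hasDerivAt_time ⟨hr.1, hr.2.trans ht.2⟩ x).pow 2).mul_const (χ R x)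
        convert! hd using 1
        simp
    have hbound : ∀ s ∈ Ioo 0 t, deriv (fun s => ∫ x, θ s x ^ 2 * χ R x) s ≤ M / R := by
      intro s hs
      have hs2 := Ioo_subset_Icc_self hs
      rw [(hderiv s hs).deriv, integral_flux_eq (hb s hs2) hχ1 hχ2]
      have hval : ∀ x, θ s x ^ 2 * fderiv ℝ (χ R) x (sqgVelocity (θ s) x) ≤
          A / R * U * (K * g x) := by
        intro x
        have h1 : fderiv ℝ (χ R) x (sqgVelocity (θ s) x) ≤ A / R * U :=
          (le_abs_self _).trans (((fderiv ℝ (χ R) x).le_opNorm _).trans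
            (mul_le_mul (hχ5 x) (hu s hs2 x) (norm_nonneg _) (by positivity)))
        calc _ ≤ θ s x ^ 2 * (A / R * U) := by gcongr
          _ ≤ K * g x * (A / R * U) := by gcongr; exact hsq s hs2 x
          _ = _ := by ring
      have hle : ∫ x, θ s x ^ 2 * fderiv ℝ (χ R) x (sqgVelocity (θ s) x) ≤
          ∫ x, A / R * U * (K * g x) := by
        refine integral_mono ?_ ((hg.const_mul K).const_mul _) hval
        refine Continuous.integrable_of_hasCompactSupport ?_ ?_
        · exact ((hb s hs2).continuous.pow 2).mul ((hχ1.continuous_fderiv (by norm_num)).clm_apply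
            (hb s hs2).contDiff_sqgVelocity.continuous)
        · refine HasCompactSupport.mul_left ?_
          exact (hχ2.fderiv ℝ).mono fun x hx hx' => hx (by simp [hx'])
      refine hle.trans_eq ?_
      rw [integral_const_mul, integral_const_mul, hM]
      ring
    have hcont : ContinuousOn (fun s => ∫ x, θ s x ^ 2 * χ R x) (Icc 0 t) := by
      refine continuousOn_of_dominated (bound := fun x => K * g x) (fun s hs => ?_)
        (fun s hs => Eventually.of_forall fun x => ?_) (hg.const_mul K)
        (Eventually.of_forall fun x => ?_)
      · exact (((hb s hs).continuous.pow 2).mul hχ1.continuous).aestronglyMeasurable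
      · rw [Real.norm_of_nonneg (mul_nonneg (sq_nonneg _) (hχ3 x).1)]
        exact (mul_le_of_le_one_right (sq_nonneg _) (hχ3 x).2).trans (hsq s hs x)
      · exact (((h.continuousOn_time x).mono (Icc_subset_Ico_right ht.2)).pow 2).mul_const _
    have hmv := (convex_Icc 0 t).image_sub_le_mul_sub_of_deriv_le hcont
      (by
        rw [interior_Icc]
        exact fun s hs => (hderiv s hs).differentiableAt.differentiableWithinAt)
      (by rw [interior_Icc]; exact hbound) 0 h0t t ⟨ht.1, le_rfl⟩ ht.1
    have hini : ∫ x, θ 0 x ^ 2 * χ R x ≤ ∫ x, θ 0 x ^ 2 := by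
      refine integral_mono ?_ (hsqi 0 h0t) fun x =>
        mul_le_of_le_one_right (sq_nonneg _) (hχ3 x).2
      exact (((hb 0 h0t).continuous.pow 2).mul hχ1.continuous).integrable_of_hasCompactSupport
        hχ2.mul_left
    rw [sub_zero] at hmv
    linarith
  -- The scales are `R = n + 1`, positive also for `n = 0`.
  have lim1 : Tendsto (fun n : ℕ => ∫ x, θ t x ^ 2 * χ (n + 1) x) atTop (𝓝 (∫ x, θ t x ^ 2)) := by
    have htt : t ∈ Icc 0 t := ⟨ht.1, le_rfl⟩
    refine tendsto_integral_of_dominated_convergence (fun x => θ t x ^ 2) (fun n => ?_) (hsqi t htt)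
      (fun n => Eventually.of_forall fun x => ?_) (Eventually.of_forall fun x => ?_)
    · exact (((hb t htt).continuous.pow 2).mul
        (hχ ((n : ℝ) + 1) (by positivity)).1.continuous).aestronglyMeasurable
    · have h3 := (hχ ((n : ℝ) + 1) (by positivity)).2.2.1 x
      rw [Real.norm_of_nonneg (mul_nonneg (sq_nonneg _) h3.1)]
      exact mul_le_of_le_one_right (sq_nonneg _) h3.2
    · refine tendsto_const_nhds.congr' ?_
      filter_upwards [eventually_ge_atTop ⌈‖x‖⌉₊] with n hn
      have hxn : ‖x‖ ≤ n := (Nat.le_ceil _).trans (by exact_mod_cast hn)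
      rw [(hχ ((n : ℝ) + 1) (by positivity)).2.2.2.1 x (by linarith), mul_one]
  have lim2 : Tendsto (fun n : ℕ => (∫ x, θ 0 x ^ 2) + M / ((n : ℝ) + 1) * t) atTop
      (𝓝 ((∫ x, θ 0 x ^ 2) + 0 * t)) :=
    ((tendsto_const_div_atTop_nhds_zero_nat M).comp (tendsto_add_atTop_nat 1) |>.congr
      (fun n => by simp)).mul_const t |>.const_add _
  rw [zero_mul, add_zero] at lim2
  exact le_of_tendsto_of_tendsto' lim1 lim2 fun n => step ((n : ℝ) + 1) (by positivity)

end IsSQGSolution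

/-! ### The logarithmic bound of the velocity -/

/-- The kernel decays like `|z|⁻²`, which is not integrable at infinity in the plane but is square
integrable there. So the unit ball about `x` uses the sup bound, and its complement uses `pq ≤ p² +
q²` with the `L²` bound. -/
lemma IsTameScalar.norm_shiftAverage_smoothKernelGrad_le {f g : Plane → ℝ} {B K δ : ℝ}
    (h : IsTameScalar f g B) (hδ : 0 < δ) (hK : ∀ x, |f x| ≤ K)
    (hsq : ∫ x, f x ^ 2 ≤ K ^ 2) (x : Plane) :
    ‖shiftAverage f (smoothKernelGrad δ) x‖ ≤
      K * (volume.real (Metric.ball (0 : Plane) 1) * Real.log (1 + (δ⁻¹) ^ 2)) +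
        (K ^ 2 + 16 * ∫ z : Plane, (1 + ‖z‖) ^ (-(4 : ℝ))) := by
  have hK0 : 0 ≤ K := (abs_nonneg _).trans (hK 0)
  set φ : Plane → ℝ := (Metric.ball (0 : Plane) 1).indicator fun z => (‖z‖ ^ 2 + δ ^ 2)⁻¹ with hφ
  have hφi : Integrable φ := (integrable_indicator_iff measurableSet_ball).2
    (integrableOn_inv_sq_add hδ)
  have hsqi : Integrable fun z => f z ^ 2 := by
    refine (h.integrable.abs.const_mul K).mono' (h.continuous.pow 2).aestronglyMeasurable
      (Eventually.of_forall fun z => ?_)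
    rw [Real.norm_of_nonneg (sq_nonneg _), ← sq_abs, sq]
    exact mul_le_mul_of_nonneg_right (hK z) (abs_nonneg _)
  have i1 : Integrable fun z => K * φ (x - z) := (hφi.comp_sub_left x).const_mul K
  have i3 : Integrable fun z : Plane => 16 * (1 + ‖x - z‖) ^ (-(4 : ℝ)) :=
    (integrable_one_add_norm_four.comp_sub_left x).const_mul 16
  have i23 : Integrable fun z => f z ^ 2 + 16 * (1 + ‖x - z‖) ^ (-(4 : ℝ)) := hsqi.add i3
  have key : ‖shiftAverage f (smoothKernelGrad δ) x‖ ≤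
      ∫ z, (K * φ (x - z) + (f z ^ 2 + 16 * (1 + ‖x - z‖) ^ (-(4 : ℝ)))) := by
    refine norm_integral_le_of_norm_le (i1.add i23) (Eventually.of_forall fun z => ?_)
    rw [norm_smul, Real.norm_eq_abs]
    have hk := norm_smoothKernelGrad_le_inv_sq hδ (x - z)
    have hpow : 0 ≤ 16 * (1 + ‖x - z‖) ^ (-(4 : ℝ)) := by positivity
    by_cases hz : x - z ∈ Metric.ball (0 : Plane) 1
    · have : φ (x - z) = (‖x - z‖ ^ 2 + δ ^ 2)⁻¹ := indicator_of_mem hz _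
      rw [this]
      have := mul_le_mul (hK z) hk (norm_nonneg _) hK0
      nlinarith [sq_nonneg (f z)]
    · have e : φ (x - z) = 0 := indicator_of_notMem hz _
      rw [e, mul_zero, zero_add]
      have h1 := inv_sq_add_sq_le δ (z := x - z) (by simpa using hz)
      have h2 : |f z| * ‖smoothKernelGrad δ (x - z)‖ ≤ |f z| * (‖x - z‖ ^ 2 + δ ^ 2)⁻¹ := by gcongr
      nlinarith [sq_nonneg (|f z| - (‖x - z‖ ^ 2 + δ ^ 2)⁻¹), sq_abs (f z), sq_nonneg (f z),
        sq_nonneg ((‖x - z‖ ^ 2 + δ ^ 2)⁻¹)]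
  refine key.trans ?_
  have e1 : ∫ z, φ (x - z) =
      volume.real (Metric.ball (0 : Plane) 1) * Real.log (1 + (δ⁻¹) ^ 2) := by
    rw [integral_sub_left_eq_self φ volume x, hφ, integral_indicator measurableSet_ball,
      setIntegral_inv_sq_add hδ]
  have e3 : ∫ z, (1 + ‖x - z‖) ^ (-(4 : ℝ)) = ∫ z : Plane, (1 + ‖z‖) ^ (-(4 : ℝ)) :=
    integral_sub_left_eq_self (fun z : Plane => (1 + ‖z‖) ^ (-(4 : ℝ))) volume x
  rw [integral_add i1 i23, integral_add hsqi i3, integral_const_mul, integral_const_mul,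
    e1, e3]
  gcongr

theorem exists_velocityConstant (K m : ℝ) (hm : 1 < m) :
    ∃ Cu : ℝ, ∀ (θ : ℝ → Plane → ℝ) (T T₀ : ℝ),
      IsSQGSolution θ T → 0 ≤ T₀ → T₀ < T →
      (∫ x, |θ 0 x|) ≤ K → (∀ x, |θ 0 x| ≤ K) →
      (∀ t ∈ Ico T₀ T, m ≤ supGradPerp (θ t)) → IsVelocityConstant θ T₀ T Cu := by
  have hlm : 0 < Real.log m := Real.log_pos hm
  set a : ℝ := ∫ z, |coreKernel 1 z| with ha
  set v : ℝ := volume.real (Metric.ball (0 : Plane) 1) with hv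
  set d : ℝ := ∫ z : Plane, (1 + ‖z‖) ^ (-(4 : ℝ)) with hd
  set D : ℝ := a + |K| * (v * Real.log 2) + (K ^ 2 + 16 * d) with hD
  -- `D` collects all terms without `log Ω`; dividing by `log m` turns them into multiples of `log
  -- Ω`. The summand `1` makes the constant positive for every `K`.
  refine ⟨(1 / (2 * Real.pi)) * (D / Real.log m + 2 * |K| * v) + 1,
    fun θ T T₀ h hT₀ hT hK1 hK hΩ => ⟨by positivity, fun t ht x => ?_⟩⟩
  have ht0 : t ∈ Ico 0 T := ⟨hT₀.trans ht.1, ht.2⟩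
  have hK0 : 0 ≤ K := (abs_nonneg _).trans (hK 0)
  obtain ⟨g, B, hb⟩ := h.tame ht0
  obtain ⟨g0, B0, hb0⟩ := h.tame (t := 0) ⟨le_rfl, ht0.1.trans_lt ht0.2⟩
  have hsq : ∫ x, θ t x ^ 2 ≤ K ^ 2 := by
    refine (h.integral_sq_le ht0).trans ?_
    have hle : ∀ x, θ 0 x ^ 2 ≤ K * |θ 0 x| := fun x => by
      rw [← sq_abs, sq]
      exact mul_le_mul_of_nonneg_right (hK x) (abs_nonneg _)
    have hi : Integrable fun x => K * |θ 0 x| := hb0.integrable.abs.const_mul K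
    calc ∫ x, θ 0 x ^ 2 ≤ ∫ x, K * |θ 0 x| :=
          integral_mono (hi.mono' (hb0.continuous.pow 2).aestronglyMeasurable
            (Eventually.of_forall fun x => by
              rw [Real.norm_of_nonneg (sq_nonneg _)]; exact hle x)) hi hle
      _ = K * ∫ x, |θ 0 x| := integral_const_mul _ _
      _ ≤ K ^ 2 := by rw [sq]; gcongr
  set Ω : ℝ := supGradPerp (θ t) with hΩdef
  have hmΩ : m ≤ Ω := hΩ t ht
  have hΩ0 : 0 < Ω := by linarith
  have hgrad : ∀ x, ‖gradient (θ t) x‖ ≤ Ω := fun x => by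
    rw [norm_gradient, ← norm_gradPerp]; exact hb.norm_gradPerp_le_sup x
  have hlog : Real.log m ≤ Real.log Ω := Real.log_le_log (by linarith) hmΩ
  -- With `δ = Ω⁻¹` the core term is exactly the constant `a`.
  have h1 := hb.norm_sqgVelocity_le (inv_pos.2 hΩ0) hgrad x
  have h2 := hb.norm_shiftAverage_smoothKernelGrad_le (inv_pos.2 hΩ0)
    (h.abs_le_of_initial hK ht0) hsq x
  rw [inv_inv] at h2
  have h3 : Real.log (1 + Ω ^ 2) ≤ Real.log 2 + 2 * Real.log Ω := by
    rw [show (2 : ℝ) * Real.log Ω = Real.log (Ω ^ 2) by simp,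
      ← Real.log_mul two_ne_zero (by positivity)]
    refine Real.log_le_log (by positivity) ?_
    nlinarith
  have h4 : Ω⁻¹ * a * Ω = a := by field_simp
  rw [h4] at h1
  have h5 : ‖shiftAverage (θ t) (smoothKernelGrad Ω⁻¹) x‖ ≤
      K * (v * (Real.log 2 + 2 * Real.log Ω)) + (K ^ 2 + 16 * d) := by
    refine h2.trans ?_
    gcongr
  have h6 : D ≤ D / Real.log m * Real.log Ω := by
    rw [div_mul_eq_mul_div, le_div_iff₀ hlm]
    gcongr
  have hlΩ : 0 ≤ Real.log Ω := hlm.le.trans hlog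
  calc ‖sqgVelocity (θ t) x‖
      ≤ (1 / (2 * Real.pi)) * (D / Real.log m * Real.log Ω + 2 * |K| * v * Real.log Ω) := by
        refine h1.trans (mul_le_mul_of_nonneg_left ?_ (by positivity))
        refine le_trans ?_ (add_le_add_left h6 _)
        rw [hD, abs_of_nonneg hK0]
        linarith
    _ = (1 / (2 * Real.pi)) * (D / Real.log m + 2 * |K| * v) * Real.log Ω := by ring
    _ ≤ _ := by gcongr; linarith

/-! ### The gradient as a function of time and space -/

/-- The spatial gradient of a time-dependent scalar. -/
noncomputable def gradField (θ : ℝ → Plane → ℝ) (p : ℝ × Plane) : Plane := gradient (θ p.1) p.2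

namespace IsSQGSolution

variable {θ : ℝ → Plane → ℝ} {T : ℝ}

/-- Expressing the spatial derivative through the derivative within `Ico 0 T ×ˢ univ` keeps the
initial time, where no two-sided time derivative is available. -/
lemma fderiv_slice (h : IsSQGSolution θ T) {t : ℝ} (ht : t ∈ Ico 0 T) (y : Plane) :
    fderiv ℝ (θ t) y = (fderivWithin ℝ (fun p : ℝ × Plane => θ p.1 p.2) (Ico 0 T ×ˢ univ)
      (t, y)).comp (ContinuousLinearMap.inr ℝ ℝ Plane) := by
  have h1 := ((h.contDiff.differentiableOn (by norm_num)) (t, y) ⟨ht, mem_univ _⟩).hasFDerivWithinAt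
  have h2 : HasFDerivWithinAt (fun y : Plane => ((t, y) : ℝ × Plane))
      (ContinuousLinearMap.inr ℝ ℝ Plane) univ y :=
    (hasFDerivAt_prodMk_right t y).hasFDerivWithinAt
  have h3 := h1.comp y h2 fun y _ => ⟨ht, mem_univ _⟩
  exact (hasFDerivWithinAt_univ.1 h3).fderiv

lemma contDiffOn_gradField (h : IsSQGSolution θ T) :
    ContDiffOn ℝ 1 (gradField θ) (Ico 0 T ×ˢ univ) := by
  have h1 : ContDiffOn ℝ 1 (fderivWithin ℝ (fun p : ℝ × Plane => θ p.1 p.2) (Ico 0 T ×ˢ univ))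
      (Ico 0 T ×ˢ univ) :=
    h.contDiff.fderivWithin ((uniqueDiffOn_Ico 0 T).prod uniqueDiffOn_univ) (by norm_num)
  refine (rieszMap.contDiff.comp_contDiffOn (h1.clm_comp
    (contDiffOn_const (c := ContinuousLinearMap.inr ℝ ℝ Plane)))).congr fun p hp => ?_
  rw [gradField, gradient_eq_rieszMap, h.fderiv_slice hp.1]
  rfl

lemma exists_lipschitz_gradField (h : IsSQGSolution θ T) {T' : ℝ} (hT' : T' < T) (R : ℝ) :
    ∃ C : ℝ, 0 ≤ C ∧ ∀ t ∈ Icc 0 T', ∀ t' ∈ Icc 0 T', ∀ y y' : Plane, ‖y‖ ≤ R → ‖y'‖ ≤ R →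
      ‖gradient (θ t) y - gradient (θ t') y'‖ ≤ C * (|t - t'| + ‖y - y'‖) := by
  obtain ⟨C, hC⟩ := (h.contDiffOn_gradField.mono (s := Ico 0 T ×ˢ univ)
    (t := Icc 0 T' ×ˢ Metric.closedBall (0 : Plane) R)
    (prod_mono (Icc_subset_Ico_right hT') (subset_univ _))).exists_lipschitzOnWith one_ne_zero
    ((convex_Icc _ _).prod (convex_closedBall _ _)) (isCompact_Icc.prod (isCompact_closedBall _ _))
  refine ⟨C, C.2, fun t ht t' ht' y y' hy hy' => ?_⟩
  have := hC.dist_le_mul (t, y) ⟨ht, by simpa using hy⟩ (t', y') ⟨ht', by simpa using hy'⟩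
  rw [dist_eq_norm, Prod.dist_eq, Real.dist_eq, dist_eq_norm] at this
  refine this.trans (mul_le_mul_of_nonneg_left ?_ C.2)
  exact max_le (by linarith [norm_nonneg (y - y')]) (by linarith [abs_nonneg (t - t')])

lemma differentiableAt_gradField (h : IsSQGSolution θ T) {t : ℝ} (ht : t ∈ Ioo 0 T) (z : Plane) :
    DifferentiableAt ℝ (gradField θ) (t, z) :=
  (h.contDiffOn_gradField.contDiffAt (prod_mem_nhds (Ico_mem_nhds ht.1 ht.2)
    univ_mem)).differentiableAt (by norm_num)

lemma fderiv_gradField_space (h : IsSQGSolution θ T) {t : ℝ} (ht : t ∈ Ioo 0 T) (z v : Plane) :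
    fderiv ℝ (gradField θ) (t, z) (0, v) = fderiv ℝ (gradient (θ t)) z v := by
  have h1 := (h.differentiableAt_gradField ht z).hasFDerivAt.comp z (hasFDerivAt_prodMk_right t z)
  have h2 : fderiv ℝ (gradient (θ t)) z = _ := h1.fderiv
  rw [h2]
  simp

/-- The derivative of the transport equation along a spatial direction. -/
lemma inner_fderiv_gradField_time (h : IsSQGSolution θ T) {t : ℝ} (ht : t ∈ Ioo 0 T)
    (z v : Plane) :
    inner ℝ (fderiv ℝ (gradField θ) (t, z) (1, 0)) v =
      -(inner ℝ (fderiv ℝ (sqgVelocity (θ t)) z v) (gradient (θ t) z) +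
        inner ℝ (sqgVelocity (θ t) z) (fderiv ℝ (gradient (θ t)) z v)) := by
  obtain ⟨g, B, hb⟩ := h.tame ⟨ht.1.le, ht.2⟩
  set Θ : ℝ × Plane → ℝ := fun p => θ p.1 p.2 with hΘ
  have hc := h.contDiffAt ht z
  have hd : HasFDerivAt (fderiv ℝ Θ) (fderiv ℝ (fderiv ℝ Θ) (t, z)) (t, z) :=
    ((hc.fderiv_right (m := 1) (by norm_num)).differentiableAt (by norm_num)).hasFDerivAt
  have hdiff : ∀ s ∈ Ioo 0 T, ∀ y, HasFDerivAt Θ (fderiv ℝ Θ (s, y)) (s, y) := fun s hs y =>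
    ((h.contDiffAt hs y).differentiableAt (by norm_num)).hasFDerivAt
  -- Joint `C²` regularity lets the time derivative of `∂_v θ` be computed as the `v`-derivative of
  -- `∂_t θ = -u·∇θ`.
  have hsym := (hc.isSymmSndFDerivAt (by simp)).eq (1, 0) (0, v)
  have hline : HasDerivAt (fun s : ℝ => ((s, z) : ℝ × Plane)) (1, 0) t :=
    (hasDerivAt_id t).prodMk (hasDerivAt_const t z)
  have e1 : inner ℝ (fderiv ℝ (gradField θ) (t, z) (1, 0)) v =
      fderiv ℝ (fderiv ℝ Θ) (t, z) (1, 0) (0, v) := by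
    have a1 : HasDerivAt (fun s => inner ℝ (gradField θ (s, z)) v) _ t :=
      (HasFDerivAt.comp_hasDerivAt (l := gradField θ) t
        (h.differentiableAt_gradField ht z).hasFDerivAt hline).inner ℝ (hasDerivAt_const t v)
    have a2 : HasDerivAt (fun s => fderiv ℝ Θ (s, z) (0, v))
        (fderiv ℝ (fderiv ℝ Θ) (t, z) (1, 0) (0, v)) t :=
      HasFDerivAt.comp_hasDerivAt (l := fun A : ℝ × Plane →L[ℝ] ℝ => A (0, v))
        (f := fun s => fderiv ℝ Θ (s, z)) t
        (ContinuousLinearMap.apply ℝ ℝ ((0 : ℝ), v)).hasFDerivAt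
        (HasFDerivAt.comp_hasDerivAt (l := fderiv ℝ Θ) t hd hline)
    have a3 : (fun s => inner ℝ (gradField θ (s, z)) v) =ᶠ[𝓝 t]
        fun s => fderiv ℝ Θ (s, z) (0, v) := by
      filter_upwards [Ioo_mem_nhds ht.1 ht.2] with s hs
      have := ((hdiff s hs z).comp z (hasFDerivAt_prodMk_right s z)).fderiv
      have h' : fderiv ℝ (θ s) z = _ := this
      rw [gradField, inner_gradient, h']
      simp
    have := a1.unique (a2.congr_of_eventuallyEq a3)
    simpa using this
  have e2 : HasFDerivAt (fun y => fderiv ℝ Θ (t, y) (1, 0)) _ z :=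
    (hd.comp z (hasFDerivAt_prodMk_right t z)).clm_apply
      (hasFDerivAt_const ((1 : ℝ), (0 : Plane)) z)
  have e3 : (fun y => fderiv ℝ Θ (t, y) (1, 0)) =
      fun y => -inner ℝ (sqgVelocity (θ t) y) (gradient (θ t) y) := by
    funext y
    exact (HasFDerivAt.comp_hasDerivAt (l := Θ) (f := fun s : ℝ => (s, y)) t (hdiff t ht y)
      ((hasDerivAt_id t).prodMk (hasDerivAt_const t y))).unique (h.hasDerivAt_time ht y)
  rw [e3] at e2
  have e4 := ((((hb.contDiff_sqgVelocity.differentiable (by norm_num) z).hasFDerivAt).inner ℝ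
    (hb.hasFDerivAt_gradient z))).neg
  have e5 := congrArg (fun A : Plane →L[ℝ] ℝ => A v) (e2.unique e4)
  rw [e1, hsym]
  simp at e5
  rw [e5, ← inner_gradient (θ t) z, real_inner_comm]
  ring

/-- The derivative of `|∇^⊥θ|` along a space-time direction, in terms of stretching and of the
slip relative to the flow. -/
lemma exists_hasFDerivAt_norm_gradField (h : IsSQGSolution θ T) {t : ℝ} (ht : t ∈ Ioo 0 T)
    {z : Plane} (hz : gradient (θ t) z ≠ 0) :
    ∃ N : ℝ × Plane →L[ℝ] ℝ, HasFDerivAt (fun p => ‖gradField θ p‖) N (t, z) ∧ ∀ Y,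
      N (1, Y) = ‖gradient (θ t) z‖⁻¹ *
        (inner ℝ (gradPerp (θ t) z)
          (fderiv ℝ (sqgVelocity (θ t)) z (gradPerp (θ t) z)) +
        inner ℝ (gradient (θ t) z)
          (fderiv ℝ (gradient (θ t)) z (Y - sqgVelocity (θ t) z))) := by
  obtain ⟨g, B, hb⟩ := h.tame ⟨ht.1.le, ht.2⟩
  have hd := h.differentiableAt_gradField ht z
  have hz' : gradField θ (t, z) ≠ 0 := hz
  have hn := (hd.norm ℝ hz').hasFDerivAt
  refine ⟨_, hn, fun Y => ?_⟩
  set N := fderiv ℝ (fun p => ‖gradField θ p‖) (t, z)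
  -- The derivative of the norm is read off from that of its square.
  have h1 := (hn.pow 2).unique hd.hasFDerivAt.norm_sq
  have h2 := congrArg (fun A : ℝ × Plane →L[ℝ] ℝ => A (1, Y)) h1
  have hg : gradField θ (t, z) = gradient (θ t) z := rfl
  simp [hg] at h2
  have h3 : fderiv ℝ (gradField θ) (t, z) (1, Y) =
      fderiv ℝ (gradField θ) (t, z) (1, 0) + fderiv ℝ (gradient (θ t)) z Y := by
    rw [← h.fderiv_gradField_space ht, ← map_add]; simp
  have h4 := h.inner_fderiv_gradField_time ht z (gradient (θ t) z)
  have h5 := inner_symm_of_hasGradientAt hb.hasGradientAt (hb.hasFDerivAt_gradient z)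
    (gradient (θ t) z) (sqgVelocity (θ t) z)
  -- The equation gives `-∇θ·(∇u)∇θ`; incompressibility of the plane flow turns it into stretching
  -- along `∇^⊥θ`.
  have h6 := inner_rot_apply_rot (hb.planeTrace_fderiv_sqgVelocity z) (gradient (θ t) z)
  rw [← gradPerp_eq_rot] at h6
  rw [← inner_gradient (θ t) z, h3, inner_add_right, real_inner_comm, h4] at h2
  rw [h6, map_sub, inner_sub_right, eq_inv_mul_iff_mul_eq₀ (norm_ne_zero_iff.2 hz)]
  have h7 := real_inner_comm (gradient (θ t) z)
    (fderiv ℝ (sqgVelocity (θ t)) z (gradient (θ t) z))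
  have h8 := real_inner_comm (sqgVelocity (θ t) z)
    (fderiv ℝ (gradient (θ t)) z (gradient (θ t) z))
  have h9 := real_inner_comm (gradient (θ t) z)
    (fderiv ℝ (gradient (θ t)) z (sqgVelocity (θ t) z))
  linarith

end IsSQGSolution

/-! ### Functions with bounded logarithmic variation -/

lemma integral_eq_sub_of_hasDerivWithinAt_Icc {f f' : ℝ → ℝ} {a b : ℝ} (hab : a ≤ b)
    (hf : ∀ r ∈ Icc a b, HasDerivWithinAt f (f' r) (Icc a b) r) (hc : ContinuousOn f' (Icc a b)) :
    ∫ r in a..b, f' r = f b - f a :=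
  intervalIntegral.integral_eq_sub_of_hasDerivAt_of_le hab
    (fun r hr => (hf r hr).continuousWithinAt)
    (fun r hr => (hf r (Ioo_subset_Icc_self hr)).hasDerivAt (Icc_mem_nhds hr.1 hr.2))
    (hc.intervalIntegrable_of_Icc hab)

section LogVariation

variable {w ρ : ℝ → ℝ} {C₀ : ℝ}

/-- With `A` the primitive of `|ρ|`, `w e^A` increases and `w e^{-A}` decreases, so values of `w`
differ by at most `exp |A r - A s|`. For the weighted integral, this comparison with a fixed `w s`
is integrated exactly on both sides of `s`, and the result is averaged over `s`. It is applied to `w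
= |∇^⊥θ|` with `ρ` the rescaled signed divergence. -/
lemma log_variation_bounds
    (hw : ∀ r ∈ Icc (0 : ℝ) 1, HasDerivWithinAt w (-(ρ r * w r)) (Icc 0 1) r)
    (hρ : ContinuousOn ρ (Icc 0 1)) (hpos : ∀ r ∈ Icc (0 : ℝ) 1, 0 < w r)
    (hC : ∫ r in (0 : ℝ)..1, |ρ r| ≤ C₀) :
    (∀ r ∈ Icc (0 : ℝ) 1, ∀ s ∈ Icc (0 : ℝ) 1, w r ≤ Real.exp C₀ * w s) ∧
    ∫ r in (0 : ℝ)..1, |ρ r| * w r ≤ (Real.exp C₀ - 1) * ∫ r in (0 : ℝ)..1, w r := by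
  -- A continuous extension of `|ρ|` to the line makes `A` differentiable everywhere, including the
  -- endpoints.
  set p : ℝ → ℝ := IccExtend zero_le_one ((Icc (0 : ℝ) 1).domRestrict fun r => |ρ r|) with hp
  have hpc : Continuous p := (hρ.abs.domRestrict).Icc_extend'
  have hpe : ∀ r ∈ Icc (0 : ℝ) 1, p r = |ρ r| := fun r hr => by
    rw [hp, IccExtend_of_mem _ _ hr, domRestrict_apply]
  have hp0 : ∀ r, 0 ≤ p r := fun r => abs_nonneg _
  set A : ℝ → ℝ := fun r => ∫ q in (0 : ℝ)..r, p q with hA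
  have hAd : ∀ r, HasDerivAt A (p r) r := fun r => (hpc.integral_hasStrictDerivAt 0 r).hasDerivAt
  have hAc : Continuous A := continuous_iff_continuousAt.2 fun r => (hAd r).continuousAt
  have hA0 : A 0 = 0 := intervalIntegral.integral_same
  have hint : ∫ r in (0 : ℝ)..1, |ρ r| = A 1 :=
    intervalIntegral.integral_congr fun r hr => by
      rw [uIcc_of_le zero_le_one] at hr; exact (hpe r hr).symm
  have hA1 : A 1 ≤ C₀ := hint ▸ hC
  have hAm : Monotone A := monotone_of_deriv_nonneg (fun r => (hAd r).differentiableAt)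
    fun r => by rw [(hAd r).deriv]; exact hp0 r
  have hwc : ContinuousOn w (Icc 0 1) := fun r hr => (hw r hr).continuousWithinAt
  have hi : ∀ r ∈ interior (Icc (0 : ℝ) 1), r ∈ Icc (0 : ℝ) 1 := fun r hr => interior_subset hr
  have hup : MonotoneOn (fun r => w r * Real.exp (A r)) (Icc 0 1) := by
    refine monotoneOn_of_hasDerivWithinAt_nonneg (convex_Icc _ _)
      (hwc.mul (Real.continuous_exp.comp hAc).continuousOn)
      (fun r hr => ((hw r (hi r hr)).mono interior_subset).mul (hAd r).exp.hasDerivWithinAt)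
      fun r hr => ?_
    rw [hpe r (hi r hr)]
    have := mul_nonneg (mul_nonneg (sub_nonneg.2 (le_abs_self (ρ r))) (hpos r (hi r hr)).le)
      (Real.exp_pos (A r)).le
    linarith
  have hdown : AntitoneOn (fun r => w r * Real.exp (-A r)) (Icc 0 1) := by
    refine antitoneOn_of_hasDerivWithinAt_nonpos (convex_Icc _ _)
      (hwc.mul (Real.continuous_exp.comp hAc.neg).continuousOn)
      (fun r hr => ((hw r (hi r hr)).mono interior_subset).mul (hAd r).neg.exp.hasDerivWithinAt)
      fun r hr => ?_
    rw [hpe r (hi r hr)]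
    have := mul_nonneg (mul_nonneg (neg_le_iff_add_nonneg.1 (neg_abs_le (ρ r)))
      (hpos r (hi r hr)).le) (Real.exp_pos (-A r)).le
    rw [Pi.neg_apply]
    linarith
  have hle : ∀ r ∈ Icc (0 : ℝ) 1, ∀ s ∈ Icc (0 : ℝ) 1, r ≤ s →
      w r ≤ w s * Real.exp (A s - A r) := fun r hr s hs hrs => by
    have := hup hr hs hrs
    rw [sub_eq_add_neg, Real.exp_add, ← mul_assoc, Real.exp_neg, ← div_eq_mul_inv,
      le_div_iff₀ (Real.exp_pos _)]
    exact this
  have hge : ∀ r ∈ Icc (0 : ℝ) 1, ∀ s ∈ Icc (0 : ℝ) 1, s ≤ r →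
      w r ≤ w s * Real.exp (A r - A s) := fun r hr s hs hrs => by
    have h1 : w r * Real.exp (-A r) ≤ w s * Real.exp (-A s) := hdown hs hr hrs
    rw [sub_eq_neg_add, Real.exp_add, ← mul_assoc, ← div_le_iff₀ (Real.exp_pos _), div_eq_mul_inv,
      ← Real.exp_neg]
    exact h1
  refine ⟨fun r hr s hs => ?_, ?_⟩
  · have hb : ∀ q ∈ Icc (0 : ℝ) 1, 0 ≤ A q ∧ A q ≤ C₀ := fun q hq =>
      ⟨hA0 ▸ hAm hq.1, (hAm hq.2).trans hA1⟩
    rw [mul_comm]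
    rcases le_total r s with hrs | hrs
    · refine (hle r hr s hs hrs).trans ?_
      have := hpos s hs
      gcongr
      linarith [(hb r hr).1, (hb s hs).2]
    · refine (hge r hr s hs hrs).trans ?_
      have := hpos s hs
      gcongr
      linarith [(hb s hs).1, (hb r hr).2]
  · set I := ∫ r in (0 : ℝ)..1, |ρ r| * w r with hI
    have hcont : ContinuousOn (fun r => |ρ r| * w r) (Icc 0 1) := hρ.abs.mul hwc
    have key : ∀ s ∈ Icc (0 : ℝ) 1, I ≤ (Real.exp C₀ - 1) * w s := by
      intro s hs
      have i1 : IntervalIntegrable (fun r => |ρ r| * w r) volume 0 s :=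
        (hcont.mono (Icc_subset_Icc_right hs.2)).intervalIntegrable_of_Icc hs.1
      have i2 : IntervalIntegrable (fun r => |ρ r| * w r) volume s 1 :=
        (hcont.mono (Icc_subset_Icc_left hs.1)).intervalIntegrable_of_Icc hs.2
      have l1 : ∫ r in (0 : ℝ)..s, |ρ r| * w r ≤ w s * (Real.exp (A s) - 1) := by
        have c : Continuous fun r => w s * (p r * Real.exp (A s - A r)) := by fun_prop
        have e : ∫ r in (0 : ℝ)..s, w s * (p r * Real.exp (A s - A r)) =
            -(w s * Real.exp (A s - A s)) - -(w s * Real.exp (A s - A 0)) :=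
          intervalIntegral.integral_eq_sub_of_hasDerivAt
            (f := fun r => -(w s * Real.exp (A s - A r))) (fun r _ => by
              convert! (((hAd r).const_sub (A s)).exp.const_mul (w s)).neg using 1
              ring) (c.intervalIntegrable _ _)
        rw [sub_self, hA0, sub_zero, Real.exp_zero] at e
        have : w s * (Real.exp (A s) - 1) =
            ∫ r in (0 : ℝ)..s, w s * (p r * Real.exp (A s - A r)) := by
          rw [e]; ring
        rw [this]
        refine intervalIntegral.integral_mono_on hs.1 i1 (c.intervalIntegrable _ _) fun r hr => ?_
        have hr' : r ∈ Icc (0 : ℝ) 1 := ⟨hr.1, hr.2.trans hs.2⟩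
        rw [hpe r hr', mul_left_comm]
        exact mul_le_mul_of_nonneg_left (hle r hr' s hs hr.2) (abs_nonneg _)
      have l2 : ∫ r in s..1, |ρ r| * w r ≤ w s * (Real.exp (A 1 - A s) - 1) := by
        have c : Continuous fun r => w s * (p r * Real.exp (A r - A s)) := by fun_prop
        have e : ∫ r in s..1, w s * (p r * Real.exp (A r - A s)) =
            w s * Real.exp (A 1 - A s) - w s * Real.exp (A s - A s) :=
          intervalIntegral.integral_eq_sub_of_hasDerivAt
            (f := fun r => w s * Real.exp (A r - A s)) (fun r _ => by
              convert! ((hAd r).sub_const (A s)).exp.const_mul (w s) using 1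
              ring) (c.intervalIntegrable _ _)
        rw [sub_self, Real.exp_zero] at e
        have : w s * (Real.exp (A 1 - A s) - 1) =
            ∫ r in s..1, w s * (p r * Real.exp (A r - A s)) := by
          rw [e]; ring
        rw [this]
        refine intervalIntegral.integral_mono_on hs.2 i2 (c.intervalIntegrable _ _) fun r hr => ?_
        have hr' : r ∈ Icc (0 : ℝ) 1 := ⟨hs.1.trans hr.1, hr.2⟩
        rw [hpe r hr', mul_left_comm]
        exact mul_le_mul_of_nonneg_left (hge r hr' s hs hr.1) (abs_nonneg _)
      have h3 : 1 ≤ Real.exp (A s) := Real.one_le_exp (hA0 ▸ hAm hs.1)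
      have h4 : 1 ≤ Real.exp (A 1 - A s) := Real.one_le_exp (sub_nonneg.2 (hAm hs.2))
      have h5 : Real.exp (A s) * Real.exp (A 1 - A s) ≤ Real.exp C₀ := by
        rw [← Real.exp_add]; exact Real.exp_le_exp.2 (by linarith)
      have h6 : I = (∫ r in (0 : ℝ)..s, |ρ r| * w r) + ∫ r in s..1, |ρ r| * w r :=
        (intervalIntegral.integral_add_adjacent_intervals i1 i2).symm
      -- From `(p - 1)(q - 1) ≥ 0`: the two one-sided losses satisfy `(p - 1) + (q - 1) ≤ pq - 1 ≤
      -- e^{C₀} - 1`.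
      have h7 := mul_nonneg (sub_nonneg.2 h3) (sub_nonneg.2 h4)
      have h8 := hpos s hs
      rw [h6]
      nlinarith
    have := intervalIntegral.integral_mono_on (zero_le_one (α := ℝ)) (f := fun _ => I)
      (g := fun s => (Real.exp C₀ - 1) * w s) (μ := volume) intervalIntegrable_const
      ((hwc.const_smul (Real.exp C₀ - 1)).intervalIntegrable_of_Icc zero_le_one) key
    rw [intervalIntegral.integral_const_mul] at this
    simpa using this

end LogVariation

/-! ### Geometry of a level curve at a fixed time -/

namespace IsTameScalar

variable {f g : Plane → ℝ} {B : ℝ}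

lemma contDiff_gradPerp (h : IsTameScalar f g B) : ContDiff ℝ 1 (gradPerp f) :=
  rot.contDiff.comp h.contDiff_gradient

lemma norm_gradPerp_eq_norm_gradient (f : Plane → ℝ) (z : Plane) :
    ‖gradPerp f z‖ = ‖gradient f z‖ := by rw [gradPerp_eq_rot, norm_rot]

lemma contDiffAt_norm_gradPerp (h : IsTameScalar f g B) {z : Plane} (hz : gradPerp f z ≠ 0) :
    ContDiffAt ℝ 1 (fun y => ‖gradPerp f y‖) z :=
  h.contDiff_gradPerp.contDiffAt.norm ℝ hz

lemma contDiffAt_unitTangent (h : IsTameScalar f g B) {z : Plane} (hz : gradPerp f z ≠ 0) :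
    ContDiffAt ℝ 1 (unitTangent f) z :=
  ((h.contDiffAt_norm_gradPerp hz).inv (norm_ne_zero_iff.2 hz)).smul h.contDiff_gradPerp.contDiffAt

lemma fderiv_norm_gradPerp_apply (h : IsTameScalar f g B) {z : Plane} (hz : gradPerp f z ≠ 0)
    (v : Plane) : fderiv ℝ (fun y => ‖gradPerp f y‖) z v =
      ‖gradient f z‖⁻¹ * inner ℝ (gradient f z) (fderiv ℝ (gradient f) z v) := by
  have hz' : ‖gradient f z‖ ≠ 0 := by
    rw [← norm_gradPerp_eq_norm_gradient]; exact norm_ne_zero_iff.2 hz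
  have h1 := (((h.contDiffAt_norm_gradPerp hz).differentiableAt
    (by norm_num)).hasFDerivAt.pow 2)
  have h2 := (h.hasFDerivAt_gradient z).norm_sq
  have e : (fun y => ‖gradPerp f y‖ ^ 2) = fun y => ‖gradient f y‖ ^ 2 :=
    funext fun y => by rw [norm_gradPerp_eq_norm_gradient]
  have h1' : HasFDerivAt (fun y => ‖gradPerp f y‖ ^ 2) _ z := h1
  rw [e] at h1'
  have h3 := congrArg (fun A : Plane →L[ℝ] ℝ => A v) (h1'.unique h2)
  simp [norm_gradPerp_eq_norm_gradient] at h3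
  rw [eq_inv_mul_iff_mul_eq₀ hz', inner_gradient]
  have h4 : fderiv ℝ (fun y => ‖gradPerp f y‖) z v = fderiv ℝ (fun y => ‖gradient f y‖) z v := by
    simp only [norm_gradPerp_eq_norm_gradient]
  rw [h4]
  linarith

lemma gradPerp_eq_smul {z : Plane} (hz : gradPerp f z ≠ 0) :
    gradPerp f z = ‖gradPerp f z‖ • unitTangent f z := by
  rw [unitTangent, smul_smul, mul_inv_cancel₀ (norm_ne_zero_iff.2 hz), one_smul]

lemma norm_unitTangent {z : Plane} (hz : gradPerp f z ≠ 0) : ‖unitTangent f z‖ = 1 := by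
  rw [unitTangent, norm_smul, norm_inv, norm_norm, inv_mul_cancel₀ (norm_ne_zero_iff.2 hz)]

/-- Along the tangent, `|∇^⊥ f|` decays at the rate `τ`. -/
lemma fderiv_norm_gradPerp_unitTangent (h : IsTameScalar f g B) {z : Plane}
    (hz : gradPerp f z ≠ 0) : fderiv ℝ (fun y => ‖gradPerp f y‖) z (unitTangent f z) =
      -(tangentDivergence f z * ‖gradPerp f z‖) := by
  have h1 := ((h.contDiffAt_norm_gradPerp hz).differentiableAt (by norm_num)).hasFDerivAt.smul
    ((h.contDiffAt_unitTangent hz).differentiableAt (by norm_num)).hasFDerivAt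
  have h2 : gradPerp f =ᶠ[𝓝 z] fun y => ‖gradPerp f y‖ • unitTangent f y := by
    filter_upwards [h.contDiff_gradPerp.continuous.continuousAt.eventually_ne hz] with y hy
    exact gradPerp_eq_smul hy
  -- Trace of the product rule for `∇^⊥f = |∇^⊥f| ξ`: `0 = ξ·∇|∇^⊥f| + |∇^⊥f| τ`.
  have h3 := h.planeTrace_fderiv_gradPerp z
  rw [(h1.congr_of_eventuallyEq h2).fderiv, planeTrace_eq] at h3
  have h4 : tangentDivergence f z = planeTrace (fderiv ℝ (unitTangent f) z) := rfl
  rw [h4, planeTrace_eq]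
  set φ := fderiv ℝ (fun y => ‖gradPerp f y‖) z
  have h5 : φ (unitTangent f z) = unitTangent f z 0 * φ (EuclideanSpace.single 0 1) +
      unitTangent f z 1 * φ (EuclideanSpace.single 1 1) := by
    rw [← smul_eq_mul, ← smul_eq_mul, ← map_smul, ← map_smul, ← map_add]
    congr 1
    ext i; fin_cases i <;> simp
  rw [h5]
  simp at h3
  linarith

end IsTameScalar

/-- `γ` runs over `[0, 1]` along a level curve of `f` without critical points, at the signed
speed `c`. -/
structure IsTangentCurve (f : Plane → ℝ) (γ : ℝ → Plane) (c : ℝ) : Prop where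
  hasDerivWithinAt : ∀ r ∈ Icc (0 : ℝ) 1,
    HasDerivWithinAt γ (c • unitTangent f (γ r)) (Icc 0 1) r
  ne_zero : ∀ r ∈ Icc (0 : ℝ) 1, gradPerp f (γ r) ≠ 0

namespace IsTangentCurve

variable {f g : Plane → ℝ} {B : ℝ} {γ : ℝ → Plane} {c : ℝ}

/-- The derivative of the unit tangent along the curve. -/
noncomputable def turning (f : Plane → ℝ) (γ : ℝ → Plane) (c r : ℝ) : Plane :=
  fderiv ℝ (unitTangent f) (γ r) (c • unitTangent f (γ r))

lemma continuousOn (hγ : IsTangentCurve f γ c) : ContinuousOn γ (Icc 0 1) :=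
  fun r hr => (hγ.hasDerivWithinAt r hr).continuousWithinAt

lemma hasDerivWithinAt_unitTangent (hγ : IsTangentCurve f γ c) (h : IsTameScalar f g B) {r : ℝ}
    (hr : r ∈ Icc (0 : ℝ) 1) :
    HasDerivWithinAt (fun r => unitTangent f (γ r)) (turning f γ c r) (Icc 0 1) r :=
  ((h.contDiffAt_unitTangent (hγ.ne_zero r hr)).differentiableAt
    (by norm_num)).hasFDerivAt.comp_hasDerivWithinAt r (hγ.hasDerivWithinAt r hr)

lemma hasDerivWithinAt_norm (hγ : IsTangentCurve f γ c) (h : IsTameScalar f g B) {r : ℝ}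
    (hr : r ∈ Icc (0 : ℝ) 1) :
    HasDerivWithinAt (fun r => ‖gradPerp f (γ r)‖)
      (-(c * tangentDivergence f (γ r) * ‖gradPerp f (γ r)‖)) (Icc 0 1) r := by
  have h1 := HasFDerivAt.comp_hasDerivWithinAt (l := fun y => ‖gradPerp f y‖) r
    ((h.contDiffAt_norm_gradPerp (hγ.ne_zero r hr)).differentiableAt
    (by norm_num)).hasFDerivAt (hγ.hasDerivWithinAt r hr)
  rw [map_smul, h.fderiv_norm_gradPerp_unitTangent (hγ.ne_zero r hr)] at h1
  convert! h1 using 1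
  rw [smul_eq_mul]
  ring

lemma continuousOn_comp {F : Type*} [TopologicalSpace F] (hγ : IsTangentCurve f γ c)
    {φ : Plane → F} (hφ : ∀ r ∈ Icc (0 : ℝ) 1, ContinuousAt φ (γ r)) :
    ContinuousOn (fun r => φ (γ r)) (Icc 0 1) := fun r hr =>
  (hφ r hr).comp_continuousWithinAt (hγ.continuousOn r hr)

lemma continuousOn_unitTangent (hγ : IsTangentCurve f γ c) (h : IsTameScalar f g B) :
    ContinuousOn (fun r => unitTangent f (γ r)) (Icc 0 1) :=
  hγ.continuousOn_comp fun r hr => (h.contDiffAt_unitTangent (hγ.ne_zero r hr)).continuousAt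

lemma continuousOn_fderiv_unitTangent (hγ : IsTangentCurve f γ c) (h : IsTameScalar f g B) :
    ContinuousOn (fun r => fderiv ℝ (unitTangent f) (γ r)) (Icc 0 1) :=
  hγ.continuousOn_comp fun r hr =>
    ((h.contDiffAt_unitTangent (hγ.ne_zero r hr)).fderiv_right (m := 0) (by norm_num)).continuousAt

lemma continuousOn_turning (hγ : IsTangentCurve f γ c) (h : IsTameScalar f g B) :
    ContinuousOn (turning f γ c) (Icc 0 1) :=
  (hγ.continuousOn_fderiv_unitTangent h).clm_apply ((hγ.continuousOn_unitTangent h).const_smul c)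

lemma continuousOn_tangentDivergence (hγ : IsTangentCurve f γ c) (h : IsTameScalar f g B) :
    ContinuousOn (fun r => tangentDivergence f (γ r)) (Icc 0 1) := by
  unfold tangentDivergence
  refine continuousOn_finsetSum _ fun i _ => ?_
  exact (EuclideanSpace.proj (𝕜 := ℝ) i).continuous.comp_continuousOn
    ((hγ.continuousOn_fderiv_unitTangent h).clm_apply continuousOn_const)

lemma continuousOn_norm (hγ : IsTangentCurve f γ c) (h : IsTameScalar f g B) :
    ContinuousOn (fun r => ‖gradPerp f (γ r)‖) (Icc 0 1) :=
  hγ.continuousOn_comp fun _ _ => h.contDiff_gradPerp.continuous.norm.continuousAt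

lemma norm_turning (f : Plane → ℝ) (γ : ℝ → Plane) (c r : ℝ) :
    ‖turning f γ c r‖ = |c| * levelCurvature f (γ r) := by
  rw [turning, map_smul, norm_smul, Real.norm_eq_abs, levelCurvature]

/-- A unit field is orthogonal to its derivative. Hence the turning pairs only with the normal part
of a velocity, which is the part the flow determines. -/
lemma inner_turning (hγ : IsTangentCurve f γ c) (h : IsTameScalar f g B) {r : ℝ}
    (hr : r ∈ Icc (0 : ℝ) 1) : inner ℝ (turning f γ c r) (unitTangent f (γ r)) = 0 := by
  have h1 := (hγ.hasDerivWithinAt_unitTangent h hr).inner ℝ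
    (hγ.hasDerivWithinAt_unitTangent h hr)
  have h2 : HasDerivWithinAt (fun r => inner ℝ (unitTangent f (γ r)) (unitTangent f (γ r)))
      0 (Icc 0 1) r := by
    refine (hasDerivWithinAt_const r (Icc 0 1) (1 : ℝ)).congr_of_mem (fun s hs => ?_) hr
    rw [real_inner_self_eq_norm_sq, IsTameScalar.norm_unitTangent (hγ.ne_zero s hs), one_pow]
  have h3 := (uniqueDiffOn_Icc (zero_lt_one (α := ℝ)) r hr).eq_deriv _ h1 h2
  rw [real_inner_comm (turning f γ c r)] at h3
  linarith

end IsTangentCurve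

/-! ### Integrated growth of the gradient along one level curve -/

namespace IsTangentCurve

variable {f g : Plane → ℝ} {B : ℝ} {γ : ℝ → Plane} {c : ℝ}

/-- The rate of change of `|∇^⊥ f|` on a moving level curve with tangential speed `b`: stretching
by the flow, and transport by the slip of the curve against the flow. -/
noncomputable def growth (f : Plane → ℝ) (γ : ℝ → Plane) (b : ℝ → ℝ) (r : ℝ) : ℝ :=
  inner ℝ (gradPerp f (γ r)) (fderiv ℝ (sqgVelocity f) (γ r) (unitTangent f (γ r))) +
    (b r - inner ℝ (sqgVelocity f (γ r)) (unitTangent f (γ r))) *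
      fderiv ℝ (fun y => ‖gradPerp f y‖) (γ r) (unitTangent f (γ r))

/-- The balance of the gradient over the curve, with the derivatives moved off the velocity. -/
lemma mul_integral_growth_eq (hγ : IsTangentCurve f γ c) (h : IsTameScalar f g B) {b : ℝ → ℝ}
    {a : ℝ} (hb : ∀ r ∈ Icc (0 : ℝ) 1, HasDerivWithinAt b
      (a + inner ℝ (turning f γ c r) (sqgVelocity f (γ r))) (Icc 0 1) r) :
    c * (∫ r in (0 : ℝ)..1, growth f γ b r) =
      a * (‖gradPerp f (γ 1)‖ - ∫ r in (0 : ℝ)..1, ‖gradPerp f (γ r)‖) +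
      b 0 * (‖gradPerp f (γ 1)‖ - ‖gradPerp f (γ 0)‖) +
      (inner ℝ (gradPerp f (γ 1)) (sqgVelocity f (γ 1)) -
        inner ℝ (gradPerp f (γ 0)) (sqgVelocity f (γ 0))) +
      2 * (∫ r in (0 : ℝ)..1, c * tangentDivergence f (γ r) * ‖gradPerp f (γ r)‖ *
        inner ℝ (sqgVelocity f (γ r)) (unitTangent f (γ r))) +
      ∫ r in (0 : ℝ)..1, (‖gradPerp f (γ 1)‖ - 2 * ‖gradPerp f (γ r)‖) *
        inner ℝ (turning f γ c r) (sqgVelocity f (γ r)) := by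
  set ω : ℝ → ℝ := fun r => ‖gradPerp f (γ r)‖ with hω
  set e : ℝ → Plane := fun r => unitTangent f (γ r) with he
  set u : ℝ → Plane := fun r => sqgVelocity f (γ r) with hu
  set k : ℝ → Plane := turning f γ c with hk
  set τ : ℝ → ℝ := fun r => tangentDivergence f (γ r) with hτ
  have cω : ContinuousOn ω (Icc 0 1) := hγ.continuousOn_norm h
  have ce : ContinuousOn e (Icc 0 1) := hγ.continuousOn_unitTangent h
  have cu : ContinuousOn u (Icc 0 1) :=
    hγ.continuousOn_comp fun _ _ => h.contDiff_sqgVelocity.continuous.continuousAt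
  have ck : ContinuousOn k (Icc 0 1) := hγ.continuousOn_turning h
  have cτ : ContinuousOn τ (Icc 0 1) := hγ.continuousOn_tangentDivergence h
  have cG : ContinuousOn (fun r => gradPerp f (γ r)) (Icc 0 1) :=
    hγ.continuousOn_comp fun _ _ => h.contDiff_gradPerp.continuous.continuousAt
  have cDu : ContinuousOn (fun r => fderiv ℝ (sqgVelocity f) (γ r)) (Icc 0 1) :=
    hγ.continuousOn_comp fun _ _ =>
      (h.contDiff_sqgVelocity.continuous_fderiv (by norm_num)).continuousAt
  have cb : ContinuousOn b (Icc 0 1) := fun r hr => (hb r hr).continuousWithinAt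
  have cs : ContinuousOn (fun r => inner ℝ (k r) (u r)) (Icc 0 1) := ck.inner cu
  have ct : ContinuousOn (fun r => c * τ r * ω r * inner ℝ (u r) (e r)) (Icc 0 1) :=
    ((continuousOn_const.mul cτ).mul cω).mul (cu.inner ce)
  have hDω : ∀ r ∈ Icc (0 : ℝ) 1,
      fderiv ℝ (fun y => ‖gradPerp f y‖) (γ r) (e r) = -(τ r * ω r) := fun r hr =>
    h.fderiv_norm_gradPerp_unitTangent (hγ.ne_zero r hr)
  have hgr : ∀ r ∈ Icc (0 : ℝ) 1, growth f γ b r =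
      inner ℝ (gradPerp f (γ r)) (fderiv ℝ (sqgVelocity f) (γ r) (e r)) +
        (b r - inner ℝ (u r) (e r)) * -(τ r * ω r) := fun r hr => by rw [growth, hDω r hr]
  have cg : ContinuousOn (growth f γ b) (Icc 0 1) := by
    refine ContinuousOn.congr ?_ hgr
    exact (cG.inner (cDu.clm_apply ce)).add ((cb.sub (cu.inner ce)).mul (cτ.mul cω).neg)
  have dω : ∀ r ∈ Icc (0 : ℝ) 1, HasDerivWithinAt ω (-(c * τ r * ω r)) (Icc 0 1) r :=
    fun r hr => hγ.hasDerivWithinAt_norm h hr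
  have du : ∀ r ∈ Icc (0 : ℝ) 1, HasDerivWithinAt u
      (fderiv ℝ (sqgVelocity f) (γ r) (c • e r)) (Icc 0 1) r := fun r hr =>
    (h.contDiff_sqgVelocity.differentiable (by norm_num) _).hasFDerivAt.comp_hasDerivWithinAt r
      (hγ.hasDerivWithinAt r hr)
  have de : ∀ r ∈ Icc (0 : ℝ) 1, HasDerivWithinAt e (k r) (Icc 0 1) r := fun r hr =>
    hγ.hasDerivWithinAt_unitTangent h hr
  have hG : ∀ r ∈ Icc (0 : ℝ) 1, gradPerp f (γ r) = ω r • e r := fun r hr =>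
    IsTameScalar.gradPerp_eq_smul (hγ.ne_zero r hr)
  -- Eliminates the tangential speed at the far end, about which nothing is assumed.
  have hb1 : b 1 - b 0 = a + ∫ r in (0 : ℝ)..1, inner ℝ (k r) (u r) := by
    rw [← integral_eq_sub_of_hasDerivWithinAt_Icc zero_le_one hb (continuousOn_const.add cs),
      intervalIntegral.integral_add intervalIntegrable_const
        (cs.intervalIntegrable_of_Icc zero_le_one)]
    simp
  -- `ω ξ·u + bω` is a primitive of `c` times the growth up to terms free of `∇u`. The prescribed
  -- derivative of `b` contributes a second curvature term `ω k·u`, whence the factors `2`.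
  have hΦ : ∀ r ∈ Icc (0 : ℝ) 1, HasDerivWithinAt
      (fun r => ω r * inner ℝ (e r) (u r) + b r * ω r)
      (c * growth f γ b r - 2 * (c * τ r * ω r * inner ℝ (u r) (e r)) +
        (2 * ω r * inner ℝ (k r) (u r) + a * ω r)) (Icc 0 1) r := by
    intro r hr
    have h1 := ((dω r hr).mul ((de r hr).inner ℝ (du r hr))).add ((hb r hr).mul (dω r hr))
    convert! h1 using 1
    rw [hgr r hr, hG r hr, map_smul, inner_smul_left, inner_smul_right, real_inner_comm (e r) (u r)]
    simp only [conj_trivial]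
    ring
  have i1 := cg.intervalIntegrable_of_Icc (μ := volume) zero_le_one
  have i2 := ct.intervalIntegrable_of_Icc (μ := volume) zero_le_one
  have c3 : ContinuousOn (fun r => 2 * ω r * inner ℝ (k r) (u r) + a * ω r) (Icc 0 1) :=
    ((continuousOn_const.mul cω).mul cs).add (continuousOn_const.mul cω)
  have i3 := c3.intervalIntegrable_of_Icc (μ := volume) zero_le_one
  have iω := cω.intervalIntegrable_of_Icc (μ := volume) zero_le_one
  have is := cs.intervalIntegrable_of_Icc (μ := volume) zero_le_one
  have iωs : IntervalIntegrable (fun r => ω r * inner ℝ (k r) (u r)) volume 0 1 :=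
    (cω.mul cs).intervalIntegrable_of_Icc zero_le_one
  have hI := integral_eq_sub_of_hasDerivWithinAt_Icc zero_le_one hΦ
    (((cg.const_smul c).sub (ct.const_smul (2 : ℝ))).add c3)
  rw [intervalIntegral.integral_add ((i1.const_mul c).sub (i2.const_mul 2)) i3,
    intervalIntegral.integral_sub (i1.const_mul c) (i2.const_mul 2),
    intervalIntegral.integral_const_mul, intervalIntegral.integral_const_mul] at hI
  have e3 : ∫ r in (0 : ℝ)..1, (2 * ω r * inner ℝ (k r) (u r) + a * ω r) =
      2 * (∫ r in (0 : ℝ)..1, ω r * inner ℝ (k r) (u r)) + a * ∫ r in (0 : ℝ)..1, ω r := by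
    rw [← intervalIntegral.integral_const_mul, ← intervalIntegral.integral_const_mul,
      ← intervalIntegral.integral_add (iωs.const_mul 2) (iω.const_mul a)]
    simp only [mul_assoc]
  have e4 : ∫ r in (0 : ℝ)..1, (ω 1 - 2 * ω r) * inner ℝ (k r) (u r) =
      ω 1 * (∫ r in (0 : ℝ)..1, inner ℝ (k r) (u r)) -
        2 * ∫ r in (0 : ℝ)..1, ω r * inner ℝ (k r) (u r) := by
    rw [← intervalIntegral.integral_const_mul, ← intervalIntegral.integral_const_mul,
      ← intervalIntegral.integral_sub (is.const_mul (ω 1)) (iωs.const_mul 2)]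
    simp only [sub_mul, mul_assoc]
  have g0 : inner ℝ (gradPerp f (γ 0)) (u 0) = ω 0 * inner ℝ (e 0) (u 0) := by
    rw [hG 0 (by simp), inner_smul_left]; rfl
  have g1 : inner ℝ (gradPerp f (γ 1)) (u 1) = ω 1 * inner ℝ (e 1) (u 1) := by
    rw [hG 1 (by simp), inner_smul_left]; rfl
  change c * (∫ r in (0 : ℝ)..1, growth f γ b r) = a * (ω 1 - ∫ r in (0 : ℝ)..1, ω r) +
    b 0 * (ω 1 - ω 0) + (inner ℝ (gradPerp f (γ 1)) (u 1) - inner ℝ (gradPerp f (γ 0)) (u 0)) +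
    2 * (∫ r in (0 : ℝ)..1, c * τ r * ω r * inner ℝ (u r) (e r)) +
    ∫ r in (0 : ℝ)..1, (ω 1 - 2 * ω r) * inner ℝ (k r) (u r)
  rw [g0, g1, e4]
  rw [e3] at hI
  linear_combination hI + (ω 1) * hb1

/-- This is `1 - e^{-C₀} ≤ C₀`; it absorbs the surplus `(C₁ - 1)` of the divergence term into `C_V`.
-/
lemma constOne_sub_one_le {C₀ : ℝ} : constOne C₀ - 1 ≤ C₀ * constOne C₀ := by
  have h1 := Real.add_one_le_exp (-C₀)
  have h2 : Real.exp (-C₀) * Real.exp C₀ = 1 := by rw [← Real.exp_add]; simp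
  unfold constOne
  nlinarith [Real.exp_pos C₀]

/-- The growth of the mean of `|∇^⊥ f|` on a moving level curve of non-increasing length. -/
lemma integral_growth_le (hγ : IsTangentCurve f γ c) (h : IsTameScalar f g B) {b : ℝ → ℝ}
    {a σ l l' M C₀ Cl : ℝ} (hσ : σ = 1 ∨ σ = -1) (hc : c = l * σ) (ha : a = l' * σ) (hl : 0 < l)
    (hl' : l' ≤ 0) (hM : ∀ x, ‖sqgVelocity f x‖ ≤ M) (hCl : 0 < Cl)
    (hb : ∀ r ∈ Icc (0 : ℝ) 1, HasDerivWithinAt b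
      (a + inner ℝ (turning f γ c r) (sqgVelocity f (γ r))) (Icc 0 1) r)
    (hb0 : |b 0| ≤ Cl * M)
    (hmax : ∀ r ∈ Icc (0 : ℝ) 1, ‖gradPerp f (γ r)‖ ≤ ‖gradPerp f (γ 1)‖)
    (hκ : ∫ r in (0 : ℝ)..1, ‖turning f γ c r‖ ≤ C₀)
    (hτ : ∫ r in (0 : ℝ)..1, |c * tangentDivergence f (γ r)| ≤ C₀) :
    ∫ r in (0 : ℝ)..1, growth f γ b r ≤
      constV C₀ Cl * M / l * ∫ r in (0 : ℝ)..1, ‖gradPerp f (γ r)‖ := by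
  have hM0 : 0 ≤ M := (norm_nonneg _).trans (hM 0)
  have h0 : (0 : ℝ) ∈ Icc (0 : ℝ) 1 := by simp
  have h1 : (1 : ℝ) ∈ Icc (0 : ℝ) 1 := by simp
  set ω : ℝ → ℝ := fun r => ‖gradPerp f (γ r)‖ with hω
  set Q : ℝ := ∫ r in (0 : ℝ)..1, ω r with hQ
  set C₁ : ℝ := constOne C₀ with hC₁
  have cω : ContinuousOn ω (Icc 0 1) := hγ.continuousOn_norm h
  have ce : ContinuousOn (fun r => unitTangent f (γ r)) (Icc 0 1) := hγ.continuousOn_unitTangent h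
  have cu : ContinuousOn (fun r => sqgVelocity f (γ r)) (Icc 0 1) :=
    hγ.continuousOn_comp fun _ _ => h.contDiff_sqgVelocity.continuous.continuousAt
  have ck : ContinuousOn (turning f γ c) (Icc 0 1) := hγ.continuousOn_turning h
  have cτ : ContinuousOn (fun r => c * tangentDivergence f (γ r)) (Icc 0 1) :=
    continuousOn_const.mul (hγ.continuousOn_tangentDivergence h)
  have dω : ∀ r ∈ Icc (0 : ℝ) 1,
      HasDerivWithinAt ω (-(c * tangentDivergence f (γ r) * ω r)) (Icc 0 1) r :=
    fun r hr => hγ.hasDerivWithinAt_norm h hr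
  have hω0 : ∀ r, 0 ≤ ω r := fun r => norm_nonneg _
  obtain ⟨hcomp, hvar⟩ := log_variation_bounds dω cτ
    (fun r hr => norm_pos_iff.2 (hγ.ne_zero r hr)) hτ
  change ∀ r ∈ Icc (0 : ℝ) 1, ∀ s ∈ Icc (0 : ℝ) 1, ω r ≤ C₁ * ω s at hcomp
  change _ ≤ (C₁ - 1) * Q at hvar
  have iω := cω.intervalIntegrable_of_Icc (μ := volume) zero_le_one
  have hle : ∀ r ∈ Icc (0 : ℝ) 1, ω r ≤ C₁ * Q := fun r hr => by
    have := intervalIntegral.integral_mono_on (zero_le_one (α := ℝ)) (f := fun _ => ω r)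
      (g := fun s => C₁ * ω s) (μ := volume) intervalIntegrable_const (iω.const_mul C₁)
      fun s hs => hcomp r hr s hs
    rw [intervalIntegral.integral_const_mul] at this
    simpa using this
  have hQle : Q ≤ ω 1 := by
    have := intervalIntegral.integral_mono_on (zero_le_one (α := ℝ)) (f := ω)
      (g := fun _ => ω 1) (μ := volume) iω intervalIntegrable_const hmax
    simpa using this
  have hQ0 : 0 ≤ Q := intervalIntegral.integral_nonneg zero_le_one fun r _ => hω0 r
  have hdiff : ω 1 - ω 0 ≤ (C₁ - 1) * Q := by
    rw [← integral_eq_sub_of_hasDerivWithinAt_Icc zero_le_one dω (cτ.mul cω).neg]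
    refine le_trans (intervalIntegral.integral_mono_on zero_le_one
      ((cτ.mul cω).neg.intervalIntegrable_of_Icc zero_le_one)
      ((cτ.abs.mul cω).intervalIntegrable_of_Icc zero_le_one) fun r _ => ?_) hvar
    rw [← neg_mul]
    exact mul_le_mul_of_nonneg_right (neg_le_abs _) (hω0 r)
  have hue : ∀ r ∈ Icc (0 : ℝ) 1,
      |inner ℝ (sqgVelocity f (γ r)) (unitTangent f (γ r))| ≤ M := fun r hr =>
    (abs_real_inner_le_norm _ _).trans (by
      rw [IsTameScalar.norm_unitTangent (hγ.ne_zero r hr), mul_one]; exact hM _)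
  have b1 : |b 0 * (ω 1 - ω 0)| ≤ Cl * M * ((C₁ - 1) * Q) := by
    rw [abs_mul, abs_of_nonneg (sub_nonneg.2 (hmax 0 h0))]
    exact mul_le_mul hb0 hdiff (sub_nonneg.2 (hmax 0 h0)) (by positivity)
  have b2 : ∀ r ∈ Icc (0 : ℝ) 1,
      |inner ℝ (gradPerp f (γ r)) (sqgVelocity f (γ r))| ≤ C₁ * Q * M := fun r hr =>
    (abs_real_inner_le_norm _ _).trans
      (mul_le_mul (hle r hr) (hM _) (norm_nonneg _) ((hω0 r).trans (hle r hr)))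
  have b3 : |∫ r in (0 : ℝ)..1, c * tangentDivergence f (γ r) * ω r *
      inner ℝ (sqgVelocity f (γ r)) (unitTangent f (γ r))| ≤ (C₁ - 1) * Q * M := by
    refine (intervalIntegral.abs_integral_le_integral_abs zero_le_one).trans ?_
    refine (intervalIntegral.integral_mono_on zero_le_one
      (((cτ.mul cω).mul (cu.inner ce)).abs.intervalIntegrable_of_Icc zero_le_one)
      (((cτ.abs.mul cω).intervalIntegrable_of_Icc zero_le_one).mul_const M)
      fun r hr => ?_).trans ?_
    · change |c * tangentDivergence f (γ r) * ω r *
        inner ℝ (sqgVelocity f (γ r)) (unitTangent f (γ r))| ≤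
          |c * tangentDivergence f (γ r)| * ω r * M
      rw [abs_mul, abs_mul, abs_of_nonneg (hω0 r)]
      exact mul_le_mul_of_nonneg_left (hue r hr) (mul_nonneg (abs_nonneg _) (hω0 r))
    · rw [intervalIntegral.integral_mul_const]
      exact mul_le_mul_of_nonneg_right hvar hM0
  have b4 : |∫ r in (0 : ℝ)..1, (ω 1 - 2 * ω r) *
      inner ℝ (turning f γ c r) (sqgVelocity f (γ r))| ≤ ω 1 * M * C₀ := by
    refine (intervalIntegral.abs_integral_le_integral_abs zero_le_one).trans ?_
    refine (intervalIntegral.integral_mono_on zero_le_one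
      (((continuousOn_const.sub (continuousOn_const.mul cω)).mul
        (ck.inner cu)).abs.intervalIntegrable_of_Icc zero_le_one)
      ((ck.norm.intervalIntegrable_of_Icc zero_le_one).const_mul (ω 1 * M))
      fun r hr => ?_).trans ?_
    · change |(ω 1 - 2 * ω r) * inner ℝ (turning f γ c r) (sqgVelocity f (γ r))| ≤ _
      rw [abs_mul, mul_assoc]
      -- Keeping the two curvature terms together costs `ω 1` instead of `3 ω 1`, because `0 ≤ ω r ≤
      -- ω 1`.
      have h3 : |ω 1 - 2 * ω r| ≤ ω 1 :=
        abs_le.2 ⟨by linarith [show ω r ≤ ω 1 from hmax r hr], by linarith [hω0 r]⟩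
      refine mul_le_mul h3 ?_ (abs_nonneg _) (hω0 1)
      refine (abs_real_inner_le_norm _ _).trans ?_
      rw [mul_comm]
      exact mul_le_mul_of_nonneg_right (hM _) (norm_nonneg _)
    · rw [intervalIntegral.integral_const_mul]
      exact mul_le_mul_of_nonneg_left hκ (mul_nonneg (hω0 1) hM0)
  have hC₀ : 0 ≤ C₀ := (intervalIntegral.integral_nonneg zero_le_one
    fun r _ => norm_nonneg _).trans hκ
  have b4' : ω 1 * M * C₀ ≤ C₁ * Q * M * C₀ := by gcongr; exact hle 1 h1
  have key := hγ.mul_integral_growth_eq h hb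
  set E1 := b 0 * (ω 1 - ω 0)
  -- `C_V M Q` exceeds the sum of the bounds by exactly `(C₀C₁ - (C₁ - 1)) M Q`.
  have hconst : Cl * M * ((C₁ - 1) * Q) + (C₁ * Q * M + C₁ * Q * M) + 2 * ((C₁ - 1) * Q * M) +
      C₁ * Q * M * C₀ ≤ constV C₀ Cl * M * Q := by
    have := mul_nonneg (sub_nonneg.2 (constOne_sub_one_le (C₀ := C₀))) (mul_nonneg hM0 hQ0)
    rw [constV, ← hC₁]
    rw [← hC₁] at this
    linarith
  have habs : |c * (∫ r in (0 : ℝ)..1, growth f γ b r) - a * (ω 1 - Q)| ≤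
      constV C₀ Cl * M * Q := by
    rw [key]
    have e1 := abs_le.1 b1
    have e2 := abs_le.1 (b2 0 h0)
    have e2' := abs_le.1 (b2 1 h1)
    have e3 := abs_le.1 b3
    have e4 := abs_le.1 b4
    rw [abs_le]
    constructor <;> linarith [e1.1, e1.2, e2.1, e2.2, e2'.1, e2'.2, e3.1, e3.2, e4.1, e4.2]
  have hle2 : l * ∫ r in (0 : ℝ)..1, growth f γ b r ≤ constV C₀ Cl * M * Q := by
    -- Here the monotone length and the maximum at the end enter: a shrinking segment can only lower
    -- the mean through this term. Since `σ² = 1`, the orientation drops out.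
    have h5 : l' * (ω 1 - Q) ≤ 0 := mul_nonpos_of_nonpos_of_nonneg hl' (sub_nonneg.2 hQle)
    rw [hc, ha] at habs
    rcases hσ with rfl | rfl
    · linarith [(abs_le.1 habs).2]
    · linarith [(abs_le.1 habs).1]
  rw [div_mul_eq_mul_div, le_div_iff₀ hl]
  linarith

end IsTangentCurve

/-! ### Moving level segments -/

/-- The level segment at time `t`, rescaled to the parameter interval `[0, 1]`. -/
noncomputable def rescaledCurve (x : ℝ → ℝ → Plane) (L : ℝ → ℝ) (t r : ℝ) : Plane := x t (L t * r)

/-- A family of level segments of a solution, whose `|∇^⊥θ|` is maximal at the endpoint, is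
comparable with the global maximum, and varies along the segments by a bounded factor. -/
structure IsControlledFamily (θ : ℝ → Plane → ℝ) (T₀ T : ℝ) (x : ℝ → ℝ → Plane) (L : ℝ → ℝ)
    (c₀ C₀ : ℝ) : Prop where
  solution : IsSQGSolution θ T
  nonneg : 0 ≤ T₀
  family : IsLevelSegmentFamily θ T₀ T x L
  pos : 0 < c₀
  sup_le : ∀ t ∈ Ico T₀ T, c₀ * supGradPerp (θ t) ≤ segmentMax (θ t) (x t) (L t)
  max_at_end : ∀ t ∈ Ico T₀ T, ‖gradPerp (θ t) (x t (L t))‖ = segmentMax (θ t) (x t) (L t)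
  integral_le : ∀ t ∈ Ico T₀ T, (∫ s in (0 : ℝ)..(L t), |tangentDivergence (θ t) (x t s)|) ≤ C₀

lemma integral_rescale (φ : ℝ → ℝ) (l : ℝ) :
    ∫ r in (0 : ℝ)..1, l * φ (l * r) = ∫ s in (0 : ℝ)..l, φ s := by
  rw [intervalIntegral.integral_const_mul, intervalIntegral.mul_integral_comp_mul_left, mul_zero,
    mul_one]

/-- Normalization is Lipschitz away from zero. A lower bound at only one of the two points suffices.
-/
lemma norm_unitTangent_sub_le {f₁ f₂ : Plane → ℝ} {z₁ z₂ : Plane} {m : ℝ} (hm : 0 < m)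
    (h₁ : m ≤ ‖gradPerp f₁ z₁‖) (h₂ : gradPerp f₂ z₂ ≠ 0) :
    ‖unitTangent f₁ z₁ - unitTangent f₂ z₂‖ ≤ 2 / m * ‖gradient f₁ z₁ - gradient f₂ z₂‖ := by
  have e0 : ‖gradient f₁ z₁ - gradient f₂ z₂‖ = ‖gradPerp f₁ z₁ - gradPerp f₂ z₂‖ := by
    rw [gradPerp_eq_rot, gradPerp_eq_rot, ← map_sub, norm_rot]
  rw [e0]
  set a := gradPerp f₁ z₁
  set b := gradPerp f₂ z₂
  have ha : 0 < ‖a‖ := hm.trans_le h₁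
  have hb : 0 < ‖b‖ := norm_pos_iff.2 h₂
  have e : unitTangent f₁ z₁ - unitTangent f₂ z₂ =
      ‖a‖⁻¹ • (a - b) + (‖a‖⁻¹ - ‖b‖⁻¹) • b := by
    simp only [unitTangent, smul_sub, sub_smul]
    abel
  have e2 : ‖(‖a‖⁻¹ - ‖b‖⁻¹) • b‖ = ‖a‖⁻¹ * |‖b‖ - ‖a‖| := by
    rw [norm_smul, Real.norm_eq_abs, inv_sub_inv ha.ne' hb.ne', abs_div,
      abs_of_pos (mul_pos ha hb)]
    field_simp
  have h3 : |‖b‖ - ‖a‖| ≤ ‖a - b‖ := by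
    rw [abs_sub_comm]; exact abs_norm_sub_norm_le a b
  have h4 : ‖a‖⁻¹ ≤ m⁻¹ := inv_anti₀ hm h₁
  rw [e]
  refine (norm_add_le _ _).trans ?_
  rw [e2, norm_smul, norm_inv, norm_norm]
  calc ‖a‖⁻¹ * ‖a - b‖ + ‖a‖⁻¹ * |‖b‖ - ‖a‖| ≤ m⁻¹ * ‖a - b‖ + m⁻¹ * ‖a - b‖ := by gcongr
    _ = 2 / m * ‖a - b‖ := by ring

namespace IsControlledFamily

variable {θ : ℝ → Plane → ℝ} {T₀ T : ℝ} {x : ℝ → ℝ → Plane} {L : ℝ → ℝ} {c₀ C₀ : ℝ}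

local notation "X" => rescaledCurve x L

lemma mem_Ico (hF : IsControlledFamily θ T₀ T x L c₀ C₀) {t : ℝ} (ht : t ∈ Ico T₀ T) :
    t ∈ Ico 0 T := ⟨hF.nonneg.trans ht.1, ht.2⟩

lemma mul_mem_Icc (hF : IsControlledFamily θ T₀ T x L c₀ C₀) {t r : ℝ} (ht : t ∈ Ico T₀ T)
    (hr : r ∈ Icc (0 : ℝ) 1) : L t * r ∈ Icc 0 (L t) :=
  have hL := hF.family.length_pos t ht
  ⟨mul_nonneg hL.le hr.1, mul_le_of_le_one_right hL.le hr.2⟩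

lemma exists_sign (hF : IsControlledFamily θ T₀ T x L c₀ C₀) : ∃ σ : ℝ, (σ = 1 ∨ σ = -1) ∧
    ∀ t ∈ Ico T₀ T, IsTangentCurve (θ t) (X t) (L t * σ) := by
  obtain ⟨σ, hσ, hd⟩ := hF.family.arclength
  refine ⟨σ, hσ, fun t ht => ⟨fun r hr => ?_, fun r hr =>
    hF.family.gradPerp_ne t ht _ (hF.mul_mem_Icc ht hr)⟩⟩
  have h1 : HasDerivWithinAt (fun r : ℝ => L t * r) (L t) (Icc 0 1) r := by
    simpa using ((hasDerivAt_id r).const_mul (L t)).hasDerivWithinAt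
  have h2 := (hd t ht _ (hF.mul_mem_Icc ht hr)).scomp r h1 fun s hs => hF.mul_mem_Icc ht hs
  rw [smul_smul] at h2
  exact h2

lemma norm_le_end (hF : IsControlledFamily θ T₀ T x L c₀ C₀) {t r : ℝ} (ht : t ∈ Ico T₀ T)
    (hr : r ∈ Icc (0 : ℝ) 1) : ‖gradPerp (θ t) (X t r)‖ ≤ ‖gradPerp (θ t) (X t 1)‖ := by
  obtain ⟨g, B, hb⟩ := hF.solution.tame (hF.mem_Ico ht)
  rw [rescaledCurve, rescaledCurve, mul_one, hF.max_at_end t ht]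
  refine le_csSup ⟨B, ?_⟩ ⟨_, hF.mul_mem_Icc ht hr, rfl⟩
  rintro _ ⟨s, _, rfl⟩
  simpa only [norm_gradPerp] using hb.norm_fderiv_le _

lemma integral_divergence_le (hF : IsControlledFamily θ T₀ T x L c₀ C₀) {σ : ℝ}
    (hσ : σ = 1 ∨ σ = -1) {t : ℝ} (ht : t ∈ Ico T₀ T) :
    ∫ r in (0 : ℝ)..1, |L t * σ * tangentDivergence (θ t) (X t r)| ≤ C₀ := by
  have hL := hF.family.length_pos t ht
  have hσ' : |σ| = 1 := by rcases hσ with rfl | rfl <;> simp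
  refine le_of_eq_of_le ?_ (hF.integral_le t ht)
  rw [← integral_rescale (fun s => |tangentDivergence (θ t) (x t s)|) (L t)]
  simp only [abs_mul, abs_of_pos hL, hσ', mul_one, rescaledCurve]

/-- The divergence bound makes the maximal endpoint value at most `C₁` times the value at any other
point of the segment. -/
lemma sup_le_mul_norm (hF : IsControlledFamily θ T₀ T x L c₀ C₀) {t r : ℝ} (ht : t ∈ Ico T₀ T)
    (hr : r ∈ Icc (0 : ℝ) 1) :
    c₀ * supGradPerp (θ t) ≤ constOne C₀ * ‖gradPerp (θ t) (X t r)‖ := by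
  obtain ⟨σ, hσ, hγ⟩ := hF.exists_sign
  obtain ⟨g, B, hb⟩ := hF.solution.tame (hF.mem_Ico ht)
  refine (hF.sup_le t ht).trans ?_
  rw [← hF.max_at_end t ht]
  have := (log_variation_bounds (fun s hs => (hγ t ht).hasDerivWithinAt_norm hb hs)
    (continuousOn_const.mul ((hγ t ht).continuousOn_tangentDivergence hb))
    (fun s hs => norm_pos_iff.2 ((hγ t ht).ne_zero s hs))
    (hF.integral_divergence_le hσ ht)).1 1 (by simp) r hr
  simpa only [rescaledCurve, mul_one, constOne] using this

lemma eventually_mem_Icc (hF : IsControlledFamily θ T₀ T x L c₀ C₀) {t : ℝ} (ht : t ∈ Ico T₀ T) :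
    ∀ᶠ t' in 𝓝[Ico T₀ T] t, t' ∈ Ico T₀ T ∧ t' ∈ Icc 0 ((t + T) / 2) := by
  have h1 : ∀ᶠ t' in 𝓝[Ico T₀ T] t, t' < (t + T) / 2 :=
    nhdsWithin_le_nhds (eventually_lt_nhds (by linarith [ht.2]))
  filter_upwards [h1, self_mem_nhdsWithin] with t' h1 h2
  exact ⟨h2, hF.nonneg.trans h2.1, h1.le⟩

/-- Nearby in time, `|∇^⊥θ|` is bounded below on the segments. -/
lemma exists_lower_bound (hF : IsControlledFamily θ T₀ T x L c₀ C₀) {t : ℝ} (ht : t ∈ Ico T₀ T) :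
    ∃ m > 0, ∀ᶠ t' in 𝓝[Ico T₀ T] t, ∀ r ∈ Icc (0 : ℝ) 1, m ≤ ‖gradPerp (θ t') (X t' r)‖ := by
  -- The bound is anchored at this fixed point: `‖∇^⊥θ(z, t')‖` stays away from zero by continuity
  -- in time, it bounds the global supremum from below, and `sup_le_mul_norm` carries this to the
  -- segments. No continuity of the segments in time is needed.
  set z := X t 0 with hz
  have hz0 : 0 < ‖gradPerp (θ t) z‖ :=
    norm_pos_iff.2 (hF.family.gradPerp_ne t ht _ (hF.mul_mem_Icc ht (by simp)))
  obtain ⟨C, hC0, hC⟩ := hF.solution.exists_lipschitz_gradField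
    (T' := (t + T) / 2) (by linarith [ht.2]) ‖z‖
  have hC₁ : 0 < constOne C₀ := Real.exp_pos _
  refine ⟨c₀ * (‖gradPerp (θ t) z‖ / 2) / constOne C₀, by have := hF.pos; positivity, ?_⟩
  have hsmall : ∀ᶠ t' in 𝓝[Ico T₀ T] t, C * |t' - t| < ‖gradPerp (θ t) z‖ / 2 := by
    have : Tendsto (fun t' => C * |t' - t|) (𝓝[Ico T₀ T] t) (𝓝 (C * |t - t|)) :=
      tendsto_nhdsWithin_of_tendsto_nhds (Continuous.tendsto (by fun_prop) t)
    rw [sub_self, abs_zero, mul_zero] at this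
    exact this.eventually_lt_const (by positivity)
  filter_upwards [hsmall, hF.eventually_mem_Icc ht] with t' h1 h2 r hr
  obtain ⟨g, B, hb⟩ := hF.solution.tame (hF.mem_Ico h2.1)
  have h3 := hC t' h2.2 t ⟨hF.nonneg.trans ht.1, by linarith [ht.2]⟩ z z le_rfl le_rfl
  rw [sub_self, norm_zero, add_zero] at h3
  have h4 : ‖gradPerp (θ t) z‖ / 2 ≤ ‖gradPerp (θ t') z‖ := by
    rw [IsTameScalar.norm_gradPerp_eq_norm_gradient] at h1 hz0 ⊢
    rw [IsTameScalar.norm_gradPerp_eq_norm_gradient]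
    have := norm_sub_norm_le (gradient (θ t) z) (gradient (θ t') z)
    rw [norm_sub_rev] at this
    linarith
  rw [div_le_iff₀ hC₁, mul_comm _ (constOne C₀)]
  refine le_trans ?_ (hF.sup_le_mul_norm h2.1 hr)
  exact mul_le_mul_of_nonneg_left (h4.trans (hb.norm_gradPerp_le_sup z)) hF.pos.le

lemma exists_rate {F : Type*} [NormedAddCommGroup F] [NormedSpace ℝ F] {φ : ℝ → F} {s : Set ℝ}
    {t : ℝ} (h : DifferentiableWithinAt ℝ φ s t) :
    ∃ C : ℝ, 0 ≤ C ∧ ∀ᶠ t' in 𝓝[s] t, ‖φ t' - φ t‖ ≤ C * |t' - t| := by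
  obtain ⟨C, hC⟩ := h.hasFDerivWithinAt.isBigO_sub.bound
  refine ⟨max C 0, le_max_right _ _, hC.mono fun t' ht' => ht'.trans ?_⟩
  rw [Real.norm_eq_abs]
  gcongr
  exact le_max_left _ _

/-- The segments move at a bounded speed, and so do the gradient and the tangent on them. -/
lemma exists_lipschitz (hF : IsControlledFamily θ T₀ T x L c₀ C₀) {t : ℝ} (ht : t ∈ Ico T₀ T) :
    ∃ C : ℝ, 0 ≤ C ∧ ∀ᶠ t' in 𝓝[Ico T₀ T] t, ∀ r ∈ Icc (0 : ℝ) 1,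
      ‖X t' r - X t r‖ ≤ C * |t' - t| ∧
      ‖gradient (θ t') (X t' r) - gradient (θ t) (X t r)‖ ≤ C * |t' - t| ∧
      ‖unitTangent (θ t') (X t' r) - unitTangent (θ t) (X t r)‖ ≤ C * |t' - t| := by
  obtain ⟨σ, hσ, hγ⟩ := hF.exists_sign
  have hσ' : |σ| = 1 := by rcases hσ with rfl | rfl <;> simp
  obtain ⟨m, hm, hlow⟩ := hF.exists_lower_bound ht
  obtain ⟨A, hA0, hA⟩ := exists_rate (hF.family.length_diff t ht)
  obtain ⟨D, hD0, hD⟩ := exists_rate (hF.family.start_diff t ht)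
  have hLt := hF.family.length_pos t ht
  -- For `|t' - t| < 1` the start point and the length change by at most `D` and `A`, so all nearby
  -- segments lie in this ball.
  set R : ℝ := ‖x t 0‖ + D + (L t + A) with hR
  obtain ⟨G, hG0, hG⟩ := hF.solution.exists_lipschitz_gradField
    (T' := (t + T) / 2) (by linarith [ht.2]) R
  have hbound : ∀ t' ∈ Ico T₀ T, ∀ r ∈ Icc (0 : ℝ) 1, ‖X t' r‖ ≤ ‖x t' 0‖ + L t' := by
    intro t' ht' r hr
    have h1 := (convex_Icc (0 : ℝ) 1).norm_image_sub_le_of_norm_hasDerivWithin_le (C := L t')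
      (fun s hs => (hγ t' ht').hasDerivWithinAt s hs) (fun s hs => by
        rw [norm_smul, IsTameScalar.norm_unitTangent ((hγ t' ht').ne_zero s hs), mul_one,
          Real.norm_eq_abs, abs_mul, hσ', mul_one, abs_of_pos (hF.family.length_pos t' ht')])
      (left_mem_Icc.2 zero_le_one) hr
    have h2 : ‖X t' r - X t' 0‖ ≤ L t' := h1.trans (by
      rw [sub_zero, Real.norm_of_nonneg hr.1]
      exact mul_le_of_le_one_right (hF.family.length_pos t' ht').le hr.2)
    have h3 : X t' 0 = x t' 0 := by simp [rescaledCurve]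
    have h4 := norm_add_le (X t' r - X t' 0) (X t' 0)
    rw [sub_add_cancel] at h4
    rw [h3] at h2 h4
    linarith
  -- Gronwall rate of `∂_r X = Lσξ`: length times the Lipschitz constant of the tangent. The summand
  -- `1` keeps `K` nonzero for the explicit Gronwall bound that defines `E`.
  set K : ℝ := L t * (2 / m * G) + 1 with hK
  have hK0 : 0 < K := by positivity
  set E : ℝ := (D + (A + K) / K) * Real.exp K with hE
  have hE0 : 0 ≤ E := by positivity
  have hnear : ∀ᶠ t' in 𝓝[Ico T₀ T] t, |t' - t| < 1 := by
    have : Tendsto (fun t' => |t' - t|) (𝓝[Ico T₀ T] t) (𝓝 |t - t|) :=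
      tendsto_nhdsWithin_of_tendsto_nhds (Continuous.tendsto (by fun_prop) t)
    rw [sub_self, abs_zero] at this
    exact this.eventually_lt_const one_pos
  refine ⟨E + G * (1 + E) + 2 / m * (G * (1 + E)), by positivity, ?_⟩
  filter_upwards [hlow, hA, hD, hnear, hF.eventually_mem_Icc ht] with t' h1 h2 h3 h4 h5
  have hgrad : ∀ r ∈ Icc (0 : ℝ) 1, ‖gradient (θ t') (X t' r) - gradient (θ t) (X t r)‖ ≤
      G * (|t' - t| + ‖X t' r - X t r‖) := fun r hr => by
    refine hG t' h5.2 t ⟨hF.nonneg.trans ht.1, by linarith [ht.2]⟩ _ _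
      ((hbound t' h5.1 r hr).trans ?_) ((hbound t ht r hr).trans ?_)
    · have a1 : ‖x t' 0‖ ≤ ‖x t 0‖ + D := by
        have := norm_sub_norm_le (x t' 0) (x t 0)
        nlinarith
      have a2 : L t' ≤ L t + A := by
        have := (le_abs_self _).trans h2
        nlinarith
      linarith
    · linarith
  have htan : ∀ r ∈ Icc (0 : ℝ) 1, ‖unitTangent (θ t') (X t' r) - unitTangent (θ t) (X t r)‖ ≤
      2 / m * (G * (|t' - t| + ‖X t' r - X t r‖)) := fun r hr =>
    (norm_unitTangent_sub_le hm (h1 r hr) ((hγ t ht).ne_zero r hr)).trans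
      (mul_le_mul_of_nonneg_left (hgrad r hr) (by positivity))
  have hdist : ∀ r ∈ Icc (0 : ℝ) 1, ‖X t' r - X t r‖ ≤ E * |t' - t| := by
    intro r hr
    have hgw := norm_le_gronwallBound_of_norm_deriv_right_le (f := fun r => X t' r - X t r)
      (f' := fun r => (L t' * σ) • unitTangent (θ t') (X t' r) -
        (L t * σ) • unitTangent (θ t) (X t r))
      (δ := D * |t' - t|) (K := K) (ε := (A + K) * |t' - t|) (a := 0) (b := 1)
      ((hγ t' h5.1).continuousOn.sub (hγ t ht).continuousOn) (fun s hs => ?_) ?_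
      (fun s hs => ?_) r hr
    · rw [gronwallBound_of_K_ne_0 hK0.ne', sub_zero] at hgw
      refine hgw.trans ?_
      have e1 : Real.exp (K * r) ≤ Real.exp K :=
        Real.exp_le_exp.2 (mul_le_of_le_one_right hK0.le hr.2)
      calc D * |t' - t| * Real.exp (K * r) +
            (A + K) * |t' - t| / K * (Real.exp (K * r) - 1)
          ≤ D * |t' - t| * Real.exp K + (A + K) * |t' - t| / K * Real.exp K := by
            gcongr
            linarith
        _ = E * |t' - t| := by rw [hE]; ring
    · have hs' := Ico_subset_Icc_self hs
      exact (((hγ t' h5.1).hasDerivWithinAt s hs').sub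
        ((hγ t ht).hasDerivWithinAt s hs')).mono_of_mem_nhdsWithin (Icc_mem_nhdsGE_of_mem hs)
    · simpa [rescaledCurve] using h3
    · have hs' := Ico_subset_Icc_self hs
      have e : (L t' * σ) • unitTangent (θ t') (X t' s) - (L t * σ) • unitTangent (θ t) (X t s) =
          ((L t' - L t) * σ) • unitTangent (θ t') (X t' s) +
            (L t * σ) • (unitTangent (θ t') (X t' s) - unitTangent (θ t) (X t s)) := by
        rw [smul_sub, sub_mul, sub_smul]; abel
      rw [e]
      refine (norm_add_le _ _).trans ?_
      rw [norm_smul, norm_smul, IsTameScalar.norm_unitTangent ((hγ t' h5.1).ne_zero s hs'),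
        Real.norm_eq_abs, Real.norm_eq_abs, abs_mul, abs_mul, hσ', mul_one, mul_one, mul_one,
        abs_of_pos hLt]
      have a1 := mul_le_mul_of_nonneg_left (htan s hs') hLt.le
      rw [Real.norm_eq_abs] at h2
      have a2 : L t * (2 / m * (G * (|t' - t| + ‖X t' s - X t s‖))) =
          (K - 1) * (|t' - t| + ‖X t' s - X t s‖) := by rw [hK]; ring
      rw [a2] at a1
      nlinarith [abs_nonneg (t' - t), norm_nonneg (X t' s - X t s)]
  intro r hr
  have d1 := hdist r hr
  have d2 : G * (|t' - t| + ‖X t' r - X t r‖) ≤ G * (1 + E) * |t' - t| := by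
    rw [mul_assoc]
    refine mul_le_mul_of_nonneg_left ?_ hG0
    linarith
  have d3 : 2 / m * (G * (|t' - t| + ‖X t' r - X t r‖)) ≤ 2 / m * (G * (1 + E)) * |t' - t| := by
    rw [mul_assoc (2 / m)]
    exact mul_le_mul_of_nonneg_left d2 (by positivity)
  have p1 : 0 ≤ G * (1 + E) * |t' - t| := by positivity
  have p2 : 0 ≤ 2 / m * (G * (1 + E)) * |t' - t| := by positivity
  have p3 : 0 ≤ E * |t' - t| := by positivity
  refine ⟨?_, (hgrad r hr).trans ?_, (htan r hr).trans ?_⟩ <;> linarith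

end IsControlledFamily

/-! ### The velocity of the moving segments -/

/-- One-sided derivatives at both ends are included, since `φ` is continuous only on the closed
interval. -/
lemma hasDerivWithinAt_integral_Icc {φ : ℝ → ℝ} {a b : ℝ} (hab : a ≤ b)
    (hφ : ContinuousOn φ (Icc a b)) {r : ℝ} (hr : r ∈ Icc a b) :
    HasDerivWithinAt (fun r => ∫ s in a..r, φ s) (φ r) (Icc a b) r := by
  set p : ℝ → ℝ := IccExtend hab ((Icc a b).domRestrict φ) with hp
  have hpc : Continuous p := (hφ.domRestrict).Icc_extend'
  have hpe : ∀ r ∈ Icc a b, p r = φ r := fun r hr => by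
    rw [hp, IccExtend_of_mem _ _ hr, domRestrict_apply]
  have h1 := (hpc.integral_hasStrictDerivAt a r).hasDerivAt.hasDerivWithinAt (s := Icc a b)
  rw [hpe r hr] at h1
  refine h1.congr_of_mem (fun q hq => ?_) hr
  refine intervalIntegral.integral_congr fun s hs => ?_
  rw [uIcc_of_le hq.1] at hs
  exact (hpe s ⟨hs.1, hs.2.trans hq.2⟩).symm

/-- Expansion of a vector in the frame of the unit tangent and the gradient. -/
lemma eq_tangent_add_normal {f : Plane → ℝ} {z : Plane} (hz : gradPerp f z ≠ 0) (v : Plane) :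
    v = inner ℝ v (unitTangent f z) • unitTangent f z +
      (inner ℝ v (gradient f z) / ‖gradient f z‖ ^ 2) • gradient f z := by
  have hn : ‖gradPerp f z‖ = ‖gradient f z‖ := IsTameScalar.norm_gradPerp_eq_norm_gradient f z
  have h0 : ‖gradient f z‖ ≠ 0 := hn ▸ norm_ne_zero_iff.2 hz
  have hsq : ‖gradient f z‖ ^ 2 = gradient f z 0 ^ 2 + gradient f z 1 ^ 2 := by
    rw [← real_inner_self_eq_norm_sq, inner_plane]; ring
  have h0' : gradient f z 0 ^ 2 + gradient f z 1 ^ 2 ≠ 0 := hsq ▸ pow_ne_zero 2 h0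
  have e : inner ℝ v (unitTangent f z) • unitTangent f z =
      (inner ℝ v (gradPerp f z) / ‖gradient f z‖ ^ 2) • gradPerp f z := by
    rw [unitTangent, inner_smul_right, smul_smul, hn]
    congr 1
    field_simp
  rw [e, hsq, inner_plane, inner_plane, gradPerp_eq_rot]
  ext i
  fin_cases i
  · simp
    field_simp
    ring
  · simp
    field_simp
    ring

namespace IsControlledFamily

variable {θ : ℝ → Plane → ℝ} {T₀ T : ℝ} {x : ℝ → ℝ → Plane} {L : ℝ → ℝ} {c₀ C₀ : ℝ}

local notation "X" => rescaledCurve x L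

lemma Ico_mem_nhds_of_Ioo {t : ℝ} (ht : t ∈ Ioo T₀ T) : Ico T₀ T ∈ 𝓝 t := Ico_mem_nhds ht.1 ht.2

/-- The tangential speed of the moving segments. -/
noncomputable def slideSpeed (θ : ℝ → Plane → ℝ) (T₀ T : ℝ) (x : ℝ → ℝ → Plane) (L : ℝ → ℝ)
    (σ t r : ℝ) : ℝ :=
  inner ℝ (derivWithin (fun r => x r 0) (Ico T₀ T) t) (unitTangent (θ t) (x t 0)) +
    ∫ s in (0 : ℝ)..r, (deriv L t * σ + inner ℝ
      (IsTangentCurve.turning (θ t) (rescaledCurve x L t) (L t * σ) s)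
      (sqgVelocity (θ t) (rescaledCurve x L t s)))

/-- Points of the segments move along the level curves with the normal velocity of the flow. -/
lemma tendsto_inner_gradient (hF : IsControlledFamily θ T₀ T x L c₀ C₀) {t : ℝ}
    (ht : t ∈ Ioo T₀ T) {r : ℝ} (hr : r ∈ Icc (0 : ℝ) 1) :
    Tendsto (fun t' => inner ℝ ((t' - t)⁻¹ • (X t' r - X t r)) (gradient (θ t) (X t r)))
      (𝓝[≠] t) (𝓝 (inner ℝ (sqgVelocity (θ t) (X t r)) (gradient (θ t) (X t r)))) := by
  have ht' : t ∈ Ico T₀ T := Ioo_subset_Ico_self ht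
  have ht0 : t ∈ Ioo 0 T := ⟨hF.nonneg.trans_lt ht.1, ht.2⟩
  set z := X t r with hz
  set Θ : ℝ × Plane → ℝ := fun p => θ p.1 p.2 with hΘ
  have hd : HasFDerivAt Θ (fderiv ℝ Θ (t, z)) (t, z) :=
    ((hF.solution.contDiffAt ht0 z).differentiableAt (by norm_num)).hasFDerivAt
  obtain ⟨c, hc⟩ := hF.family.same_level
  obtain ⟨C, hC0, hC⟩ := hF.exists_lipschitz ht'
  rw [nhdsWithin_eq_nhds.2 (Ico_mem_nhds_of_Ioo ht)] at hC
  -- The Lipschitz bound makes the Taylor remainder of `θ` along the moving point `o(t' - t)`,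
  -- before differentiability of the motion is known.
  have hO : (fun t' => ((t', X t' r) : ℝ × Plane) - (t, z)) =O[𝓝 t] fun t' => t' - t := by
    refine Asymptotics.IsBigO.of_bound (max 1 C) (hC.mono fun t' h' => ?_)
    rw [Prod.mk_sub_mk, Prod.norm_mk, Real.norm_eq_abs]
    refine max_le ?_ ?_
    · exact le_mul_of_one_le_left (abs_nonneg _) (le_max_left _ _)
    · exact (h' r hr).1.trans (mul_le_mul_of_nonneg_right (le_max_right _ _) (abs_nonneg _))
  have hcurve : Tendsto (fun t' => ((t', X t' r) : ℝ × Plane)) (𝓝 t) (𝓝 (t, z)) := by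
    have h0 : Tendsto (fun t' : ℝ => t' - t) (𝓝 t) (𝓝 0) := by
      simpa using (continuous_id.sub continuous_const).tendsto (x := t) (f := fun s : ℝ => s - t)
    have := hO.trans_tendsto h0
    simpa using this.add_const ((t, z) : ℝ × Plane)
  have ho := (hd.isLittleO.comp_tendsto hcurve).trans_isBigO hO
  have hlim := ho.tendsto_div_nhds_zero
  -- Both points have the same value of `θ`, so the first-order expansion relates the normal
  -- displacement to `∂_t θ = -u·∇θ`.
  have hval : ∀ᶠ t' in 𝓝[≠] t,
      inner ℝ (sqgVelocity (θ t) z) (gradient (θ t) z) -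
        (Θ (t', X t' r) - Θ (t, z) - fderiv ℝ Θ (t, z) ((t', X t' r) - (t, z))) / (t' - t) =
      inner ℝ ((t' - t)⁻¹ • (X t' r - z)) (gradient (θ t) z) := by
    filter_upwards [self_mem_nhdsWithin, nhdsWithin_le_nhds (Ico_mem_nhds_of_Ioo ht)] with t' h1 h2
    have h3 : t' - t ≠ 0 := sub_ne_zero.2 h1
    have e1 : Θ (t', X t' r) = c := hc t' h2 _ (hF.mul_mem_Icc h2 hr)
    have e2 : Θ (t, z) = c := hc t ht' _ (hF.mul_mem_Icc ht' hr)
    have e3 : fderiv ℝ Θ (t, z) (1, 0) = -inner ℝ (sqgVelocity (θ t) z) (gradient (θ t) z) :=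
      (HasFDerivAt.comp_hasDerivAt (l := Θ) (f := fun s : ℝ => (s, z)) t hd
        ((hasDerivAt_id t).prodMk (hasDerivAt_const t z))).unique
        (hF.solution.hasDerivAt_time ht0 z)
    have e4 : ∀ v, fderiv ℝ Θ (t, z) (0, v) = inner ℝ v (gradient (θ t) z) := fun v => by
      have h5 : fderiv ℝ (θ t) z = _ := (hd.comp z (hasFDerivAt_prodMk_right t z)).fderiv
      rw [real_inner_comm, inner_gradient, h5]
      simp
    have e5 : fderiv ℝ Θ (t, z) ((t', X t' r) - (t, z)) =
        (t' - t) * -inner ℝ (sqgVelocity (θ t) z) (gradient (θ t) z) +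
          inner ℝ (X t' r - z) (gradient (θ t) z) := by
      rw [← e3, ← e4, ← smul_eq_mul, ← map_smul, ← map_add]
      congr 1
      ext <;> simp
    rw [e5, e1, e2, inner_smul_left]
    simp only [conj_trivial]
    field_simp
    ring
  refine Tendsto.congr' hval ?_
  have := (hlim.mono_left (nhdsWithin_le_nhds (s := {t}ᶜ))).const_sub
    (inner ℝ (sqgVelocity (θ t) z) (gradient (θ t) z))
  rw [sub_zero] at this
  exact this

lemma continuousOn_slide (hF : IsControlledFamily θ T₀ T x L c₀ C₀) {σ t : ℝ}
    (hγ : IsTangentCurve (θ t) (X t) (L t * σ)) (ht : t ∈ Ico T₀ T) (a : ℝ) :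
    ContinuousOn (fun s => a + inner ℝ
      (IsTangentCurve.turning (θ t) (X t) (L t * σ) s) (sqgVelocity (θ t) (X t s)))
      (Icc 0 1) := by
  obtain ⟨g, B, hb⟩ := hF.solution.tame (hF.mem_Ico ht)
  exact continuousOn_const.add ((hγ.continuousOn_turning hb).inner
    (hγ.continuousOn_comp fun _ _ => hb.contDiff_sqgVelocity.continuous.continuousAt))

/-- The tangential speed of the segments. -/
lemma tendsto_inner_unitTangent (hF : IsControlledFamily θ T₀ T x L c₀ C₀) {σ : ℝ}
    (hσ : σ = 1 ∨ σ = -1) (hγ : ∀ t ∈ Ico T₀ T, IsTangentCurve (θ t) (X t) (L t * σ)) {t : ℝ}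
    (ht : t ∈ Ioo T₀ T) {r : ℝ} (hr : r ∈ Icc (0 : ℝ) 1) :
    Tendsto (fun t' => inner ℝ ((t' - t)⁻¹ • (X t' r - X t r)) (unitTangent (θ t) (X t r)))
      (𝓝[≠] t) (𝓝 (slideSpeed θ T₀ T x L σ t r)) := by
  have ht' : t ∈ Ico T₀ T := Ioo_subset_Ico_self ht
  obtain ⟨g, B, hb⟩ := hF.solution.tame (hF.mem_Ico ht')
  obtain ⟨C, hC0, hC⟩ := hF.exists_lipschitz ht'
  rw [nhdsWithin_eq_nhds.2 (Ico_mem_nhds_of_Ioo ht)] at hC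
  have hγt := hγ t ht'
  have hsub : ∀ q ∈ uIoc 0 r, q ∈ Icc (0 : ℝ) 1 := fun q hq => by
    rw [uIoc_of_le hr.1] at hq
    exact ⟨hq.1.le, hq.2.trans hr.2⟩
  set e : ℝ → Plane := fun s => unitTangent (θ t) (X t s) with he
  set k : ℝ → Plane := IsTangentCurve.turning (θ t) (X t) (L t * σ) with hk
  have ck : ContinuousOn k (Icc 0 1) := hγt.continuousOn_turning hb
  have ce : ContinuousOn e (Icc 0 1) := hγt.continuousOn_unitTangent hb
  obtain ⟨Ck, hCk⟩ := isCompact_Icc.exists_bound_of_continuousOn ck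
  have hLd : HasDerivAt L (deriv L t) t :=
    ((hF.family.length_diff t ht').differentiableAt (Ico_mem_nhds_of_Ioo ht)).hasDerivAt
  have hxd : HasDerivAt (fun t' => x t' 0) (derivWithin (fun r => x r 0) (Ico T₀ T) t) t :=
    (hF.family.start_diff t ht').hasDerivWithinAt.hasDerivAt (Ico_mem_nhds_of_Ioo ht)
  have hLs := hasDerivAt_iff_tendsto_slope.1 hLd
  have hxs := hasDerivAt_iff_tendsto_slope.1 hxd
  -- the integrand of the tangential displacement
  set Φ : ℝ → ℝ → ℝ := fun t' s =>
    (t' - t)⁻¹ * (σ * (L t' - L t) - L t' * σ *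
      ‖unitTangent (θ t') (X t' s) - e s‖ ^ 2 / 2) +
      inner ℝ (k s) ((t' - t)⁻¹ • (X t' s - X t s)) with hΦ
  have hcont : ∀ t' ∈ Ico T₀ T, ContinuousOn (Φ t') (Icc 0 1) := by
    intro t' h'
    obtain ⟨g', B', hb'⟩ := hF.solution.tame (hF.mem_Ico h')
    have c1 := (hγ t' h').continuousOn_unitTangent hb'
    have c2 := (hγ t' h').continuousOn
    have c3 := hγt.continuousOn
    exact (continuousOn_const.mul (continuousOn_const.sub
      ((continuousOn_const.mul ((c1.sub ce).norm.pow 2)).div_const 2))).add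
      (ck.inner ((c2.sub c3).const_smul (t' - t)⁻¹))
  -- The tangential difference quotient is recovered from its value at the start point by
  -- integrating its `r`-derivative `Φ`.
  have hftc : ∀ᶠ t' in 𝓝[≠] t,
      inner ℝ (slope (fun t' => x t' 0) t t') (e 0) + ∫ s in (0 : ℝ)..r, Φ t' s =
        inner ℝ ((t' - t)⁻¹ • (X t' r - X t r)) (e r) := by
    filter_upwards [nhdsWithin_le_nhds (Ico_mem_nhds_of_Ioo ht)] with t' h'
    have hderiv : ∀ s ∈ Icc 0 r, HasDerivWithinAt
        (fun s => inner ℝ ((t' - t)⁻¹ • (X t' s - X t s)) (e s)) (Φ t' s) (Icc 0 r) s := by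
      intro s hs
      have hs' : s ∈ Icc (0 : ℝ) 1 := ⟨hs.1, hs.2.trans hr.2⟩
      have h1 := ((((hγ t' h').hasDerivWithinAt s hs').sub
        (hγt.hasDerivWithinAt s hs')).const_smul (t' - t)⁻¹).inner ℝ
        (hγt.hasDerivWithinAt_unitTangent hb hs')
      refine (h1.mono (Icc_subset_Icc_right hr.2)).congr_deriv ?_
      have n1 := IsTameScalar.norm_unitTangent ((hγ t' h').ne_zero s hs')
      have n2 : ‖e s‖ = 1 := IsTameScalar.norm_unitTangent (hγt.ne_zero s hs')
      -- For unit vectors the inner product is `1` minus half the squared distance, so the change of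
      -- tangent enters only quadratically and disappears after division by `t' - t`.
      have h2 := norm_sub_sq_real (unitTangent (θ t') (X t' s)) (e s)
      rw [n1, n2] at h2
      have h3 : inner ℝ (e s) (e s) = (1 : ℝ) := by
        rw [real_inner_self_eq_norm_sq, n2, one_pow]
      change inner ℝ ((t' - t)⁻¹ • (X t' s - X t s)) (k s) + inner ℝ ((t' - t)⁻¹ •
        ((L t' * σ) • unitTangent (θ t') (X t' s) - (L t * σ) • e s)) (e s) = _
      rw [real_inner_comm (k s)]
      simp only [hΦ, inner_smul_left, inner_sub_left, conj_trivial, h3]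
      rw [h2]
      ring
    have h4 := integral_eq_sub_of_hasDerivWithinAt_Icc hr.1 hderiv
      ((hcont t' h').mono (Icc_subset_Icc_right hr.2))
    rw [h4, slope_def_module]
    simp [rescaledCurve]
  refine Tendsto.congr' hftc ?_
  have hx0 : unitTangent (θ t) (x t 0) = e 0 := by simp [he, rescaledCurve]
  rw [slideSpeed, hx0]
  refine (hxs.inner tendsto_const_nhds).add ?_
  have hLlip : ∀ᶠ t' in 𝓝[≠] t, |slope L t t'| ≤ |deriv L t| + 1 :=
    (hLs.abs.eventually_lt_const (lt_add_one _)).mono fun _ h => h.le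
  have hLb : ∀ᶠ t' in 𝓝[≠] t, |L t'| ≤ |L t| + 1 :=
    ((hLd.continuousAt.abs.tendsto.mono_left nhdsWithin_le_nhds).eventually_lt_const
      (lt_add_one _)).mono fun _ h => h.le
  have hone : ∀ᶠ t' in 𝓝[≠] t, |t' - t| ≤ 1 := by
    have : Tendsto (fun t' => |t' - t|) (𝓝[≠] t) (𝓝 |t - t|) :=
      tendsto_nhdsWithin_of_tendsto_nhds (Continuous.tendsto (by fun_prop) t)
    rw [sub_self, abs_zero] at this
    exact (this.eventually_lt_const one_pos).mono fun _ h => h.le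
  have hσ' : |σ| = 1 := by rcases hσ with rfl | rfl <;> simp
  have hterm : ∀ᶠ t' in 𝓝[≠] t, ∀ s ∈ Icc (0 : ℝ) 1,
      |(t' - t)⁻¹ * (L t' * σ * ‖unitTangent (θ t') (X t' s) - e s‖ ^ 2 / 2)| ≤
        (|L t| + 1) * C ^ 2 * |t' - t| := by
    filter_upwards [hLb, nhdsWithin_le_nhds hC, self_mem_nhdsWithin] with t' h1 h2 h3 s hs
    have h4 : 0 < |t' - t| := abs_pos.2 (sub_ne_zero.2 h3)
    have h5 : ‖unitTangent (θ t') (X t' s) - e s‖ ^ 2 ≤ (C * |t' - t|) ^ 2 := by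
      have := (h2 s hs).2.2
      gcongr
    rw [abs_mul, abs_inv, abs_div, abs_mul, abs_mul, hσ', mul_one,
      abs_of_nonneg (sq_nonneg ‖unitTangent (θ t') (X t' s) - e s‖), abs_two, inv_mul_le_iff₀ h4]
    have h6 : |L t'| * ‖unitTangent (θ t') (X t' s) - e s‖ ^ 2 ≤
        (|L t| + 1) * (C * |t' - t|) ^ 2 := by gcongr
    have h7 : 0 ≤ (|L t| + 1) * (C * |t' - t|) ^ 2 := by positivity
    calc _ ≤ (|L t| + 1) * (C * |t' - t|) ^ 2 := by linarith
      _ = _ := by ring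
  have hslope : ∀ t', (t' - t)⁻¹ * (σ * (L t' - L t)) = σ * slope L t t' := fun t' => by
    rw [slope_def_module, smul_eq_mul]; ring
  refine intervalIntegral.tendsto_integral_filter_of_dominated_convergence
    (fun _ => |deriv L t| + 1 + (|L t| + 1) * C ^ 2 + Ck * C) ?_ ?_ intervalIntegrable_const ?_
  · filter_upwards [nhdsWithin_le_nhds (Ico_mem_nhds_of_Ioo ht)] with t' h'
    exact ((hcont t' h').mono fun q hq => hsub q hq).aestronglyMeasurable measurableSet_uIoc
  · filter_upwards [hLlip, hterm, hone, nhdsWithin_le_nhds hC, self_mem_nhdsWithin]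
      with t' h1 h2 h3 h4 h5
    refine Eventually.of_forall fun s hs => ?_
    have hs' := hsub s hs
    have h6 : 0 < |t' - t| := abs_pos.2 (sub_ne_zero.2 h5)
    rw [hΦ, Real.norm_eq_abs]
    simp only [mul_sub (t' - t)⁻¹, hslope]
    refine (abs_add_le _ _).trans (add_le_add ((abs_sub _ _).trans (add_le_add ?_ ?_)) ?_)
    · rw [abs_mul, hσ', one_mul]; exact h1
    · refine (h2 s hs').trans ?_
      exact mul_le_of_le_one_right (by positivity) h3
    · refine (abs_real_inner_le_norm _ _).trans ?_
      refine mul_le_mul (hCk s hs') ?_ (norm_nonneg _) ((norm_nonneg _).trans (hCk s hs'))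
      rw [norm_smul, norm_inv, Real.norm_eq_abs, inv_mul_le_iff₀ h6, mul_comm]
      exact (h4 s hs').1
  · refine Eventually.of_forall fun s hs => ?_
    have hs' := hsub s hs
    have hne := hγt.ne_zero s hs'
    have l1 : Tendsto (fun t' => σ * slope L t t') (𝓝[≠] t) (𝓝 (σ * deriv L t)) :=
      hLs.const_mul σ
    have l2 : Tendsto (fun t' => (t' - t)⁻¹ *
        (L t' * σ * ‖unitTangent (θ t') (X t' s) - e s‖ ^ 2 / 2)) (𝓝[≠] t) (𝓝 0) := by
      have l0 : Tendsto (fun t' => (|L t| + 1) * C ^ 2 * |t' - t|) (𝓝[≠] t) (𝓝 0) := by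
        have : Tendsto (fun t' => (|L t| + 1) * C ^ 2 * |t' - t|) (𝓝[≠] t)
            (𝓝 ((|L t| + 1) * C ^ 2 * |t - t|)) :=
          tendsto_nhdsWithin_of_tendsto_nhds (Continuous.tendsto (by fun_prop) t)
        simpa using this
      exact squeeze_zero_norm' (hterm.mono fun t' h => h s hs') l0
    -- The turning is normal to the curve, so only the normal displacement matters here, and its
    -- limit is already known.
    have l3 : Tendsto (fun t' => inner ℝ (k s) ((t' - t)⁻¹ • (X t' s - X t s))) (𝓝[≠] t)
        (𝓝 (inner ℝ (k s) (sqgVelocity (θ t) (X t s)))) := by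
      have e1 : ∀ v, inner ℝ (k s) v = inner ℝ (k s) (gradient (θ t) (X t s)) /
          ‖gradient (θ t) (X t s)‖ ^ 2 * inner ℝ v (gradient (θ t) (X t s)) := fun v => by
        conv_lhs => rw [eq_tangent_add_normal hne (k s), hγt.inner_turning hb hs', zero_smul,
          zero_add, inner_smul_left, conj_trivial]
        rw [real_inner_comm v]
      rw [e1 (sqgVelocity (θ t) (X t s))]
      refine Tendsto.congr (fun t' => (e1 _).symm) ?_
      exact (hF.tendsto_inner_gradient ht hs').const_mul _
    have l4 := (l1.sub l2).add l3
    rw [sub_zero, mul_comm σ] at l4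
    refine l4.congr fun t' => ?_
    rw [hΦ]
    simp only [mul_sub (t' - t)⁻¹, hslope]

/-- Normal and tangential limits combine in the frame of `ξ` and `∇θ`. The form `u + (slip) ξ`
isolates the slip against the flow. -/
lemma hasDerivAt_rescaledCurve (hF : IsControlledFamily θ T₀ T x L c₀ C₀) {σ : ℝ}
    (hσ : σ = 1 ∨ σ = -1) (hγ : ∀ t ∈ Ico T₀ T, IsTangentCurve (θ t) (X t) (L t * σ)) {t : ℝ}
    (ht : t ∈ Ioo T₀ T) {r : ℝ} (hr : r ∈ Icc (0 : ℝ) 1) :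
    HasDerivAt (fun t' => X t' r) (sqgVelocity (θ t) (X t r) +
      (slideSpeed θ T₀ T x L σ t r -
        inner ℝ (sqgVelocity (θ t) (X t r)) (unitTangent (θ t) (X t r))) •
          unitTangent (θ t) (X t r)) t := by
  have hne := (hγ t (Ioo_subset_Ico_self ht)).ne_zero r hr
  have h1 := hF.tendsto_inner_gradient ht hr
  have h2 := hF.tendsto_inner_unitTangent hσ hγ ht hr
  have h3 := (h2.smul_const (unitTangent (θ t) (X t r))).add
    ((h1.div_const (‖gradient (θ t) (X t r)‖ ^ 2)).smul_const (gradient (θ t) (X t r)))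
  rw [hasDerivAt_iff_tendsto_slope]
  have e1 := eq_tangent_add_normal hne (sqgVelocity (θ t) (X t r))
  have e2 : sqgVelocity (θ t) (X t r) + (slideSpeed θ T₀ T x L σ t r -
      inner ℝ (sqgVelocity (θ t) (X t r)) (unitTangent (θ t) (X t r))) •
        unitTangent (θ t) (X t r) =
      slideSpeed θ T₀ T x L σ t r • unitTangent (θ t) (X t r) +
        (inner ℝ (sqgVelocity (θ t) (X t r)) (gradient (θ t) (X t r)) /
          ‖gradient (θ t) (X t r)‖ ^ 2) • gradient (θ t) (X t r) := by
    conv_lhs => enter [1]; rw [e1]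
    rw [sub_smul]
    abel
  rw [e2]
  refine h3.congr fun t' => ?_
  rw [slope_def_module]
  exact (eq_tangent_add_normal hne _).symm

end IsControlledFamily

/-! ### Evolution of the mean of the gradient and the final growth estimate -/

namespace IsControlledFamily

variable {θ : ℝ → Plane → ℝ} {T₀ T : ℝ} {x : ℝ → ℝ → Plane} {L : ℝ → ℝ} {c₀ C₀ : ℝ}

local notation "X" => rescaledCurve x L

lemma segmentMean_eq (hF : IsControlledFamily θ T₀ T x L c₀ C₀) {t : ℝ} (ht : t ∈ Ico T₀ T) :
    segmentMean (θ t) (x t) (L t) = ∫ r in (0 : ℝ)..1, ‖gradPerp (θ t) (X t r)‖ := by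
  have hL := hF.family.length_pos t ht
  rw [segmentMean, ← integral_rescale, intervalIntegral.integral_const_mul, ← mul_assoc,
    one_div_mul_cancel hL.ne', one_mul]
  rfl

lemma intervalIntegrable_norm (hF : IsControlledFamily θ T₀ T x L c₀ C₀) {t : ℝ}
    (ht : t ∈ Ico T₀ T) :
    IntervalIntegrable (fun r => ‖gradPerp (θ t) (X t r)‖) volume 0 1 := by
  obtain ⟨σ, hσ, hγ⟩ := hF.exists_sign
  obtain ⟨g, B, hb⟩ := hF.solution.tame (hF.mem_Ico ht)
  exact ((hγ t ht).continuousOn_norm hb).intervalIntegrable_of_Icc zero_le_one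

lemma exists_norm_sub_le (hF : IsControlledFamily θ T₀ T x L c₀ C₀) {t : ℝ} (ht : t ∈ Ico T₀ T) :
    ∃ C : ℝ, 0 ≤ C ∧ ∀ᶠ t' in 𝓝[Ico T₀ T] t, t' ∈ Ico T₀ T ∧ ∀ r ∈ Icc (0 : ℝ) 1,
      |‖gradPerp (θ t') (X t' r)‖ - ‖gradPerp (θ t) (X t r)‖| ≤ C * |t' - t| := by
  obtain ⟨C, hC0, hC⟩ := hF.exists_lipschitz ht
  refine ⟨C, hC0, ?_⟩
  filter_upwards [hC, self_mem_nhdsWithin] with t' h1 h2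
  refine ⟨h2, fun r hr => ?_⟩
  rw [IsTameScalar.norm_gradPerp_eq_norm_gradient, IsTameScalar.norm_gradPerp_eq_norm_gradient]
  exact (abs_norm_sub_norm_le _ _).trans (h1 r hr).2.1

lemma continuousOn_segmentMean (hF : IsControlledFamily θ T₀ T x L c₀ C₀) :
    ContinuousOn (fun t => segmentMean (θ t) (x t) (L t)) (Ico T₀ T) := by
  intro t ht
  obtain ⟨C, hC0, hC⟩ := hF.exists_norm_sub_le ht
  have hlim : Tendsto (fun t' => C * |t' - t|) (𝓝[Ico T₀ T] t) (𝓝 0) := by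
    have : Tendsto (fun t' => C * |t' - t|) (𝓝[Ico T₀ T] t) (𝓝 (C * |t - t|)) :=
      tendsto_nhdsWithin_of_tendsto_nhds (Continuous.tendsto (by fun_prop) t)
    simpa using this
  refine tendsto_iff_norm_sub_tendsto_zero.2 (squeeze_zero' (Eventually.of_forall fun _ =>
    norm_nonneg _) (hC.mono fun t' h => ?_) hlim)
  change ‖segmentMean (θ t') (x t') (L t') - segmentMean (θ t) (x t) (L t)‖ ≤ _
  rw [hF.segmentMean_eq ht, hF.segmentMean_eq h.1,
    ← intervalIntegral.integral_sub (hF.intervalIntegrable_norm h.1)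
      (hF.intervalIntegrable_norm ht)]
  have := intervalIntegral.norm_integral_le_of_norm_le_const (a := 0) (b := 1)
    (f := fun r => ‖gradPerp (θ t') (X t' r)‖ - ‖gradPerp (θ t) (X t r)‖) (C := C * |t' - t|)
    fun r hr => h.2 r (by rw [uIoc_of_le zero_le_one] at hr; exact Ioc_subset_Icc_self hr)
  simpa using this

lemma hasDerivAt_norm_gradPerp (hF : IsControlledFamily θ T₀ T x L c₀ C₀) {σ : ℝ}
    (hσ : σ = 1 ∨ σ = -1) (hγ : ∀ t ∈ Ico T₀ T, IsTangentCurve (θ t) (X t) (L t * σ)) {t : ℝ}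
    (ht : t ∈ Ioo T₀ T) {r : ℝ} (hr : r ∈ Icc (0 : ℝ) 1) :
    HasDerivAt (fun t' => ‖gradPerp (θ t') (X t' r)‖)
      (IsTangentCurve.growth (θ t) (X t) (slideSpeed θ T₀ T x L σ t) r) t := by
  have ht' : t ∈ Ico T₀ T := Ioo_subset_Ico_self ht
  have ht0 : t ∈ Ioo 0 T := ⟨hF.nonneg.trans_lt ht.1, ht.2⟩
  obtain ⟨g, B, hb⟩ := hF.solution.tame (hF.mem_Ico ht')
  have hne := (hγ t ht').ne_zero r hr
  have hn : ‖gradPerp (θ t) (X t r)‖ = ‖gradient (θ t) (X t r)‖ :=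
    IsTameScalar.norm_gradPerp_eq_norm_gradient _ _
  have hne' : gradient (θ t) (X t r) ≠ 0 := norm_ne_zero_iff.1 (hn ▸ norm_ne_zero_iff.2 hne)
  obtain ⟨N, hN, hNv⟩ := hF.solution.exists_hasFDerivAt_norm_gradField ht0 hne'
  have h1 := HasFDerivAt.comp_hasDerivAt (l := fun p => ‖gradField θ p‖)
    (f := fun t' => (t', X t' r)) t hN
    ((hasDerivAt_id t).prodMk (hF.hasDerivAt_rescaledCurve hσ hγ ht hr))
  rw [hNv] at h1
  have e : (fun t' => ‖gradPerp (θ t') (X t' r)‖) =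
      (fun p => ‖gradField θ p‖) ∘ fun t' => (t', X t' r) :=
    funext fun t' => IsTameScalar.norm_gradPerp_eq_norm_gradient _ _
  rw [e]
  refine h1.congr_deriv (Eq.symm ?_)
  rw [IsTangentCurve.growth, hb.fderiv_norm_gradPerp_apply hne, add_sub_cancel_left, map_smul,
    inner_smul_right, mul_add, mul_left_comm ‖gradient (θ t) (X t r)‖⁻¹]
  congr 1
  conv_rhs => enter [2, 3]; rw [IsTameScalar.gradPerp_eq_smul hne]
  rw [map_smul, inner_smul_right, hn, inv_mul_cancel_left₀ (norm_ne_zero_iff.2 hne')]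

/-- After rescaling the integration interval is fixed, so differentiation passes under the integral;
the uniform Lipschitz bound dominates the difference quotients. -/
lemma hasDerivAt_segmentMean (hF : IsControlledFamily θ T₀ T x L c₀ C₀) {σ : ℝ}
    (hσ : σ = 1 ∨ σ = -1) (hγ : ∀ t ∈ Ico T₀ T, IsTangentCurve (θ t) (X t) (L t * σ)) {t : ℝ}
    (ht : t ∈ Ioo T₀ T) :
    HasDerivAt (fun t => segmentMean (θ t) (x t) (L t))
      (∫ r in (0 : ℝ)..1, IsTangentCurve.growth (θ t) (X t) (slideSpeed θ T₀ T x L σ t) r) t := by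
  have ht' : t ∈ Ico T₀ T := Ioo_subset_Ico_self ht
  obtain ⟨C, hC0, hC⟩ := hF.exists_norm_sub_le ht'
  rw [nhdsWithin_eq_nhds.2 (Ico_mem_nhds_of_Ioo ht)] at hC
  have hsub : ∀ q ∈ uIoc (0 : ℝ) 1, q ∈ Icc (0 : ℝ) 1 := fun q hq => by
    rw [uIoc_of_le zero_le_one] at hq; exact Ioc_subset_Icc_self hq
  rw [hasDerivAt_iff_tendsto_slope]
  have heq : ∀ᶠ t' in 𝓝[≠] t,
      ∫ r in (0 : ℝ)..1, slope (fun t' => ‖gradPerp (θ t') (X t' r)‖) t t' =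
        slope (fun t => segmentMean (θ t) (x t) (L t)) t t' := by
    filter_upwards [nhdsWithin_le_nhds hC] with t' h
    rw [slope_def_field, hF.segmentMean_eq ht', hF.segmentMean_eq h.1,
      ← intervalIntegral.integral_sub (hF.intervalIntegrable_norm h.1)
        (hF.intervalIntegrable_norm ht'), ← intervalIntegral.integral_div]
    simp only [slope_def_field]
  refine Tendsto.congr' heq ?_
  refine intervalIntegral.tendsto_integral_filter_of_dominated_convergence (fun _ => C) ?_ ?_
    intervalIntegrable_const ?_
  · filter_upwards [nhdsWithin_le_nhds hC] with t' h
    have := ((hF.intervalIntegrable_norm h.1).sub (hF.intervalIntegrable_norm ht')).div_const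
      (t' - t)
    simp only [slope_def_field]
    exact (intervalIntegrable_iff.1 this).aestronglyMeasurable
  · filter_upwards [nhdsWithin_le_nhds hC, self_mem_nhdsWithin] with t' h h'
    refine Eventually.of_forall fun r hr => ?_
    rw [slope_def_field, Real.norm_eq_abs, abs_div,
      div_le_iff₀ (abs_pos.2 (sub_ne_zero.2 h'))]
    exact h.2 r (hsub r hr)
  · exact Eventually.of_forall fun r hr =>
      hasDerivAt_iff_tendsto_slope.1 (hF.hasDerivAt_norm_gradPerp hσ hγ ht (hsub r hr))

lemma segmentMean_pos (hF : IsControlledFamily θ T₀ T x L c₀ C₀) {t : ℝ} (ht : t ∈ Ico T₀ T) :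
    0 < segmentMean (θ t) (x t) (L t) := by
  obtain ⟨σ, hσ, hγ⟩ := hF.exists_sign
  rw [hF.segmentMean_eq ht]
  exact intervalIntegral.intervalIntegral_pos_of_pos_on (hF.intervalIntegrable_norm ht)
    (fun r hr => norm_pos_iff.2 ((hγ t ht).ne_zero r (Ioo_subset_Icc_self hr))) zero_lt_one

lemma sup_le_mul_segmentMean (hF : IsControlledFamily θ T₀ T x L c₀ C₀) {t : ℝ}
    (ht : t ∈ Ico T₀ T) :
    supGradPerp (θ t) ≤ constOne C₀ / c₀ * segmentMean (θ t) (x t) (L t) := by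
  have := intervalIntegral.integral_mono_on (zero_le_one (α := ℝ))
    (f := fun _ => c₀ * supGradPerp (θ t)) (g := fun r => constOne C₀ * ‖gradPerp (θ t) (X t r)‖)
    (μ := volume) intervalIntegrable_const ((hF.intervalIntegrable_norm ht).const_mul _)
    fun r hr => hF.sup_le_mul_norm ht hr
  rw [intervalIntegral.integral_const_mul (constOne C₀), ← hF.segmentMean_eq ht,
    intervalIntegral.integral_const, sub_zero, one_smul] at this
  rw [div_mul_eq_mul_div, le_div_iff₀ hF.pos]
  simpa [mul_comm] using this

/-- The differential inequality for the mean of `|∇^⊥θ|` on the segments. -/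
lemma exists_hasDerivAt_segmentMean_le (hF : IsControlledFamily θ T₀ T x L c₀ C₀)
    (hL : AntitoneOn L (Ico T₀ T)) {t M Cl : ℝ} (ht : t ∈ Ioo T₀ T) (hCl : 0 < Cl)
    (hM : ∀ x, ‖sqgVelocity (θ t) x‖ ≤ M)
    (hκ : (∫ s in (0 : ℝ)..(L t), |levelCurvature (θ t) (x t s)|) ≤ C₀)
    (hstart : |inner ℝ (derivWithin (fun r => x r 0) (Ico T₀ T) t) (unitTangent (θ t) (x t 0))| ≤
      Cl * segmentTangentialSpeed (θ t) (x t) (L t)) :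
    ∃ q : ℝ, HasDerivAt (fun t => segmentMean (θ t) (x t) (L t)) q t ∧
      q ≤ constV C₀ Cl * M / L t * segmentMean (θ t) (x t) (L t) := by
  have ht' : t ∈ Ico T₀ T := Ioo_subset_Ico_self ht
  obtain ⟨σ, hσ, hγ⟩ := hF.exists_sign
  obtain ⟨g, B, hb⟩ := hF.solution.tame (hF.mem_Ico ht')
  have hLt := hF.family.length_pos t ht'
  have hσ' : |σ| = 1 := by rcases hσ with rfl | rfl <;> simp
  refine ⟨_, hF.hasDerivAt_segmentMean hσ hγ ht, ?_⟩
  rw [hF.segmentMean_eq ht']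
  refine (hγ t ht').integral_growth_le hb (a := deriv L t * σ) (l' := deriv L t) hσ rfl rfl hLt ?_
    hM hCl (fun r hr => ?_) ?_ (fun r hr => hF.norm_le_end ht' hr) ?_
    (hF.integral_divergence_le hσ ht')
  · rw [← derivWithin_of_mem_nhds (Ico_mem_nhds_of_Ioo ht)]
    exact hL.derivWithin_nonpos
  · exact (hasDerivWithinAt_integral_Icc zero_le_one
      (hF.continuousOn_slide (hγ t ht') ht' _) hr).const_add _
  -- At `r = 0` the tangential speed is that of the start point, and `|u·ξ| ≤ |u| ≤ M` bounds the
  -- maximum over the segment.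
  · rw [slideSpeed, intervalIntegral.integral_same, add_zero]
    refine hstart.trans (mul_le_mul_of_nonneg_left ?_ hCl.le)
    refine csSup_le ((nonempty_Icc.2 hLt.le).image _) ?_
    rintro _ ⟨s, hs, rfl⟩
    refine (abs_real_inner_le_norm _ _).trans ?_
    rw [IsTameScalar.norm_unitTangent (hF.family.gradPerp_ne t ht' s hs), mul_one]
    exact hM _
  · refine le_of_eq_of_le ?_ hκ
    rw [← integral_rescale (fun s => |levelCurvature (θ t) (x t s)|) (L t)]
    refine intervalIntegral.integral_congr fun r _ => ?_
    simp only [IsTangentCurve.norm_turning, abs_mul, hσ', mul_one, abs_of_pos hLt, rescaledCurve]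
    rw [abs_of_nonneg (show 0 ≤ levelCurvature (θ t) (x t (L t * r)) from norm_nonneg _)]

/-- Growth of the global maximum of `|∇^⊥θ|`. -/
theorem supGradPerp_le_exp (hF : IsControlledFamily θ T₀ T x L c₀ C₀)
    (hL : AntitoneOn L (Ico T₀ T)) {Cu Cl : ℝ} (hCu : IsVelocityConstant θ T₀ T Cu)
    (hC₀ : 0 < C₀) (hCl : 0 < Cl)
    (hκ : ∀ t ∈ Ico T₀ T, (∫ s in (0 : ℝ)..(L t), |levelCurvature (θ t) (x t s)|) ≤ C₀)
    (hstart : ∀ t ∈ Ico T₀ T,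
      |inner ℝ (derivWithin (fun r => x r 0) (Ico T₀ T) t) (unitTangent (θ t) (x t 0))| ≤
        Cl * segmentTangentialSpeed (θ t) (x t) (L t)) {t : ℝ} (ht : t ∈ Ico T₀ T) :
    supGradPerp (θ t) ≤ Real.exp
      (Real.log (constOne C₀ / c₀ * segmentMean (θ T₀) (x T₀) (L T₀)) *
        Real.exp (∫ r in T₀..t, Cu * max (constU C₀) (constV C₀ Cl) / L r)) := by
  set Q : ℝ → ℝ := fun t => segmentMean (θ t) (x t) (L t) with hQ
  set y : ℝ → ℝ := fun t => Real.log (constOne C₀ / c₀ * Q t) with hy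
  set φ : ℝ → ℝ := fun r => Cu * max (constU C₀) (constV C₀ Cl) / L r with hφ
  set Γ : ℝ → ℝ := fun s => ∫ r in T₀..s, φ r with hΓ
  have hc₀ := hF.pos
  have hk : 0 < constOne C₀ / c₀ := div_pos (Real.exp_pos _) hc₀
  have hsub : Icc T₀ t ⊆ Ico T₀ T := Icc_subset_Ico_right ht.2
  have hQpos : ∀ s ∈ Ico T₀ T, 0 < Q s := fun s hs => hF.segmentMean_pos hs
  have hΩpos : ∀ s ∈ Ico T₀ T, 0 < supGradPerp (θ s) := fun s hs => by
    obtain ⟨g, B, hb⟩ := hF.solution.tame (hF.mem_Ico hs)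
    exact (norm_pos_iff.2 (hF.family.gradPerp_ne s hs 0
      ⟨le_rfl, (hF.family.length_pos s hs).le⟩)).trans_le (hb.norm_gradPerp_le_sup _)
  have hlog : ∀ s ∈ Ico T₀ T, Real.log (supGradPerp (θ s)) ≤ y s := fun s hs =>
    Real.log_le_log (hΩpos s hs) (hF.sup_le_mul_segmentMean hs)
  -- The velocity bound itself forces this: a norm is at most `C_u log Ω` with `C_u > 0`.
  have hlog0 : ∀ s ∈ Ico T₀ T, 0 ≤ Real.log (supGradPerp (θ s)) := fun s hs =>
    nonneg_of_mul_nonneg_right ((norm_nonneg _).trans (hCu.2 s hs 0)) hCu.1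
  have hyc : ContinuousOn y (Icc T₀ t) :=
    ((continuousOn_const.mul (hF.continuousOn_segmentMean.mono hsub)).log fun s hs =>
      (mul_pos hk (hQpos s (hsub hs))).ne')
  have hφc : ContinuousOn φ (Icc T₀ t) :=
    continuousOn_const.div (hF.family.length_diff.continuousOn.mono hsub)
      fun s hs => (hF.family.length_pos s (hsub hs)).ne'
  have hΓd : ∀ s ∈ Icc T₀ t, HasDerivWithinAt Γ (φ s) (Icc T₀ t) s := fun s hs =>
    hasDerivWithinAt_integral_Icc ht.1 hφc hs
  have hV : 0 ≤ constV C₀ Cl := by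
    have h1 : 1 ≤ constOne C₀ := Real.one_le_exp hC₀.le
    have h2 : 0 ≤ (constOne C₀ - 1) * (Cl + 1) := mul_nonneg (by linarith) (by linarith)
    have h3 : 0 ≤ C₀ * constOne C₀ := by positivity
    unfold constV
    linarith
  have hyd : ∀ s ∈ Ioo T₀ t, ∃ y', HasDerivAt y y' s ∧ y' ≤ φ s * y s := by
    intro s hs
    have hs' : s ∈ Ioo T₀ T := ⟨hs.1, hs.2.trans ht.2⟩
    have hsI := Ioo_subset_Ico_self hs'
    have hLs := hF.family.length_pos s hsI
    obtain ⟨q, hq, hqle⟩ := hF.exists_hasDerivAt_segmentMean_le hL hs' hCl (hCu.2 s hsI)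
      (hκ s hsI) (hstart s hsI)
    have hQs := hQpos s hsI
    refine ⟨_, (hq.const_mul (constOne C₀ / c₀)).log (mul_pos hk hQs).ne', ?_⟩
    -- The constant factor cancels, so `y' = Q'/Q`; the velocity bound with `log Ω ≤ y` makes the
    -- inequality linear in `y`.
    rw [mul_div_mul_left _ _ hk.ne', div_le_iff₀ hQs]
    refine hqle.trans ?_
    refine mul_le_mul_of_nonneg_right ?_ hQs.le
    have e : φ s * y s = (max (constU C₀) (constV C₀ Cl) * (Cu * y s)) / L s := by
      rw [hφ]; ring
    rw [e]
    have hCu0 := hCu.1.le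
    have h1 := hlog s hsI
    have h2 := hlog0 s hsI
    have h3 : constV C₀ Cl ≤ max (constU C₀) (constV C₀ Cl) := le_max_right _ _
    gcongr
  -- Gronwall by an integrating factor. The derivative is needed only in the open interval;
  -- continuity of `Q` reaches `T₀`.
  have hanti : AntitoneOn (fun s => y s * Real.exp (-Γ s)) (Icc T₀ t) := by
    choose! y' hy' hle using hyd
    have hΓc : ContinuousOn Γ (Icc T₀ t) := fun s hs => (hΓd s hs).continuousWithinAt
    refine antitoneOn_of_hasDerivWithinAt_nonpos (convex_Icc _ _)
      (f' := fun s => y' s * Real.exp (-Γ s) + y s * (Real.exp (-Γ s) * -φ s))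
      (hyc.mul (Real.continuous_exp.comp_continuousOn hΓc.neg)) ?_ ?_
    · rw [interior_Icc]
      intro s hs
      exact (hy' s hs).hasDerivWithinAt.mul
        (((hΓd s (Ioo_subset_Icc_self hs)).mono Ioo_subset_Icc_self).neg.exp)
    · rw [interior_Icc]
      intro s hs
      have := mul_le_mul_of_nonneg_right (hle s hs) (Real.exp_pos (-Γ s)).le
      linarith
  have hfin := hanti (left_mem_Icc.2 ht.1) (right_mem_Icc.2 ht.1) ht.1
  have hΓ0 : Γ T₀ = 0 := intervalIntegral.integral_same
  simp only [hΓ0, neg_zero, Real.exp_zero, mul_one] at hfin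
  rw [Real.exp_neg, ← div_eq_mul_inv, div_le_iff₀ (Real.exp_pos _)] at hfin
  calc supGradPerp (θ t) = Real.exp (Real.log (supGradPerp (θ t))) :=
        (Real.exp_log (hΩpos t ht)).symm
    _ ≤ _ := Real.exp_le_exp.2 ((hlog t ht).trans hfin)

end IsControlledFamily

theorem mainTheorem5 :
    -- the constant `C_u` exists, and depends only on `m` and on the size `K` of the initial datum
    (∀ K m : ℝ, 1 < m → ∃ Cu : ℝ, ∀ (θ : ℝ → Plane → ℝ) (T T₀ : ℝ),
      IsSQGSolution θ T → 0 ≤ T₀ → T₀ < T →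
      (∫ x, |θ 0 x|) ≤ K → (∀ x, |θ 0 x| ≤ K) →
      (∀ t ∈ Ico T₀ T, m ≤ supGradPerp (θ t)) →
      IsVelocityConstant θ T₀ T Cu) ∧
    -- the growth estimate, with every such constant
    (∀ (θ : ℝ → Plane → ℝ) (T T₀ Cu : ℝ),
      IsSQGSolution θ T → 0 ≤ T₀ → T₀ < T → IsVelocityConstant θ T₀ T Cu →
      ∀ (x : ℝ → ℝ → Plane) (L : ℝ → ℝ) (c₀ C₀ Cl : ℝ),
        IsLevelSegmentFamily θ T₀ T x L →
        AntitoneOn L (Ico T₀ T) →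
        0 < c₀ → c₀ ≤ 1 → 0 < C₀ → 0 < Cl →
        (∀ t ∈ Ico T₀ T, c₀ * supGradPerp (θ t) ≤ segmentMax (θ t) (x t) (L t)) →
        (∀ t ∈ Ico T₀ T, ‖gradPerp (θ t) (x t (L t))‖ = segmentMax (θ t) (x t) (L t)) →
        (∀ t ∈ Ico T₀ T, (∫ s in (0 : ℝ)..(L t), |levelCurvature (θ t) (x t s)|) ≤ C₀) →
        (∀ t ∈ Ico T₀ T, (∫ s in (0 : ℝ)..(L t), |tangentDivergence (θ t) (x t s)|) ≤ C₀) →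
        (∀ t ∈ Ico T₀ T,
          |inner ℝ (derivWithin (fun r => x r 0) (Ico T₀ T) t) (unitTangent (θ t) (x t 0))|
            ≤ Cl * segmentTangentialSpeed (θ t) (x t) (L t)) →
        ∀ t ∈ Ico T₀ T,
          supGradPerp (θ t) ≤
            Real.exp
              (Real.log (constOne C₀ / c₀ * segmentMean (θ T₀) (x T₀) (L T₀)) *
                Real.exp (∫ r in T₀..t, Cu * max (constU C₀) (constV C₀ Cl) / L r))) := by
  refine ⟨exists_velocityConstant, ?_⟩
  intro θ T T₀ Cu hθ hT₀ hT hCu x L c₀ C₀ Cl hx hL hc₀ _ hC₀ hCl hsup hend hκ hτ hstart t ht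
  exact IsControlledFamily.supGradPerp_le_exp ⟨hθ, hT₀, hx, hc₀, hsup, hend, hτ⟩ hL hCu hC₀ hCl hκ
    hstart ht
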